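/- Let $\mathcal N$ be a non-compact symplectic manifold (Hausdorff, second countable, without boundary) of dimension $2n$, $n\ge 1$, with symplectic form $\omega$, let $H_0,H\in C^\infty(\mathcal N)$ be real-valued and let $E\in\mathbb R$. Let $X$ be the Hamiltonian vector field of $H$, $\omega(X,\cdot)=-dH$, let $\Phi_t$ be its flow, and put $G=\{H\le E\}$, $A=\{H=E\}$; let $X_0,\Phi^0_t,G_0,A_0$ be the corresponding objects for $H_0$. Assume: (i) $dH(x)\ne 0$ for all $x\in A$ and $dH_0(x)\neq 0$ for all $x\in A_0$; (ii) $\Phi_t$ on $A$ and $\Phi^0_t$ on $A_0$ are defined for all $t\in\mathbb R$; (iii) for every compact $K\subset A_0$ there is $T>0$ such that $\Phi^0_t(x)\notin K$ for all $x\in K$ and $|t|\ge T$; (iv) the sets $G\cap\operatorname{supp}(H-H_0)$ and $G_0\cap\operatorname{supp}(H-H_0)$ are compact; (v) (completeness) the wave operators $W_\pm(x)=\lim_{t\to\pm\infty}\Phi_{-t}\circ\Phi^0_t(x)$, $x\in A_0$, satisfy $W_+(A_0)=W_-(A_0)=A$. Let $\pi:A\to\widetilde A$ be the projection onto the $(2n-2)$-dimensional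 manifold of orbits of $\Phi$ on $A$, with the symplectic form $\widetilde\omega$ determined by $\pi^*\widetilde\omega=\omega|_A$, and define $\pi_0:A_0\to\widetilde A_0$ and $\widetilde\omega_0$ in the same way for $\Phi^0$. Orbit spaces are oriented so that the top power of the symplectic form is positive; for $n=1$ the integral over an orbit space is the sum over the orbits. For open pre-compact sets $\Omega_1\subset\Omega_2\subset\cdots\subset\mathcal N$ with $\bigcup_k\Omega_k=\mathcal N$, let $u_k(x)=\int_{-\infty}^\infty\chi_{\Omega_k}(\Phi_t(x))\,dt$ for $x\in A$ and $u^0_k(x)=\int_{-\infty}^\infty\chi_{\Omega_k}(\Phi^0_t(x))\,dt$ for $x\in A_0$. These functions are constant on orbits; let $\widetilde u_k$, $\widetilde u_k^0$ be the functions on $\widetilde A$, $\widetilde A_0$ with $\widetilde u_k\circ\pi=u_k$, $\widetilde u_k^0\circ\pi_0=u_k^0$. Then, for every such sequence, all these integrals are finite, and the limit $$T_E=\lim_{k\to\infty}\left\{\int_{\widetilde A}\widetilde u_k\,\frac{\widetilde\omega^{n-1}}{(n-1)!}-\int_{\widetilde A_0}\widetilde u_k^0\,\frac{\widetilde\omega_0^{n-1}}{(n-1)!}\right\}$$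 exists and does not depend on the choice of the sequence $\{\Omega_k\}$. Suppose in addition that $\Gamma\subset A_0$ is a global Poincaré section, that is, a smooth submanifold of dimension $2n-2$ with $X_0(x)\notin T_x\Gamma$ for all $x\in\Gamma$, such that for every $x\in A_0$ there are a unique $z\in\Gamma$ and a unique $t\in\mathbb R$ with $x=\Phi^0_t(z)$. Let $S_E=W_+^{-1}\circ W_-:A_0\to A_0$ be the scattering map. Then there are (unique) maps $\widetilde s_E:\Gamma\to\Gamma$ and $\tau_E:\Gamma\to\mathbb R$ with $S_E(\Phi^0_t(z))=\Phi^0_{t-\tau_E(z)}(\widetilde s_E(z))$ for all $z\in\Gamma$, $t\in\mathbb R$; the function $\tau_E$ is integrable and $$T_E=\int_\Gamma\tau_E\,\frac{\omega^{n-1}}{(n-1)!},$$ where $\Gamma$ is oriented so that $\omega^{n-1}|_\Gamma$ is positive. -/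

import Mathlib

open Set Filter Topology MeasureTheory
open scoped Manifold ContDiff

noncomputable section

namespace HamScattering

/-- The model space `ℝ^d`. -/
abbrev Eucl (d : ℕ) : Type := EuclideanSpace ℝ (Fin d)

section Form

variable (n : ℕ) (M : Type*) [TopologicalSpace M] [ChartedSpace (Eucl (2 * n)) M]
  [IsManifold (𝓡 (2 * n)) ∞ M]

/-- A symplectic form on the `2n`-dimensional manifold `M`: a smooth, closed, nondegenerate 2-form.
Smoothness is smoothness of the section of the bundle of bilinear forms on `TM`. -/
structure SymplecticForm where
  toFun : ∀ x : M, TangentSpace (𝓡 (2 * n)) x →L[ℝ] TangentSpace (𝓡 (2 * n)) x →L[ℝ] ℝ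
  smooth : ContMDiff (𝓡 (2 * n))
    ((𝓡 (2 * n)).prod 𝓘(ℝ, Eucl (2 * n) →L[ℝ] Eucl (2 * n) →L[ℝ] ℝ)) ∞
    (fun x ↦ Bundle.TotalSpace.mk' (Eucl (2 * n) →L[ℝ] Eucl (2 * n) →L[ℝ] ℝ)
      (E := fun x : M ↦
        TangentSpace (𝓡 (2 * n)) x →L[ℝ] TangentSpace (𝓡 (2 * n)) x →L[ℝ] ℝ) x (toFun x))
  alternating : ∀ (x : M) (v : TangentSpace (𝓡 (2 * n)) x), toFun x v v = 0
  nondegenerate : ∀ (x : M) (v : TangentSpace (𝓡 (2 * n)) x), (∀ w, toFun x v w = 0) → v = 0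
  /-- `dϖ = 0`, written in the coordinates of each chart: with `ϖ_y(v, w)` the coordinate expression
  of the form, `∂_a ϖ(b, c) + ∂_b ϖ(c, a) + ∂_c ϖ(a, b) = 0`. -/
  closed : ∀ e ∈ atlas (Eucl (2 * n)) M, ∀ y ∈ e.target, ∀ a b c : Eucl (2 * n),
    let loc : Eucl (2 * n) → Eucl (2 * n) → Eucl (2 * n) → ℝ := fun v w z ↦
      toFun (e.symm z) (mfderiv 𝓘(ℝ, Eucl (2 * n)) (𝓡 (2 * n)) e.symm z v)
        (mfderiv 𝓘(ℝ, Eucl (2 * n)) (𝓡 (2 * n)) e.symm z w)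
    fderiv ℝ (loc b c) y a + fderiv ℝ (loc c a) y b + fderiv ℝ (loc a b) y c = 0

end Form

variable {n : ℕ} {M : Type*} [TopologicalSpace M] [ChartedSpace (Eucl (2 * n)) M]
  [IsManifold (𝓡 (2 * n)) ∞ M]

theorem SymplecticForm.exists_eq (ϖ : SymplecticForm n M) (x : M)
    (φ : TangentSpace (𝓡 (2 * n)) x →L[ℝ] ℝ) : ∃ v, ϖ.toFun x v = φ := by
  let V := Eucl (2 * n)
  let f : V →ₗ[ℝ] (V →L[ℝ] ℝ) := (ϖ.toFun x).toLinearMap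
  have hinj : Function.Injective f := by
    rw [← LinearMap.ker_eq_bot, LinearMap.ker_eq_bot']
    intro v hv
    exact ϖ.nondegenerate x v fun w ↦ congrArg (fun g : V →L[ℝ] ℝ ↦ g w) hv
  have hfr : Module.finrank ℝ V = Module.finrank ℝ (V →L[ℝ] ℝ) := by
    rw [← (LinearMap.toContinuousLinearMap (𝕜 := ℝ) (E := V) (F' := ℝ)).finrank_eq]
    exact (Subspace.dual_finrank_eq (K := ℝ) (V := V)).symm
  exact (LinearMap.injective_iff_surjective_of_finrank_eq_finrank hfr).1 hinj φ

/-- The Hamiltonian vector field `X` of `H`, defined by `ϖ(X, ·) = -dH`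
(it is unique, because `ϖ` is nondegenerate). -/
def hamField (ϖ : SymplecticForm n M) (H : M → ℝ) (x : M) : TangentSpace (𝓡 (2 * n)) x :=
  (ϖ.exists_eq x (-(mfderiv (𝓡 (2 * n)) 𝓘(ℝ, ℝ) H x))).choose

theorem hamField_spec (ϖ : SymplecticForm n M) (H : M → ℝ) (x : M) :
    ϖ.toFun x (hamField ϖ H x) = -(mfderiv (𝓡 (2 * n)) 𝓘(ℝ, ℝ) H x) :=
  (ϖ.exists_eq x (-(mfderiv (𝓡 (2 * n)) 𝓘(ℝ, ℝ) H x))).choose_spec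

open Classical in
/-- The Hamiltonian flow `Φ_t(x)`: the value at time `t` of the integral curve of `X` starting
at `x`, when this curve exists for all times (and `x` otherwise). -/
def flow (ϖ : SymplecticForm n M) (H : M → ℝ) (t : ℝ) (x : M) : M :=
  if h : ∃ γ : ℝ → M, γ 0 = x ∧ IsMIntegralCurve (I := 𝓡 (2 * n)) γ (hamField ϖ H)
    then h.choose t else x

/-- The energy surface `A(E) = {H = E}`. -/
def energySurface (H : M → ℝ) (E : ℝ) : Set M := {x | H x = E}

/-- The sublevel set `G(E) = {H ≤ E}`. -/
def sublevel (H : M → ℝ) (E : ℝ) : Set M := {x | H x ≤ E}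

/-- The standing assumptions on the pair `H₀, H` at the energy `E`. -/
structure ScatteringAssumption (ϖ : SymplecticForm n M) (H₀ H : M → ℝ) (E : ℝ) : Prop where
  regular₀ : ∀ x ∈ energySurface H₀ E, mfderiv (𝓡 (2 * n)) 𝓘(ℝ, ℝ) H₀ x ≠ 0
  regular : ∀ x ∈ energySurface H E, mfderiv (𝓡 (2 * n)) 𝓘(ℝ, ℝ) H x ≠ 0
  complete₀ : ∀ x ∈ energySurface H₀ E, ∃ γ : ℝ → M, γ 0 = x ∧
    IsMIntegralCurve (I := 𝓡 (2 * n)) γ (hamField ϖ H₀)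
  complete : ∀ x ∈ energySurface H E, ∃ γ : ℝ → M, γ 0 = x ∧
    IsMIntegralCurve (I := 𝓡 (2 * n)) γ (hamField ϖ H)
  nontrapping : ∀ K ⊆ energySurface H₀ E, IsCompact K →
    ∃ T > 0, ∀ x ∈ K, ∀ t : ℝ, T ≤ |t| → flow ϖ H₀ t x ∉ K
  compact : IsCompact (sublevel H E ∩ tsupport fun x ↦ H x - H₀ x)
  compact₀ : IsCompact (sublevel H₀ E ∩ tsupport fun x ↦ H x - H₀ x)

/-- `W₊(x) = lim_{t → +∞} Φ_{-t} (Φ⁰_t x)`. -/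
def waveOpPlus (ϖ : SymplecticForm n M) (H₀ H : M → ℝ) (x : M) : M :=
  haveI : Nonempty M := ⟨x⟩
  limUnder atTop fun t : ℝ ↦ flow ϖ H (-t) (flow ϖ H₀ t x)

/-- `W₋(x) = lim_{t → -∞} Φ_{-t} (Φ⁰_t x)`. -/
def waveOpMinus (ϖ : SymplecticForm n M) (H₀ H : M → ℝ) (x : M) : M :=
  haveI : Nonempty M := ⟨x⟩
  limUnder atBot fun t : ℝ ↦ flow ϖ H (-t) (flow ϖ H₀ t x)

/-- Completeness of the wave operators: `W₊(A₀(E)) = W₋(A₀(E)) = A(E)`. -/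
def Completeness (ϖ : SymplecticForm n M) (H₀ H : M → ℝ) (E : ℝ) : Prop :=
  waveOpPlus ϖ H₀ H '' energySurface H₀ E = energySurface H E ∧
  waveOpMinus ϖ H₀ H '' energySurface H₀ E = energySurface H E

/-- The scattering map `S_E = W₊⁻¹ ∘ W₋` on `A₀(E)`, where `W₊⁻¹ : A(E) → A₀(E)` is the inverse of
`W₊` restricted to `A₀(E)`. -/
def scatteringMap (ϖ : SymplecticForm n M) (H₀ H : M → ℝ) (E : ℝ) (x : M) : M :=
  haveI : Nonempty M := ⟨x⟩
  Function.invFunOn (waveOpPlus ϖ H₀ H) (energySurface H₀ E) (waveOpMinus ϖ H₀ H x)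

/-- The space `Ã` of orbits of the flow of `H` on `A(E)`, with the quotient topology and its
Borel σ-algebra. -/
def OrbitSpace (ϖ : SymplecticForm n M) (H : M → ℝ) (E : ℝ) : Type _ :=
  Quot fun x y : energySurface H E ↦ ∃ t : ℝ, flow ϖ H t x.1 = y.1

/-- The projection `π : A(E) → Ã`. -/
def orbitProj (ϖ : SymplecticForm n M) (H : M → ℝ) (E : ℝ) (x : energySurface H E) :
    OrbitSpace ϖ H E := Quot.mk _ x

instance (ϖ : SymplecticForm n M) (H : M → ℝ) (E : ℝ) : TopologicalSpace (OrbitSpace ϖ H E) :=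
  inferInstanceAs (TopologicalSpace (Quot _))

instance (ϖ : SymplecticForm n M) (H : M → ℝ) (E : ℝ) : MeasurableSpace (OrbitSpace ϖ H E) :=
  borel _

instance (ϖ : SymplecticForm n M) (H : M → ℝ) (E : ℝ) : BorelSpace (OrbitSpace ϖ H E) := ⟨rfl⟩

/-- The value `(ϖ^m / m!)(v₁, …, v_{2m})` of the exterior power of an alternating bilinear
form `ϖ`, namely `1 / (2^m m!) * ∑_p sign(p) ∏_i ϖ(v_{p(2i-1)}, v_{p(2i)})`. For `m = 0` it is `1`. -/
def extPow {V : Type*} (b : V → V → ℝ) (m : ℕ) (v : Fin (2 * m) → V) : ℝ :=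
  (1 / (2 ^ m * (m.factorial : ℝ))) * ∑ p : Equiv.Perm (Fin (2 * m)),
    ((Equiv.Perm.sign p : ℤ) : ℝ) *
      ∏ i : Fin m, b (v (p ⟨2 * i.1, by omega⟩)) (v (p ⟨2 * i.1 + 1, by omega⟩))

/-- A smooth immersed piece of dimension `2n-2` in `M`, parametrized by an open subset
of `ℝ^(2n-2)`. -/
structure Piece (n : ℕ) (M : Type*) [TopologicalSpace M] [ChartedSpace (Eucl (2 * n)) M]
    [IsManifold (𝓡 (2 * n)) ∞ M] where
  dom : Set (Eucl (2 * (n - 1)))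
  isOpen_dom : IsOpen dom
  map : Eucl (2 * (n - 1)) → M
  smoothOn : ContMDiffOn 𝓘(ℝ, Eucl (2 * (n - 1))) (𝓡 (2 * n)) ∞ map dom
  immersion : ∀ u ∈ dom,
    Function.Injective (mfderiv 𝓘(ℝ, Eucl (2 * (n - 1))) (𝓡 (2 * n)) map u)

/-- The coefficient of `σ^* ϖ^{n-1} / (n-1)!` with respect to `du₁ ∧ … ∧ du_{2n-2}`. -/
def Piece.coeff (ϖ : SymplecticForm n M) (σ : Piece n M) (u : Eucl (2 * (n - 1))) : ℝ :=
  extPow (fun v w : Eucl (2 * (n - 1)) ↦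
      ϖ.toFun (σ.map u)
        (mfderiv 𝓘(ℝ, Eucl (2 * (n - 1))) (𝓡 (2 * n)) σ.map u v)
        (mfderiv 𝓘(ℝ, Eucl (2 * (n - 1))) (𝓡 (2 * n)) σ.map u w)) (n - 1)
    (fun i ↦ EuclideanSpace.single i (1 : ℝ))

/-- Let `f : dom → Y` be the parametrization of a subset of `Y` that is obtained from the piece `σ`.
This is the measure on `Y` obtained by integrating the form `σ^* ϖ^{n-1} / (n-1)!` over the parameter
domain, with the orientation which makes this form positive. -/
def Piece.measure (ϖ : SymplecticForm n M) (σ : Piece n M) {Y : Type*} [MeasurableSpace Y]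
    (f : σ.dom → Y) : Measure Y :=
  (((volume.restrict σ.dom).withDensity fun u ↦ ENNReal.ofReal |σ.coeff ϖ u|).comap
    (Subtype.val : σ.dom → Eucl (2 * (n - 1)))).map f

/-- A parametrized local Poincaré section of the flow of `H` in `A(E)`: a piece of `A(E)` to which
`X` is nowhere tangent and which meets every orbit at most once. The maps `π ∘ σ` are the
(inverses of) charts of the manifold `Ã`. -/
structure LocalSection (ϖ : SymplecticForm n M) (H : M → ℝ) (E : ℝ) extends Piece n M where
  mem : ∀ u ∈ dom, map u ∈ energySurface H E
  transversal : ∀ u ∈ dom, hamField ϖ H (map u) ∉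
    Set.range (mfderiv 𝓘(ℝ, Eucl (2 * (n - 1))) (𝓡 (2 * n)) map u)
  injective : Function.Injective fun u : dom ↦ orbitProj ϖ H E ⟨map u.1, mem u.1 u.2⟩

/-- The symplectic volume `ω̃^{n-1} / (n-1)!` on the reduced space `Ã`, as a measure.
Since `π^* ω̃ = ϖ|_A`, the form `ω̃` reads `σ^* ϖ` in the chart `π ∘ σ` given by a local section `σ`.
So the chart `π ∘ σ` contributes the measure `|σ^* ϖ^{n-1} / (n-1)!|` on its image, and the volume
is the least measure which dominates all the contributions (they agree on overlaps). For `n = 1`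
it is the counting measure on the set of orbits. -/
def reducedVolume (ϖ : SymplecticForm n M) (H : M → ℝ) (E : ℝ) : Measure (OrbitSpace ϖ H E) :=
  ⨆ σ : LocalSection ϖ H E,
    σ.toPiece.measure ϖ fun u : σ.dom ↦ orbitProj ϖ H E ⟨σ.map u.1, σ.mem u.1 u.2⟩

/-- A local parametrization of `Γ ⊆ M`: an immersed piece that is a homeomorphism onto an
open subset of `Γ` (with the topology induced from `M`). -/
structure LocalParam (n : ℕ) {M : Type*} [TopologicalSpace M] [ChartedSpace (Eucl (2 * n)) M]
    [IsManifold (𝓡 (2 * n)) ∞ M] (Γ : Set M) extends Piece n M where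
  mem : ∀ u ∈ dom, map u ∈ Γ
  isOpenEmbedding : IsOpenEmbedding fun u : dom ↦ (⟨map u.1, mem u.1 u.2⟩ : Γ)

/-- `Γ` is a global Poincaré section: a smooth (embedded) submanifold of dimension `2n-2` of `A₀(E)`,
nowhere tangent to `X₀`, such that every `x ∈ A₀(E)` is `Φ⁰_t(z)` for unique `z ∈ Γ` and `t ∈ ℝ`. -/
structure IsPoincareSection (ϖ : SymplecticForm n M) (H₀ : M → ℝ) (E : ℝ) (Γ : Set M) :
    Prop where
  subset : Γ ⊆ energySurface H₀ E
  submanifold : ∀ z ∈ Γ, ∃ σ : LocalParam n Γ, z ∈ σ.map '' σ.dom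
  transversal : ∀ σ : LocalParam n Γ, ∀ u ∈ σ.dom, hamField ϖ H₀ (σ.map u) ∉
    Set.range (mfderiv 𝓘(ℝ, Eucl (2 * (n - 1))) (𝓡 (2 * n)) σ.map u)
  existsUnique : ∀ x ∈ energySurface H₀ E, ∃! p : M × ℝ, p.1 ∈ Γ ∧ flow ϖ H₀ p.2 p.1 = x

/-- The symplectic volume `ϖ^{n-1} / (n-1)!` on a submanifold `Γ` of dimension `2n-2`, as a
measure on `Γ` with the Borel σ-algebra: the least measure which dominates the measures
`|σ^* ϖ^{n-1} / (n-1)!|` of all local parametrizations `σ`. -/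
def sectionVolume (ϖ : SymplecticForm n M) (Γ : Set M) : @Measure Γ (borel Γ) :=
  letI : MeasurableSpace Γ := borel Γ
  ⨆ σ : LocalParam n Γ,
    σ.toPiece.measure ϖ fun u : σ.dom ↦ (⟨σ.map u.1, σ.mem u.1 u.2⟩ : Γ)

/-- In the coordinates `(z, t) ↦ Φ⁰_t(z)` on `A₀(E)`, the scattering map is
`(z, t) ↦ (s(z), t - τ(z))`, with `s : Γ → Γ` the Poincaré scattering map and
`τ : Γ → ℝ` the time delay. -/
def IsTimeDelay (ϖ : SymplecticForm n M) (H₀ H : M → ℝ) (E : ℝ) (Γ : Set M)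
    (s : Γ → Γ) (τ : Γ → ℝ) : Prop :=
  ∀ (z : Γ) (t : ℝ), scatteringMap ϖ H₀ H E (flow ϖ H₀ t z.1) = flow ϖ H₀ (t - τ z) (s z).1

/-- An increasing sequence of open pre-compact sets with union `M`. -/
structure IsExhaustion (Ω : ℕ → Set M) : Prop where
  mono : Monotone Ω
  isOpen : ∀ k, IsOpen (Ω k)
  isCompact_closure : ∀ k, IsCompact (closure (Ω k))
  iUnion_eq : ⋃ k, Ω k = Set.univ

/-- The sojourn time `u(x) = ∫ χ_Ω(Φ_t x) dt`. -/
def sojourn (ϖ : SymplecticForm n M) (H : M → ℝ) (Ω : Set M) (x : M) : ℝ :=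
  ∫ t : ℝ, Ω.indicator (fun _ ↦ (1 : ℝ)) (flow ϖ H t x)

/-- The function `ũ` on `Ã` with `ũ ∘ π = u` (`u` is constant on orbits, so that it does not
matter which point of the orbit is used). -/
def reducedSojourn (ϖ : SymplecticForm n M) (H : M → ℝ) (E : ℝ) (Ω : Set M)
    (y : OrbitSpace ϖ H E) : ℝ :=
  sojourn ϖ H Ω (Quot.out y).1

end HamScattering

end

open HamScattering

/-! Let U be the complement of supp(H - H₀). On U the two Hamiltonians, their fields and, as long as
orbits stay in U, their flows coincide, while A \ U and A₀ \ U are compact. The energy surface A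
carries the Liouville measure λ, which is the symplectic volume of the orbit space times dt along
the orbits; A₀ carries λ₀ in the same way. By Fubini the integral of the reduced sojourn time in Ω
is λ(A ∩ Ω) (`integrable_reducedSojourn`). The measure is local in H, so λ and λ₀ agree on subsets
of U (`liouville_eq_of_subset`). Once Ω_k contains both compact sets, the difference of the two
integrals is therefore exactly λ(A \ U) - λ₀(A₀ \ U), and this number is T_E.

For λ to make sense the reduced volume must not depend on the local section. Two sections through
the same orbit differ by a flow map Φ_T, which is symplectic, and by a displacement along X. The
field X is ϖ-orthogonal to the tangent vectors of A, so the displacement does not change the pulled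
back form, and the densities differ by a Jacobian determinant (`exists_transition`). This rests on
C¹ dependence of the flow on initial values and on the vanishing of the Lie derivative of ϖ along X.

Non-trapping makes Φ⁰_t x stay in U for large |t|, locally uniformly in x. The limits defining W_±
are then attained at finite times, and locally W = Φ_{-t} ∘ Φ⁰_t. With completeness, W_± are
homeomorphisms from A₀ to A which conjugate the flows, carry λ₀ to λ, and transfer non-trapping from
H₀ to H.

For the time delay, let D ⊂ A₀ be the points at or after the section Γ. The scattering map S
preserves λ₀ and satisfies W₊ ∘ S = W₋. On D the map W₊ is the identity outside a compact set, and
so is W₋ on the complement of D. Cutting W₋⁻¹(Ω_k) along S⁻¹D and Ω_k along D therefore gives T_E =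
λ₀(D \ S⁻¹D) - λ₀(S⁻¹D \ D) in the limit (`measure_displacement_eq`). On the orbit through z in Γ
the first set is the time interval [0, τ(z)) and the second is [τ(z), 0), so the two volumes are the
integrals of the positive and the negative part of τ. -/

noncomputable section

namespace HamScattering

variable {n : ℕ} {M : Type*} [TopologicalSpace M] [ChartedSpace (Eucl (2 * n)) M]
  [IsManifold (𝓡 (2 * n)) ∞ M]

/-! ### Differentiable dependence of solutions of an ODE on the initial value. -/

section LocalFlow

variable {F : Type*} [NormedAddCommGroup F] [NormedSpace ℝ F]

theorem gronwallBound_zero_mul (K ε x : ℝ) :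
    gronwallBound 0 K ε x = ε * gronwallBound 0 K 1 x := by
  unfold gronwallBound
  split_ifs <;> ring

/-- Grönwall estimate for the first order expansion of solutions of an autonomous ODE in
the initial value. -/
theorem norm_sub_sub_variation_le {f : F → F} {D : F → F →L[ℝ] F} {y₀ : F} {ρ : ℝ} {K : NNReal}
    {C : ℝ} (hC : 0 ≤ C) (hlip : LipschitzOnWith K f (Metric.ball y₀ ρ))
    (hquad : ∀ x ∈ Metric.ball y₀ ρ, ∀ z ∈ Metric.ball y₀ ρ,
      ‖f z - f x - D x (z - x)‖ ≤ C * ‖z - x‖ ^ 2)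
    {α β : ℝ → F} {J : ℝ → F →L[ℝ] F} {h : F} {T : ℝ}
    (hα : ∀ t ∈ Icc 0 T, HasDerivAt α (f (α t)) t) (hβ : ∀ t ∈ Icc 0 T, HasDerivAt β (f (β t)) t)
    (hJ : ∀ t ∈ Icc 0 T, HasDerivAt J ((D (α t)).comp (J t)) t)
    (hαm : ∀ t ∈ Icc 0 T, α t ∈ Metric.ball y₀ (ρ / 2))
    (hβm : ∀ t ∈ Icc 0 T, β t ∈ Metric.ball y₀ ρ) (hJn : ∀ t ∈ Icc 0 T, ‖J t‖ ≤ 2)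
    (hh : 2 * ‖h‖ < ρ / 2) (h0 : β 0 = α 0 + h) (hJ0 : J 0 = ContinuousLinearMap.id ℝ F)
    {t : ℝ} (ht : t ∈ Icc 0 T) :
    ‖β t - α t - J t h‖ ≤ (4 * C * gronwallBound 0 K 1 t) * ‖h‖ ^ 2 := by
  have hJh : ∀ s ∈ Icc 0 T, ‖J s h‖ ≤ 2 * ‖h‖ := fun s hs ↦
    ((J s).le_opNorm h).trans (by gcongr; exact hJn s hs)
  have hzm : ∀ s ∈ Icc 0 T, α s + J s h ∈ Metric.ball y₀ ρ := by
    intro s hs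
    have h1 := hαm s hs
    rw [mem_ball_iff_norm] at h1 ⊢
    calc ‖α s + J s h - y₀‖ = ‖(α s - y₀) + J s h‖ := by congr 1; abel
      _ ≤ ‖α s - y₀‖ + ‖J s h‖ := norm_add_le _ _
      _ < ρ := by linarith [hJh s hs]
  have hzd : ∀ s ∈ Icc 0 T, HasDerivAt (fun s ↦ α s + J s h)
      (f (α s) + D (α s) (J s h)) s := by
    intro s hs
    have h1 := (hJ s hs).clm_apply (hasDerivAt_const s h)
    simpa using! (hα s hs).add h1
  have hsub : Ico (0 : ℝ) T ⊆ Icc 0 T := Ico_subset_Icc_self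
  have hρ : 0 ≤ ρ / 2 := (by positivity : 0 ≤ 2 * ‖h‖).trans hh.le
  -- The curve α + J h starts at the same point as β and solves the equation up to the quadratic
  -- remainder of f at α, which is at most C (2‖h‖)² because ‖J‖ ≤ 2.
  have key := dist_le_of_approx_trajectories_ODE_of_mem (v := fun _ ↦ f)
    (s := fun _ ↦ Metric.ball y₀ ρ) (K := K) (f := β) (g := fun s ↦ α s + J s h) (a := 0) (b := T)
    (εf := 0) (εg := C * (2 * ‖h‖) ^ 2) (δ := 0) (f' := fun s ↦ f (β s))
    (g' := fun s ↦ f (α s) + D (α s) (J s h))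
    (fun _ _ ↦ hlip) (fun s hs ↦ (hβ s hs).continuousAt.continuousWithinAt)
    (fun s hs ↦ (hβ s (hsub hs)).hasDerivWithinAt) (fun s _ ↦ by simp)
    (fun s hs ↦ hβm s (hsub hs)) (fun s hs ↦ (hzd s hs).continuousAt.continuousWithinAt)
    (fun s hs ↦ (hzd s (hsub hs)).hasDerivWithinAt)
    (fun s hs ↦ by
      have hs' := hsub hs
      have h1 := hquad (α s) (Metric.ball_subset_ball (by linarith) (hαm s hs')) _ (hzm s hs')
      rw [dist_comm, dist_eq_norm]
      have h2 : f (α s + J s h) - (f (α s) + D (α s) (J s h)) =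
          f (α s + J s h) - f (α s) - D (α s) (α s + J s h - α s) := by
        rw [add_sub_cancel_left]; abel
      rw [h2]
      refine h1.trans ?_
      rw [add_sub_cancel_left]
      gcongr
      exact hJh s hs')
    (fun s hs ↦ hzm s (hsub hs)) (by simp [h0, hJ0]) t ht
  rw [dist_eq_norm, gronwallBound_zero_mul] at key
  calc ‖β t - α t - J t h‖ = ‖β t - (α t + J t h)‖ := by congr 1; abel
    _ ≤ _ := key
    _ = _ := by rw [sub_zero]; ring

/-- Two-sided version of `norm_sub_sub_variation_le`, as a derivative. -/
theorem hasFDerivAt_of_variation {f : F → F} {D : F → F →L[ℝ] F} {y₀ : F} {ρ : ℝ} {K : NNReal}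
    {C : ℝ} (hC : 0 ≤ C) (hρ : 0 < ρ) (hlip : LipschitzOnWith K f (Metric.ball y₀ ρ))
    (hquad : ∀ x ∈ Metric.ball y₀ ρ, ∀ z ∈ Metric.ball y₀ ρ,
      ‖f z - f x - D x (z - x)‖ ≤ C * ‖z - x‖ ^ 2)
    {φ : ℝ → F → F} {J : ℝ → F → F →L[ℝ] F} {ε : ℝ} {N : Set F}
    (h0 : ∀ y ∈ N, φ 0 y = y) (hJ0 : ∀ y ∈ N, J 0 y = ContinuousLinearMap.id ℝ F)
    (hφ : ∀ y ∈ N, ∀ t ∈ Ioo (-ε) ε, HasDerivAt (φ · y) (f (φ t y)) t)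
    (hJ : ∀ y ∈ N, ∀ t ∈ Ioo (-ε) ε, HasDerivAt (J · y) ((D (φ t y)).comp (J t y)) t)
    (hm : ∀ y ∈ N, ∀ t ∈ Ioo (-ε) ε, φ t y ∈ Metric.ball y₀ (ρ / 2))
    (hJn : ∀ y ∈ N, ∀ t ∈ Ioo (-ε) ε, ‖J t y‖ ≤ 2)
    {y : F} (hy : N ∈ 𝓝 y) {t : ℝ} (ht : t ∈ Ioo (-ε) ε) :
    HasFDerivAt (φ t) (J t y) y := by
  have hyN := mem_of_mem_nhds hy
  obtain ⟨B, hB⟩ : ∃ B : ℝ, ∀ z ∈ N, 2 * ‖z - y‖ < ρ / 2 →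
      ‖φ t z - φ t y - J t y (z - y)‖ ≤ B * ‖z - y‖ ^ 2 := by
    have hbb : Metric.ball y₀ (ρ / 2) ⊆ Metric.ball y₀ ρ := Metric.ball_subset_ball (by linarith)
    rcases le_total 0 t with h | h
    · have hI : Icc 0 t ⊆ Ioo (-ε) ε := fun s hs ↦ ⟨by linarith [ht.1, ht.2, hs.1, hs.2], by
        linarith [ht.1, ht.2, hs.1, hs.2]⟩
      refine ⟨_, fun z hz hzy ↦ norm_sub_sub_variation_le hC hlip hquad
        (fun s hs ↦ hφ y hyN s (hI hs)) (fun s hs ↦ hφ z hz s (hI hs))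
        (fun s hs ↦ hJ y hyN s (hI hs)) (fun s hs ↦ hm y hyN s (hI hs))
        (fun s hs ↦ hbb (hm z hz s (hI hs))) (fun s hs ↦ hJn y hyN s (hI hs)) hzy
        (by rw [h0 y hyN, h0 z hz]; abel) (hJ0 y hyN) (right_mem_Icc.2 h)⟩
    -- Negative times are reduced to positive ones: s ↦ φ (-s) and s ↦ J (-s) solve the same kind of
    -- system for -f and -D.
    · have hI : ∀ s ∈ Icc 0 (-t), -s ∈ Ioo (-ε) ε := fun s hs ↦
        ⟨by linarith [ht.1, ht.2, hs.1, hs.2], by linarith [ht.1, ht.2, hs.1, hs.2]⟩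
      have hd : ∀ z ∈ N, ∀ s ∈ Icc 0 (-t), HasDerivAt (fun s ↦ φ (-s) z) (-f (φ (-s) z)) s :=
        fun z hz s hs ↦ by
          have := HasDerivAt.scomp (g₁ := (φ · z)) s (hφ z hz (-s) (hI s hs)) (hasDerivAt_neg s)
          simpa using! this
      have hdJ : ∀ s ∈ Icc 0 (-t),
          HasDerivAt (fun s ↦ J (-s) y) ((-D (φ (-s) y)).comp (J (-s) y)) s :=
        fun s hs ↦ by
          have := HasDerivAt.scomp (g₁ := (J · y)) s (hJ y hyN (-s) (hI s hs)) (hasDerivAt_neg s)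
          simpa using! this
      refine ⟨4 * C * gronwallBound 0 K 1 (-t), fun z hz hzy ↦ ?_⟩
      have := norm_sub_sub_variation_le (f := fun x ↦ -f x) (D := fun x ↦ -D x)
        (α := fun s ↦ φ (-s) y) (β := fun s ↦ φ (-s) z) (J := fun s ↦ J (-s) y) hC (y₀ := y₀)
        (ρ := ρ) (K := K)
        (by
          refine LipschitzOnWith.of_dist_le_mul fun a ha b hb ↦ ?_
          rw [dist_neg_neg]; exact hlip.dist_le_mul a ha b hb)
        (fun x hx z hz ↦ by
          have e : -f z - -f x - (-D x) (z - x) = -(f z - f x - D x (z - x)) := by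
            rw [show (-D x) (z - x) = -(D x (z - x)) from rfl]
            abel
          rw [e, norm_neg]
          exact hquad x hx z hz)
        (fun s hs ↦ hd y hyN s hs) (fun s hs ↦ hd z hz s hs) hdJ
        (fun s hs ↦ hm y hyN _ (hI s hs))
        (fun s hs ↦ hbb (hm z hz _ (hI s hs))) (fun s hs ↦ hJn y hyN _ (hI s hs)) hzy
        (by simp only [neg_zero]; rw [h0 y hyN, h0 z hz]; abel) (by simpa using! hJ0 y hyN)
        (right_mem_Icc.2 (by linarith : 0 ≤ -t))
      simpa using! this
  have hO : (fun z ↦ φ t z - φ t y - J t y (z - y)) =O[𝓝 y] fun z ↦ ‖z - y‖ ^ 2 := by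
    refine Asymptotics.IsBigO.of_bound B ?_
    have hc : Tendsto (fun z : F ↦ 2 * ‖z - y‖) (𝓝 y) (𝓝 0) := by
      have : Continuous fun z : F ↦ 2 * ‖z - y‖ := by fun_prop
      simpa using this.tendsto y
    filter_upwards [hy, hc.eventually (gt_mem_nhds (by linarith : 0 < ρ / 2))] with z hz hz2
    simpa using hB z hz hz2
  refine HasFDerivAt.of_isLittleO (hO.trans_isLittleO ?_)
  have h1 : (fun z : F ↦ ‖z - y‖ ^ 2) =o[𝓝 y] fun z ↦ ‖z - y‖ := by
    have hc : Tendsto (fun z : F ↦ ‖z - y‖) (𝓝 y) (𝓝 0) := by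
      have : Continuous fun z : F ↦ ‖z - y‖ := by fun_prop
      simpa using this.tendsto y
    have := (Asymptotics.isLittleO_pow_id (𝕜 := ℝ) (n := 2) (by norm_num)).comp_tendsto hc
    simpa [Function.comp_def] using! this
  exact h1.of_norm_right

/-- A `C²` vector field has a local flow which is `C¹` in time and initial value, whose derivative
in the initial value solves the variational equation. -/
theorem exists_local_flow [CompleteSpace F] {f : F → F} {y₀ : F} (hf : ContDiffAt ℝ 2 f y₀)
    {O : Set F} (hO : O ∈ 𝓝 y₀) :
    ∃ ε > 0, ∃ r > 0, ∃ (φ : ℝ → F → F) (J : ℝ → F → F →L[ℝ] F),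
      (∀ y ∈ Metric.ball y₀ r, φ 0 y = y ∧ J 0 y = ContinuousLinearMap.id ℝ F ∧
        ∀ t ∈ Ioo (-ε) ε, φ t y ∈ O ∧ HasDerivAt (φ · y) (f (φ t y)) t ∧
          HasDerivAt (J · y) ((fderiv ℝ f (φ t y)).comp (J t y)) t ∧
          HasFDerivAt (φ t) (J t y) y) ∧
      ContDiffOn ℝ 1 (fun p : ℝ × F ↦ φ p.1 p.2) (Ioo (-ε) ε ×ˢ Metric.ball y₀ r) := by
  -- the system for the flow and its derivative
  let V : F × (F →L[ℝ] F) → F × (F →L[ℝ] F) := fun p ↦ (f p.1, (fderiv ℝ f p.1).comp p.2)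
  let i : F →L[ℝ] F := ContinuousLinearMap.id ℝ F
  have hfd : ContDiffAt ℝ 1 (fderiv ℝ f) y₀ := hf.fderiv_right (by norm_num)
  have hV : ContDiffAt ℝ 1 V (y₀, i) := by
    have h1 : ContDiffAt ℝ 1 (fun p : F × (F →L[ℝ] F) ↦ f p.1) (y₀, i) :=
      ContDiffAt.comp (y₀, i) (hf.of_le (by norm_num)) contDiffAt_fst
    have h2 : ContDiffAt ℝ 1 (fun p : F × (F →L[ℝ] F) ↦ fderiv ℝ f p.1) (y₀, i) :=
      ContDiffAt.comp (y₀, i) hfd contDiffAt_fst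
    exact h1.prodMk (h2.clm_comp contDiffAt_snd)
  -- The augmented field V is C¹ because f is C². Its solutions started at (y, id) depend
  -- continuously on y, so the candidate J for the derivative is continuous; the Grönwall estimate
  -- then shows that it is the derivative.
  obtain ⟨ε₀, hε₀, a, r₀, L, K₀, hr₀, hpl⟩ := IsPicardLindelof.of_contDiffAt_one hV
  obtain ⟨A, hA, hAc⟩ := (hpl 0).exists_forall_mem_closedBall_eq_hasDerivWithinAt_continuousOn
  -- regularity constants of `f`
  obtain ⟨K, s₁, hs₁, hlip⟩ := (hf.of_le (by norm_num : (1 : ℕ∞ω) ≤ 2)).exists_lipschitzOnWith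
  obtain ⟨C, s₂, hs₂, hlip'⟩ := hfd.exists_lipschitzOnWith
  have hdiff : ∀ᶠ x in 𝓝 y₀, DifferentiableAt ℝ f x := by
    filter_upwards [hf.eventually (by norm_num)] with x hx
    exact hx.differentiableAt (by norm_num)
  obtain ⟨ρ, hρ, hρs⟩ := Metric.mem_nhds_iff.1 (inter_mem (inter_mem hs₁ hs₂) hdiff)
  have hquad : ∀ x ∈ Metric.ball y₀ ρ, ∀ z ∈ Metric.ball y₀ ρ,
      ‖f z - f x - fderiv ℝ f x (z - x)‖ ≤ C * ‖z - x‖ ^ 2 := by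
    intro x hx z hz
    have := Convex.norm_image_sub_le_of_norm_hasFDerivWithin_le' (𝕜 := ℝ) (f := f)
      (f' := fderiv ℝ f) (φ := fderiv ℝ f x) (C := C * ‖z - x‖) (s := segment ℝ x z) (x := x)
      (y := z)
      (fun w hw ↦ ((hρs ((convex_ball y₀ ρ).segment_subset hx hz hw)).2.hasFDerivAt
        ).hasFDerivWithinAt)
      (fun w hw ↦ by
        have h1 := hlip'.norm_sub_le (hρs ((convex_ball y₀ ρ).segment_subset hx hz hw)).1.2
          (hρs hx).1.2
        refine h1.trans ?_
        gcongr
        exact norm_sub_le_of_mem_segment hw)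
      (convex_segment x z) (left_mem_segment ℝ x z) (right_mem_segment ℝ x z)
    refine this.trans (le_of_eq (by ring))
  -- shrink
  let N : Set (F × (F →L[ℝ] F)) := (Metric.ball y₀ (ρ / 2) ∩ O) ×ˢ Metric.ball 0 2
  -- In N the second component has norm below 2, as `hasFDerivAt_of_variation` demands; this is
  -- possible for short times since J starts at the identity, of norm at most 1.
  have hN : N ∈ 𝓝 (y₀, i) := by
    refine prod_mem_nhds (inter_mem (Metric.ball_mem_nhds _ (by linarith)) hO)
      (Metric.isOpen_ball.mem_nhds ?_)
    rw [mem_ball_zero_iff]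
    exact (ContinuousLinearMap.norm_id_le).trans_lt (by norm_num)
  have hc0 : ContinuousAt A ((y₀, i), 0) :=
    hAc.continuousAt (prod_mem_nhds (Metric.closedBall_mem_nhds _ hr₀)
      (Icc_mem_nhds (by linarith) (by linarith)))
  have hA0 : A ((y₀, i), 0) = (y₀, i) := (hA _ (Metric.mem_closedBall_self hr₀.le)).1
  have hι : Continuous fun p : ℝ × F ↦ (((p.2, i), p.1) : (F × (F →L[ℝ] F)) × ℝ) := by fun_prop
  have hpre : (fun p : ℝ × F ↦ A ((p.2, i), p.1)) ⁻¹' N ∈ 𝓝 ((0 : ℝ), y₀) := by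
    have h1 : ContinuousAt (fun p : ℝ × F ↦ A ((p.2, i), p.1)) (0, y₀) :=
      ContinuousAt.comp (f := fun p : ℝ × F ↦ (((p.2, i), p.1) : (F × (F →L[ℝ] F)) × ℝ))
        (x := ((0 : ℝ), y₀)) hc0 hι.continuousAt
    exact h1.preimage_mem_nhds (by rw [hA0]; exact hN)
  obtain ⟨δ, hδ, hδN⟩ := Metric.mem_nhds_iff.1 hpre
  let ε := min δ ε₀
  let r := min δ r₀
  have hε : 0 < ε := lt_min hδ hε₀
  have hr : 0 < r := lt_min hδ hr₀
  have hball : ∀ y ∈ Metric.ball y₀ r, (y, i) ∈ Metric.closedBall (y₀, i) r₀ := by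
    intro y hy
    rw [Metric.mem_closedBall, Prod.dist_eq]
    simp only [dist_self]
    exact max_le ((Metric.mem_ball.1 hy).le.trans (min_le_right _ _)) r₀.2
  have hmemN : ∀ y ∈ Metric.ball y₀ r, ∀ t ∈ Ioo (-ε) ε, A ((y, i), t) ∈ N := by
    intro y hy t ht
    refine hδN (?_ : (t, y) ∈ Metric.ball ((0 : ℝ), y₀) δ)
    rw [Metric.mem_ball, Prod.dist_eq]
    refine max_lt ?_ ((Metric.mem_ball.1 hy).trans_le (min_le_left _ _))
    rw [Real.dist_eq, sub_zero]
    exact (abs_lt.2 ht).trans_le (min_le_left _ _)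
  have hI : ∀ t ∈ Ioo (-ε) ε, t ∈ Ioo (0 - ε₀) (0 + ε₀) := fun t ht ↦
    ⟨by linarith [ht.1, min_le_right δ ε₀], by linarith [ht.2, min_le_right δ ε₀]⟩
  have hder : ∀ y ∈ Metric.ball y₀ r, ∀ t ∈ Ioo (-ε) ε,
      HasDerivAt (fun t ↦ A ((y, i), t)) (V (A ((y, i), t))) t := fun y hy t ht ↦
    ((hA _ (hball y hy)).2 t (Ioo_subset_Icc_self (hI t ht))).hasDerivAt
      (Icc_mem_nhds (hI t ht).1 (hI t ht).2)
  let φ : ℝ → F → F := fun t y ↦ (A ((y, i), t)).1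
  let J : ℝ → F → F →L[ℝ] F := fun t y ↦ (A ((y, i), t)).2
  have hφd : ∀ y ∈ Metric.ball y₀ r, ∀ t ∈ Ioo (-ε) ε, HasDerivAt (φ · y) (f (φ t y)) t :=
    fun y hy t ht ↦ (hder y hy t ht).fst
  have hJd : ∀ y ∈ Metric.ball y₀ r, ∀ t ∈ Ioo (-ε) ε,
      HasDerivAt (J · y) ((fderiv ℝ f (φ t y)).comp (J t y)) t :=
    fun y hy t ht ↦ (hder y hy t ht).snd
  have h00 : ∀ y ∈ Metric.ball y₀ r, A ((y, i), 0) = (y, i) := fun y hy ↦ (hA _ (hball y hy)).1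
  have hφ0 : ∀ y ∈ Metric.ball y₀ r, φ 0 y = y := fun y hy ↦ congrArg Prod.fst (h00 y hy)
  have hJ0 : ∀ y ∈ Metric.ball y₀ r, J 0 y = i := fun y hy ↦ congrArg Prod.snd (h00 y hy)
  have hspace : ∀ y ∈ Metric.ball y₀ r, ∀ t ∈ Ioo (-ε) ε, HasFDerivAt (φ t) (J t y) y := by
    intro y hy t ht
    exact hasFDerivAt_of_variation (D := fderiv ℝ f) (C := C) C.2 hρ
      (hlip.mono fun x hx ↦ (hρs hx).1.1) hquad hφ0 hJ0 hφd hJd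
      (fun y hy t ht ↦ (hmemN y hy t ht).1.1)
      (fun y hy t ht ↦ (mem_ball_zero_iff.1 (hmemN y hy t ht).2).le)
      (Metric.isOpen_ball.mem_nhds hy) ht
  refine ⟨ε, hε, r, hr, φ, J, fun y hy ↦ ⟨hφ0 y hy, hJ0 y hy, fun t ht ↦
    ⟨(hmemN y hy t ht).1.2, hφd y hy t ht, hJd y hy t ht, hspace y hy t ht⟩⟩, ?_⟩
  -- joint regularity
  have hS : IsOpen (Ioo (-ε) ε ×ˢ Metric.ball y₀ r) := isOpen_Ioo.prod Metric.isOpen_ball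
  have hAcont : ContinuousOn (fun p : ℝ × F ↦ A ((p.2, i), p.1))
      (Ioo (-ε) ε ×ˢ Metric.ball y₀ r) :=
    hAc.comp hι.continuousOn fun p hp ↦
      ⟨hball _ hp.2, Ioo_subset_Icc_self (hI _ hp.1)⟩
  have hfc : ContinuousOn (fun p : ℝ × F ↦ f (φ p.1 p.2)) (Ioo (-ε) ε ×ˢ Metric.ball y₀ r) := by
    refine ContinuousOn.comp (g := f) (t := Metric.ball y₀ ρ)
      (hlip.continuousOn.mono fun x hx ↦ (hρs hx).1.1) hAcont.fst fun p hp ↦ ?_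
    exact Metric.ball_subset_ball (by linarith) (hmemN _ hp.2 _ hp.1).1.1
  let f₁ : ℝ → F → ℝ →L[ℝ] F := fun t y ↦ (1 : ℝ →L[ℝ] ℝ).smulRight (f (φ t y))
  have hf₁ : ContinuousOn (fun p : ℝ × F ↦ f₁ p.1 p.2) (Ioo (-ε) ε ×ˢ Metric.ball y₀ r) :=
    ((ContinuousLinearMap.smulRightL ℝ ℝ F 1).continuous.comp_continuousOn hfc)
  have hstrict : ∀ p ∈ Ioo (-ε) ε ×ˢ Metric.ball y₀ r,
      HasStrictFDerivAt (fun p : ℝ × F ↦ φ p.1 p.2) ((f₁ p.1 p.2).coprod (J p.1 p.2)) p := by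
    intro p hp
    refine hasStrictFDerivAt_uncurry_coprod (f := φ) (f₁ := f₁) (f₂ := J) ?_ ?_
      (hf₁.continuousAt (hS.mem_nhds hp)) (hAcont.snd.continuousAt (hS.mem_nhds hp))
    · filter_upwards [hS.mem_nhds hp] with q hq
      exact (hφd q.2 hq.2 q.1 hq.1).hasFDerivAt
    · filter_upwards [hS.mem_nhds hp] with q hq
      exact hspace q.2 hq.2 q.1 hq.1
  have hfder : ContinuousOn (fderiv ℝ fun p : ℝ × F ↦ φ p.1 p.2)
      (Ioo (-ε) ε ×ˢ Metric.ball y₀ r) := by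
    have h1 : ContinuousOn (fun p : ℝ × F ↦ (f₁ p.1 p.2).coprod (J p.1 p.2))
        (Ioo (-ε) ε ×ˢ Metric.ball y₀ r) := by
      have : (fun p : ℝ × F ↦ (f₁ p.1 p.2).coprod (J p.1 p.2)) = fun p ↦
          (f₁ p.1 p.2).comp (ContinuousLinearMap.fst ℝ ℝ F) +
          (J p.1 p.2).comp (ContinuousLinearMap.snd ℝ ℝ F) := by
        ext p <;> simp
      rw [this]
      exact (hf₁.clm_comp continuousOn_const).add (hAcont.snd.clm_comp continuousOn_const)
    exact h1.congr fun p hp ↦ (hstrict p hp).hasFDerivAt.fderiv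
  have := (contDiffOn_succ_iff_fderiv_of_isOpen (𝕜 := ℝ) (n := 0)
    (f := fun p : ℝ × F ↦ φ p.1 p.2) hS).2
    ⟨fun p hp ↦ (hstrict p hp).hasFDerivAt.differentiableAt.differentiableWithinAt, by simp,
      contDiffOn_zero.2 hfder⟩
  simpa using this

end LocalFlow

/-! ### Smoothness of pullbacks of the symplectic form. -/

section Pullback

variable {F : Type*} [NormedAddCommGroup F] [NormedSpace ℝ F]

theorem contMDiffOn_mfderiv_apply {f : F → M} {s : Set F} (hs : IsOpen s)
    (hf : ContMDiffOn 𝓘(ℝ, F) (𝓡 (2 * n)) ∞ f s) {V : F → F} (hV : ContDiffOn ℝ ∞ V s) :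
    ContMDiffOn 𝓘(ℝ, F) (𝓡 (2 * n)).tangent ∞
      (fun y ↦ (Bundle.TotalSpace.mk' (Eucl (2 * n)) (f y)
        (mfderiv 𝓘(ℝ, F) (𝓡 (2 * n)) f y (V y)) : TangentBundle (𝓡 (2 * n)) M)) s := by
  have h1 := hf.contMDiffOn_tangentMapWithin (m := ∞) le_rfl hs.uniqueMDiffOn
  have h2 : ContMDiffOn 𝓘(ℝ, F) (𝓘(ℝ, F)).tangent ∞
      (fun y ↦ (⟨y, V y⟩ : TangentBundle 𝓘(ℝ, F) F)) s := by
    intro y hy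
    rw [Bundle.contMDiffWithinAt_totalSpace]
    refine ⟨contMDiffWithinAt_id, ?_⟩
    simpa using! (hV y hy).contMDiffWithinAt
  have h3 := h1.comp h2 (fun y hy ↦ hy)
  refine h3.congr fun y hy ↦ ?_
  simp only [Function.comp, tangentMapWithin]
  rw [mfderivWithin_of_isOpen hs hy]

/-- The smooth section ϖ of the bundle of bilinear forms is contracted with two smooth vector fields
along f. With f a chart inverse this gives the coordinate form, with f a piece it gives the density
of its volume. -/
theorem contDiffOn_pullback (ϖ : SymplecticForm n M) {f : F → M} {s : Set F} (hs : IsOpen s)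
    (hf : ContMDiffOn 𝓘(ℝ, F) (𝓡 (2 * n)) ∞ f s) (v w : F) :
    ContDiffOn ℝ ∞ (fun y ↦ ϖ.toFun (f y) (mfderiv 𝓘(ℝ, F) (𝓡 (2 * n)) f y v)
      (mfderiv 𝓘(ℝ, F) (𝓡 (2 * n)) f y w)) s := by
  have hv := contMDiffOn_mfderiv_apply hs hf (V := fun _ ↦ v) contDiffOn_const
  have hw := contMDiffOn_mfderiv_apply hs hf (V := fun _ ↦ w) contDiffOn_const
  have hψ := ϖ.smooth.comp_contMDiffOn hf
  intro y hy
  rw [← contMDiffWithinAt_iff_contDiffWithinAt]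
  have : ContMDiffWithinAt 𝓘(ℝ, F) ((𝓡 (2 * n)).prod 𝓘(ℝ, ℝ)) ∞
      (fun m ↦ Bundle.TotalSpace.mk' ℝ (E := Bundle.Trivial M ℝ) (f m)
        (ϖ.toFun (f m) (mfderiv 𝓘(ℝ, F) (𝓡 (2 * n)) f m v)
          (mfderiv 𝓘(ℝ, F) (𝓡 (2 * n)) f m w))) s y :=
    ContMDiffWithinAt.clm_bundle_apply₂ (F₁ := Eucl (2 * n)) (F₂ := Eucl (2 * n))
      (hψ y hy) (hv y hy) (hw y hy)
  rw [Bundle.contMDiffWithinAt_totalSpace] at this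
  exact this.2

end Pullback

/-! ### The symplectic form and the Hamiltonian field in a chart. -/

section Chart

variable (ϖ : SymplecticForm n M) (H : M → ℝ) (e : OpenPartialHomeomorph M (Eucl (2 * n)))

/-- The derivative of the inverse of the chart `e`. -/
def chartInv (y : Eucl (2 * n)) : Eucl (2 * n) →L[ℝ] TangentSpace (𝓡 (2 * n)) (e.symm y) :=
  mfderiv 𝓘(ℝ, Eucl (2 * n)) (𝓡 (2 * n)) e.symm y

/-- The coordinate expression of the symplectic form in the chart `e`. -/
def chartForm (y : Eucl (2 * n)) : Eucl (2 * n) →L[ℝ] Eucl (2 * n) →L[ℝ] ℝ :=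
  let B : Eucl (2 * n) →L[ℝ] Eucl (2 * n) →L[ℝ] ℝ := ϖ.toFun (e.symm y)
  let D : Eucl (2 * n) →L[ℝ] Eucl (2 * n) := chartInv e y
  B.bilinearComp D D

/-- The coordinate expression of the Hamiltonian vector field in the chart `e`. -/
def chartField (y : Eucl (2 * n)) : Eucl (2 * n) :=
  mfderiv (𝓡 (2 * n)) 𝓘(ℝ, Eucl (2 * n)) e (e.symm y) (hamField ϖ H (e.symm y))

variable {e} (he : e ∈ atlas (Eucl (2 * n)) M) {y : Eucl (2 * n)} (hy : y ∈ e.target)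

include he in
theorem chart_contMDiffOn_symm : ContMDiffOn 𝓘(ℝ, Eucl (2 * n)) (𝓡 (2 * n)) ∞ e.symm e.target :=
  contMDiffOn_symm_of_mem_maximalAtlas
    (IsManifold.subset_maximalAtlas he : e ∈ IsManifold.maximalAtlas (𝓡 (2 * n)) ∞ M)

include he in
theorem chart_contMDiffOn : ContMDiffOn (𝓡 (2 * n)) 𝓘(ℝ, Eucl (2 * n)) ∞ e e.source :=
  contMDiffOn_of_mem_maximalAtlas
    (IsManifold.subset_maximalAtlas he : e ∈ IsManifold.maximalAtlas (𝓡 (2 * n)) ∞ M)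

include he in
theorem chart_mdifferentiable : e.MDifferentiable (𝓡 (2 * n)) 𝓘(ℝ, Eucl (2 * n)) :=
  ⟨(chart_contMDiffOn he).mdifferentiableOn (by simp),
    (chart_contMDiffOn_symm he).mdifferentiableOn (by simp)⟩

include he hy in
theorem chartInv_chartField : chartInv e y (chartField ϖ H e y) = hamField ϖ H (e.symm y) := by
  have h := (chart_mdifferentiable he).symm_comp_deriv (e.map_target hy)
  rw [e.right_inv hy] at h
  exact DFunLike.congr_fun h (hamField ϖ H (e.symm y))

include he hy in
theorem chartInv_surjective (v : TangentSpace (𝓡 (2 * n)) (e.symm y)) :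
    chartInv e y (mfderiv (𝓡 (2 * n)) 𝓘(ℝ, Eucl (2 * n)) e (e.symm y) v) = v := by
  have h := (chart_mdifferentiable he).symm_comp_deriv (e.map_target hy)
  rw [e.right_inv hy] at h
  exact DFunLike.congr_fun h v

include he hy in
theorem chart_mfderiv_chartInv (v : Eucl (2 * n)) :
    mfderiv (𝓡 (2 * n)) 𝓘(ℝ, Eucl (2 * n)) e (e.symm y) (chartInv e y v) = v := by
  have h := (chart_mdifferentiable he).comp_symm_deriv hy
  exact DFunLike.congr_fun h v

include he hy in
theorem chartInv_injective : Function.Injective (chartInv e y) := fun v w h ↦ by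
  rw [← chart_mfderiv_chartInv he hy v, h, chart_mfderiv_chartInv he hy]

include he in
theorem contDiffOn_chartForm : ContDiffOn ℝ ∞ (chartForm ϖ e) e.target := by
  rw [contDiffOn_clm_apply]
  intro v
  rw [contDiffOn_clm_apply]
  intro w
  exact contDiffOn_pullback ϖ e.open_target (chart_contMDiffOn_symm he) v w

theorem chartForm_self (v : Eucl (2 * n)) : chartForm ϖ e y v v = 0 :=
  ϖ.alternating _ _

theorem chartForm_swap (v w : Eucl (2 * n)) : chartForm ϖ e y v w = -chartForm ϖ e y w v := by
  have h := chartForm_self ϖ (e := e) (y := y) (v + w)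
  simp only [map_add, add_apply, chartForm_self] at h
  linarith

include he hy in
theorem chartForm_injective : Function.Injective (chartForm ϖ e y) := by
  rw [injective_iff_map_eq_zero]
  intro v hv
  have : chartInv e y v = 0 := ϖ.nondegenerate _ _ fun w ↦ by
    rw [← chartInv_surjective he hy w]
    exact DFunLike.congr_fun hv _
  exact chartInv_injective he hy (this.trans (map_zero _).symm)

theorem finrank_dual_eucl (d : ℕ) :
    Module.finrank ℝ (Eucl d) = Module.finrank ℝ (Eucl d →L[ℝ] ℝ) := by
  rw [← (LinearMap.toContinuousLinearMap (𝕜 := ℝ) (E := Eucl d) (F' := ℝ)).finrank_eq]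
  exact (Subspace.dual_finrank_eq (K := ℝ) (V := Eucl d)).symm

/-- The coordinate form as an isomorphism onto the dual space. -/
def chartFormEquiv (he : e ∈ atlas (Eucl (2 * n)) M) (hy : y ∈ e.target) :
    Eucl (2 * n) ≃L[ℝ] (Eucl (2 * n) →L[ℝ] ℝ) :=
  (LinearEquiv.ofInjectiveOfFinrankEq (chartForm ϖ e y).toLinearMap (chartForm_injective ϖ he hy)
    (finrank_dual_eucl _)).toContinuousLinearEquiv

theorem chartFormEquiv_coe : (chartFormEquiv ϖ he hy : Eucl (2 * n) →L[ℝ] _) = chartForm ϖ e y :=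
  rfl

variable {H}

include he hy in
theorem fderiv_chart_energy (hH : ContMDiff (𝓡 (2 * n)) 𝓘(ℝ, ℝ) ∞ H) (v : Eucl (2 * n)) :
    fderiv ℝ (H ∘ e.symm) y v = mfderiv (𝓡 (2 * n)) 𝓘(ℝ, ℝ) H (e.symm y) (chartInv e y v) := by
  have h2 := mfderiv_comp (I := 𝓘(ℝ, Eucl (2 * n))) (I' := 𝓡 (2 * n)) (I'' := 𝓘(ℝ, ℝ)) y
    (hH.mdifferentiableAt (by simp) : MDifferentiableAt (𝓡 (2 * n)) 𝓘(ℝ, ℝ) H (e.symm y))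
    ((chart_mdifferentiable he).mdifferentiableAt_symm hy)
  rw [mfderiv_eq_fderiv] at h2
  exact DFunLike.congr_fun h2 v

include he in
theorem contDiffOn_chart_energy (hH : ContMDiff (𝓡 (2 * n)) 𝓘(ℝ, ℝ) ∞ H) :
    ContDiffOn ℝ ∞ (H ∘ e.symm) e.target :=
  (hH.comp_contMDiffOn (chart_contMDiffOn_symm he)).contDiffOn

include he hy in
theorem chartForm_chartField (hH : ContMDiff (𝓡 (2 * n)) 𝓘(ℝ, ℝ) ∞ H) (w : Eucl (2 * n)) :
    chartForm ϖ e y (chartField ϖ H e y) w = -fderiv ℝ (H ∘ e.symm) y w := by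
  have h1 : chartForm ϖ e y (chartField ϖ H e y) w =
      ϖ.toFun (e.symm y) (hamField ϖ H (e.symm y)) (chartInv e y w) := by
    rw [← chartInv_chartField ϖ H he hy]; rfl
  rw [h1, hamField_spec, fderiv_chart_energy he hy hH]
  rfl

include he in
-- In coordinates X = -ϖ⁻¹ dH, and inversion of operators is smooth at invertible ones.
theorem contDiffOn_chartField (hH : ContMDiff (𝓡 (2 * n)) 𝓘(ℝ, ℝ) ∞ H) :
    ContDiffOn ℝ ∞ (chartField ϖ H e) e.target := by
  have h1 : ContDiffOn ℝ ∞
      (fun y ↦ (chartForm ϖ e y).inverse (-fderiv ℝ (H ∘ e.symm) y)) e.target := by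
    intro y hy
    have h0 : ContDiffAt ℝ ∞ (ContinuousLinearMap.inverse :
        (Eucl (2 * n) →L[ℝ] Eucl (2 * n) →L[ℝ] ℝ) → _) (chartForm ϖ e y) := by
      rw [← chartFormEquiv_coe ϖ he hy]
      exact contDiffAt_map_inverse (chartFormEquiv ϖ he hy)
    have h2 : ContDiffAt ℝ ∞ (fun y ↦ (chartForm ϖ e y).inverse) y :=
      h0.comp y ((contDiffOn_chartForm ϖ he).contDiffAt (e.open_target.mem_nhds hy))
    have h3 : ContDiffAt ℝ ∞ (fderiv ℝ (H ∘ e.symm)) y :=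
      ((contDiffOn_chart_energy he hH).contDiffAt (e.open_target.mem_nhds hy)).fderiv_right
        (by simp)
    exact (h2.clm_apply h3.neg).contDiffWithinAt
  refine h1.congr fun y hy ↦ ?_
  have h4 : chartForm ϖ e y (chartField ϖ H e y) = -fderiv ℝ (H ∘ e.symm) y := by
    ext w
    exact chartForm_chartField ϖ he hy hH w
  rw [← h4, ← chartFormEquiv_coe ϖ he hy, ContinuousLinearMap.inverse_equiv]
  exact ((chartFormEquiv ϖ he hy).symm_apply_apply _).symm

include he hy in
theorem chartForm_closed (a b c : Eucl (2 * n)) :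
    fderiv ℝ (chartForm ϖ e) y a b c + fderiv ℝ (chartForm ϖ e) y b c a +
      fderiv ℝ (chartForm ϖ e) y c a b = 0 := by
  have hd : DifferentiableAt ℝ (chartForm ϖ e) y :=
    ((contDiffOn_chartForm ϖ he).contDiffAt (e.open_target.mem_nhds hy)).differentiableAt (by simp)
  have key : ∀ v w z : Eucl (2 * n),
      fderiv ℝ (fun y ↦ chartForm ϖ e y v w) y z = fderiv ℝ (chartForm ϖ e) y z v w := by
    intro v w z
    have := ((hd.hasFDerivAt.clm_apply (hasFDerivAt_const v y)).clm_apply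
      (hasFDerivAt_const w y)).fderiv
    rw [this]
    simp
  have h := ϖ.closed e he y hy a b c
  rw [← key, ← key, ← key]
  exact h

include he hy in
/-- The Lie derivative of the symplectic form along a Hamiltonian vector field vanishes. -/
theorem chartForm_lie (hH : ContMDiff (𝓡 (2 * n)) 𝓘(ℝ, ℝ) ∞ H) (v w : Eucl (2 * n)) :
    fderiv ℝ (chartForm ϖ e) y (chartField ϖ H e y) v w +
      chartForm ϖ e y (fderiv ℝ (chartField ϖ H e) y v) w +
      chartForm ϖ e y v (fderiv ℝ (chartField ϖ H e) y w) = 0 := by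
  have hnhds := e.open_target.mem_nhds hy
  have hd : DifferentiableAt ℝ (chartForm ϖ e) y :=
    ((contDiffOn_chartForm ϖ he).contDiffAt hnhds).differentiableAt (by simp)
  have hX : DifferentiableAt ℝ (chartField ϖ H e) y :=
    ((contDiffOn_chartField ϖ he hH).contDiffAt hnhds).differentiableAt (by simp)
  have hE : ContDiffAt ℝ ∞ (H ∘ e.symm) y := (contDiffOn_chart_energy he hH).contDiffAt hnhds
  have hE' : DifferentiableAt ℝ (fderiv ℝ (H ∘ e.symm)) y :=
    (hE.fderiv_right (m := ∞) (by simp)).differentiableAt (by simp)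
  have hsymm : ∀ a b, fderiv ℝ (fderiv ℝ (H ∘ e.symm)) y a b =
      fderiv ℝ (fderiv ℝ (H ∘ e.symm)) y b a :=
    fun a b ↦ (hE.isSymmSndFDerivAt (by
      simp only [minSmoothness_of_isRCLikeNormedField]
      exact WithTop.coe_le_coe.2 le_top)).eq a b
  -- This differentiates ϖ(X, b) = -dH(b) in the direction a. Antisymmetrizing in a and b removes
  -- the Hessian of H, and closedness turns the two derivatives of ϖ that are left into the
  -- derivative along X.
  have key : ∀ a b, fderiv ℝ (chartForm ϖ e) y a (chartField ϖ H e y) b +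
      chartForm ϖ e y (fderiv ℝ (chartField ϖ H e) y a) b =
      -fderiv ℝ (fderiv ℝ (H ∘ e.symm)) y a b := by
    intro a b
    have h1 := (hd.hasFDerivAt.clm_apply hX.hasFDerivAt).clm_apply (hasFDerivAt_const b y)
    have h2 := (hE'.hasFDerivAt.clm_apply (hasFDerivAt_const b y)).neg
    have h3 : (fun y ↦ chartForm ϖ e y (chartField ϖ H e y) b) =ᶠ[𝓝 y]
        -fun y ↦ fderiv ℝ (H ∘ e.symm) y b := by
      filter_upwards [hnhds] with z hz
      exact chartForm_chartField ϖ he hz hH b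
    have h4 := DFunLike.congr_fun (h1.unique (h2.congr_of_eventuallyEq h3)) a
    simpa [add_comm] using! h4
  have k1 := key v w
  have k2 := key w v
  have hcl := chartForm_closed ϖ he hy (chartField ϖ H e y) v w
  have hskew : ∀ a b c, fderiv ℝ (chartForm ϖ e) y a b c = -fderiv ℝ (chartForm ϖ e) y a c b := by
    intro a b c
    have h1 := (hd.hasFDerivAt.clm_apply (hasFDerivAt_const b y)).clm_apply (hasFDerivAt_const c y)
    have h2 := ((hd.hasFDerivAt.clm_apply (hasFDerivAt_const c y)).clm_apply
      (hasFDerivAt_const b y)).neg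
    have h3 : (fun y ↦ chartForm ϖ e y b c) = -fun y ↦ chartForm ϖ e y c b := by
      funext z
      exact chartForm_swap ϖ b c
    rw [h3] at h1
    have h4 := DFunLike.congr_fun (h1.unique h2) a
    simpa using! h4
  rw [hskew v w] at hcl
  rw [chartForm_swap ϖ v]
  have := hsymm v w
  linarith

end Chart

/-! ### Local Hamiltonian flows on the manifold and their symplecticity. -/

section LocalFlowManifold

variable (ϖ : SymplecticForm n M) {H : M → ℝ}

/-- Uniqueness of integral curves needs this regularity; it is what makes the chosen curves in
`flow` satisfy the group law. -/
theorem contMDiff_hamField (hH : ContMDiff (𝓡 (2 * n)) 𝓘(ℝ, ℝ) ∞ H) :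
    ContMDiff (𝓡 (2 * n)) (𝓡 (2 * n)).tangent ∞
      (fun x ↦ (⟨x, hamField ϖ H x⟩ : TangentBundle (𝓡 (2 * n)) M)) := by
  intro p
  let e := chartAt (Eucl (2 * n)) p
  have he : e ∈ atlas (Eucl (2 * n)) M := chart_mem_atlas _ p
  have h1 := contMDiffOn_mfderiv_apply e.open_target (chart_contMDiffOn_symm he)
    (contDiffOn_chartField ϖ he hH)
  have h2 := h1.comp (chart_contMDiffOn he) (fun q hq ↦ e.map_source hq)
  refine (h2.congr fun q hq ↦ ?_).contMDiffAt
    (e.open_source.mem_nhds (mem_chart_source (Eucl (2 * n)) p))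
  have h3 := chartInv_chartField ϖ H he (e.map_source hq)
  have h4 : (⟨e.symm (e q), hamField ϖ H (e.symm (e q))⟩ : TangentBundle (𝓡 (2 * n)) M) =
      ⟨q, hamField ϖ H q⟩ := by
    rw [e.left_inv hq]
  rw [← h4, ← h3]
  rfl

theorem mfderiv_energy_hamField (x : M) :
    mfderiv (𝓡 (2 * n)) 𝓘(ℝ, ℝ) H x (hamField ϖ H x) = 0 := by
  have h := hamField_spec ϖ H x
  have h1 : ϖ.toFun x (hamField ϖ H x) (hamField ϖ H x) =
      -(mfderiv (𝓡 (2 * n)) 𝓘(ℝ, ℝ) H x (hamField ϖ H x)) :=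
    DFunLike.congr_fun h (hamField ϖ H x)
  rw [ϖ.alternating] at h1
  exact neg_eq_zero.1 h1.symm

variable {ϖ}

theorem energy_eq_of_isMIntegralCurveOn (hH : ContMDiff (𝓡 (2 * n)) 𝓘(ℝ, ℝ) ∞ H) {γ : ℝ → M}
    {a b : ℝ} (hγ : IsMIntegralCurveOn (I := 𝓡 (2 * n)) γ (hamField ϖ H) (Ioo a b)) {s t : ℝ}
    (hs : s ∈ Ioo a b) (ht : t ∈ Ioo a b) : H (γ s) = H (γ t) := by
  have hd : ∀ t ∈ Ioo a b, HasDerivAt (H ∘ γ) 0 t := by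
    intro t ht
    have h1 : HasMFDerivAt 𝓘(ℝ, ℝ) (𝓡 (2 * n)) γ t
        ((1 : ℝ →L[ℝ] ℝ).smulRight (hamField ϖ H (γ t))) :=
      (hγ t ht).hasMFDerivAt (isOpen_Ioo.mem_nhds ht)
    have h2 := HasMFDerivAt.comp t
      (hH.mdifferentiableAt (by simp) : MDifferentiableAt (𝓡 (2 * n)) 𝓘(ℝ, ℝ) H
        (γ t)).hasMFDerivAt h1
    have h4 : mfderiv (𝓡 (2 * n)) 𝓘(ℝ, ℝ) H (γ t) ((1 : ℝ) • hamField ϖ H (γ t)) = 0 :=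
      (congrArg _ (one_smul ℝ _)).trans (mfderiv_energy_hamField ϖ (H := H) (γ t))
    obtain ⟨L, hL, hL1⟩ : ∃ L : ℝ →L[ℝ] ℝ, HasFDerivAt (H ∘ γ) L t ∧ L 1 = 0 :=
      ⟨_, hasMFDerivAt_iff_hasFDerivAt.1 h2, h4⟩
    exact hL1 ▸ hL.hasDerivAt
  exact IsOpen.is_const_of_deriv_eq_zero isOpen_Ioo isPreconnected_Ioo
    (fun t ht ↦ (hd t ht).differentiableAt.differentiableWithinAt) (fun t ht ↦ (hd t ht).deriv)
    hs ht

variable (ϖ)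

/-- Hamiltonian vector fields have symplectic local flows, which are `C¹` jointly in time and
initial value. -/
theorem exists_symplectic_local_flow (hH : ContMDiff (𝓡 (2 * n)) 𝓘(ℝ, ℝ) ∞ H) (p : M) :
    ∃ ε > 0, ∃ V : Set M, IsOpen V ∧ p ∈ V ∧ ∃ Ψ : ℝ → M → M,
      (∀ y ∈ V, Ψ 0 y = y ∧
        IsMIntegralCurveOn (I := 𝓡 (2 * n)) (Ψ · y) (hamField ϖ H) (Ioo (-ε) ε)) ∧
      ContMDiffOn (𝓘(ℝ, ℝ).prod (𝓡 (2 * n))) (𝓡 (2 * n)) 1 (fun q : ℝ × M ↦ Ψ q.1 q.2)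
        (Ioo (-ε) ε ×ˢ V) ∧
      ∀ y ∈ V, ∀ t ∈ Ioo (-ε) ε, ∀ v w : TangentSpace (𝓡 (2 * n)) y,
        ϖ.toFun (Ψ t y) (mfderiv (𝓡 (2 * n)) (𝓡 (2 * n)) (Ψ t) y v)
          (mfderiv (𝓡 (2 * n)) (𝓡 (2 * n)) (Ψ t) y w) = ϖ.toFun y v w := by
  let e := chartAt (Eucl (2 * n)) p
  have he : e ∈ atlas (Eucl (2 * n)) M := chart_mem_atlas _ p
  have hp : p ∈ e.source := mem_chart_source (Eucl (2 * n)) p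
  have hX := contDiffOn_chartField ϖ he hH
  obtain ⟨ε, hε, r, hr, φ, J, hφ, hsm⟩ := exists_local_flow (y₀ := e p)
    ((hX.contDiffAt (e.open_target.mem_nhds (e.map_source hp))).of_le
      (WithTop.coe_le_coe.2 le_top)) (e.open_target.mem_nhds (e.map_source hp))
  have hV : IsOpen (e.source ∩ e ⁻¹' Metric.ball (e p) r) := e.isOpen_inter_preimage Metric.isOpen_ball
  have h0 : (0 : ℝ) ∈ Ioo (-ε) ε := ⟨by linarith, hε⟩
  have hmd := chart_mdifferentiable he
  -- the coordinate form is invariant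
  have hinv : ∀ z ∈ Metric.ball (e p) r, ∀ t ∈ Ioo (-ε) ε, ∀ a b,
      chartForm ϖ e (φ t z) (J t z a) (J t z b) = chartForm ϖ e z a b := by
    intro z hz t ht a b
    obtain ⟨hz0, hJ0, hz1⟩ := hφ z hz
    -- By the variational equation for J, the derivative in t is the Lie derivative of the form at φ
    -- t z, evaluated at J a and J b, so `chartForm_lie` makes it vanish.
    have hd : ∀ t ∈ Ioo (-ε) ε,
        HasDerivAt (fun t ↦ chartForm ϖ e (φ t z) (J t z a) (J t z b)) 0 t := by
      intro t ht
      obtain ⟨hO, hφ', hJ', -⟩ := hz1 t ht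
      have hd : DifferentiableAt ℝ (chartForm ϖ e) (φ t z) :=
        ((contDiffOn_chartForm ϖ he).contDiffAt (e.open_target.mem_nhds hO)).differentiableAt
          (by simp)
      have h1 : HasDerivAt (fun t ↦ chartForm ϖ e (φ t z)) _ t :=
        HasFDerivAt.comp_hasDerivAt (f := fun t ↦ φ t z) (l := chartForm ϖ e) t hd.hasFDerivAt hφ'
      have h2 : ∀ c, HasDerivAt (fun t ↦ J t z c)
          (fderiv ℝ (chartField ϖ H e) (φ t z) (J t z c)) t := fun c ↦ by
        simpa using! hJ'.clm_apply (hasDerivAt_const t c)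
      have h3 := (h1.clm_apply (h2 a)).clm_apply (h2 b)
      have h4 := chartForm_lie ϖ he hO hH (J t z a) (J t z b)
      convert! h3 using 1
      rw [← h4]
      simp
    have := IsOpen.is_const_of_deriv_eq_zero isOpen_Ioo isPreconnected_Ioo
      (fun t ht ↦ (hd t ht).differentiableAt.differentiableWithinAt) (fun t ht ↦ (hd t ht).deriv)
      ht h0
    simpa [hz0, hJ0] using this
  refine ⟨ε, hε, e.source ∩ e ⁻¹' Metric.ball (e p) r, hV, ⟨hp, Metric.mem_ball_self hr⟩,
    fun t y ↦ e.symm (φ t (e y)), fun y hy ↦ ⟨?_, ?_⟩, ?_, ?_⟩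
  · simp only [(hφ _ hy.2).1]
    exact e.left_inv hy.1
  · intro t ht
    obtain ⟨hO, hφ', -⟩ := (hφ _ hy.2).2.2 t ht
    have h1 := (hmd.mdifferentiableAt_symm hO).hasMFDerivAt
    have h2 : HasMFDerivAt 𝓘(ℝ, ℝ) 𝓘(ℝ, Eucl (2 * n)) (φ · (e y)) t _ :=
      hφ'.hasFDerivAt.hasMFDerivAt
    have h3 := (HasMFDerivAt.comp t h1 h2).hasMFDerivWithinAt (s := Ioo (-ε) ε)
    refine h3.congr_mfderiv ?_
    ext
    have h4 := chartInv_chartField ϖ H he hO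
    rw [← h4]
    exact (chartInv e (φ t (e y))).map_smul _ _
  · have h1 : ContMDiffOn (𝓘(ℝ, ℝ).prod (𝓡 (2 * n))) (𝓘(ℝ, ℝ).prod 𝓘(ℝ, Eucl (2 * n))) 1
        (fun q : ℝ × M ↦ (q.1, e q.2))
        (Ioo (-ε) ε ×ˢ (e.source ∩ e ⁻¹' Metric.ball (e p) r)) := by
      refine contMDiffOn_fst.prodMk ?_
      exact ((chart_contMDiffOn he).of_le (by simp)).comp contMDiffOn_snd fun q hq ↦ hq.2.1
    have h2 : ContMDiffOn (𝓘(ℝ, ℝ).prod 𝓘(ℝ, Eucl (2 * n))) 𝓘(ℝ, Eucl (2 * n)) 1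
        (fun q : ℝ × Eucl (2 * n) ↦ φ q.1 q.2) (Ioo (-ε) ε ×ˢ Metric.ball (e p) r) := by
      rw [← modelWithCornersSelf_prod, chartedSpaceSelf_prod]
      exact hsm.contMDiffOn
    have h3 := h2.comp h1 fun q hq ↦ ⟨hq.1, hq.2.2⟩
    exact ((chart_contMDiffOn_symm he).of_le (by simp)).comp h3
      fun q hq ↦ ((hφ _ hq.2.2).2.2 _ hq.1).1
  · intro y hy t ht v w
    obtain ⟨hO, -, -, hJ⟩ := (hφ _ hy.2).2.2 t ht
    have h1 := (hmd.mdifferentiableAt hy.1).hasMFDerivAt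
    have h2 : HasMFDerivAt 𝓘(ℝ, Eucl (2 * n)) 𝓘(ℝ, Eucl (2 * n)) (φ t) (e y) _ :=
      hJ.hasMFDerivAt
    have h3 := (hmd.mdifferentiableAt_symm hO).hasMFDerivAt
    have h4 := (HasMFDerivAt.comp y h3 (HasMFDerivAt.comp y h2 h1)).mfderiv
    have h5 : ∀ v, mfderiv (𝓡 (2 * n)) (𝓡 (2 * n)) (fun y ↦ e.symm (φ t (e y))) y v =
        chartInv e (φ t (e y)) (J t (e y)
          (mfderiv (𝓡 (2 * n)) 𝓘(ℝ, Eucl (2 * n)) e y v)) :=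
      fun v ↦ DFunLike.congr_fun h4 v
    rw [h5, h5]
    have h6 := hinv _ hy.2 t ht (mfderiv (𝓡 (2 * n)) 𝓘(ℝ, Eucl (2 * n)) e y v)
      (mfderiv (𝓡 (2 * n)) 𝓘(ℝ, Eucl (2 * n)) e y w)
    refine Eq.trans h6 ?_
    have h8 : ∀ v w : Eucl (2 * n), chartForm ϖ e (e y)
        (mfderiv (𝓡 (2 * n)) 𝓘(ℝ, Eucl (2 * n)) e (e.symm (e y)) v)
        (mfderiv (𝓡 (2 * n)) 𝓘(ℝ, Eucl (2 * n)) e (e.symm (e y)) w) =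
        ϖ.toFun (e.symm (e y)) v w := by
      intro v w
      have h9 := chartInv_surjective he (e.map_source hy.1)
      exact congrArg₂ (fun a b ↦ ϖ.toFun (e.symm (e y)) a b) (h9 v) (h9 w)
    have h10 : ∀ q, e.symm (e y) = q → ∀ v w : Eucl (2 * n), chartForm ϖ e (e y)
        (mfderiv (𝓡 (2 * n)) 𝓘(ℝ, Eucl (2 * n)) e q v)
        (mfderiv (𝓡 (2 * n)) 𝓘(ℝ, Eucl (2 * n)) e q w) = ϖ.toFun q v w := by
      rintro q rfl
      exact h8
    exact h10 y (e.left_inv hy.1) v w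

end LocalFlowManifold

/-! ### The global flow on a regular energy surface. -/

/-- Regularity and completeness of the flow on an energy surface. -/
structure RegularLevel (ϖ : SymplecticForm n M) (H : M → ℝ) (E : ℝ) : Prop where
  smooth : ContMDiff (𝓡 (2 * n)) 𝓘(ℝ, ℝ) ∞ H
  regular : ∀ x ∈ energySurface H E, mfderiv (𝓡 (2 * n)) 𝓘(ℝ, ℝ) H x ≠ 0
  complete : ∀ x ∈ energySurface H E, ∃ γ : ℝ → M, γ 0 = x ∧
    IsMIntegralCurve (I := 𝓡 (2 * n)) γ (hamField ϖ H)

namespace RegularLevel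

variable {ϖ : SymplecticForm n M} {H : M → ℝ} {E : ℝ} (h : RegularLevel ϖ H E)

include h

theorem isClosed : IsClosed (energySurface H E) :=
  isClosed_eq h.smooth.continuous continuous_const

section NoSep

variable {x : M} (hx : x ∈ energySurface H E)

include hx

theorem flow_zero : flow ϖ H 0 x = x := by
  unfold flow
  rw [dif_pos (h.complete x hx)]
  exact (h.complete x hx).choose_spec.1

theorem isMIntegralCurve_flow :
    IsMIntegralCurve (I := 𝓡 (2 * n)) (fun t ↦ flow ϖ H t x) (hamField ϖ H) := by
  have : (fun t ↦ flow ϖ H t x) = (h.complete x hx).choose := by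
    funext t
    unfold flow
    rw [dif_pos (h.complete x hx)]
  rw [this]
  exact (h.complete x hx).choose_spec.2

theorem flow_mem (t : ℝ) : flow ϖ H t x ∈ energySurface H E := by
  have h1 : IsMIntegralCurveOn (I := 𝓡 (2 * n)) (fun t ↦ flow ϖ H t x) (hamField ϖ H)
      (Ioo (-(|t| + 1)) (|t| + 1)) := (h.isMIntegralCurve_flow hx).isMIntegralCurveOn _
  have h2 := energy_eq_of_isMIntegralCurveOn h.smooth h1 (s := t) (t := 0)
    ⟨by linarith [neg_abs_le t], by linarith [le_abs_self t]⟩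
    ⟨by linarith [abs_nonneg t], by linarith [abs_nonneg t]⟩
  simp only [h.flow_zero hx] at h2
  exact h2.trans hx

theorem continuous_flow_time : Continuous fun t ↦ flow ϖ H t x :=
  (h.isMIntegralCurve_flow hx).continuous

end NoSep

variable [T2Space M] {x : M} (hx : x ∈ energySurface H E)

include hx

/-- `flow` is defined by a choice of integral curve; uniqueness identifies any locally constructed
curve with it. -/
theorem flow_eq {γ : ℝ → M} {a b : ℝ} (h0 : (0 : ℝ) ∈ Ioo a b)
    (hγ : IsMIntegralCurveOn (I := 𝓡 (2 * n)) γ (hamField ϖ H) (Ioo a b)) (hγ0 : γ 0 = x) :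
    ∀ t ∈ Ioo a b, γ t = flow ϖ H t x :=
  isMIntegralCurveOn_Ioo_eqOn_of_contMDiff_boundaryless h0
    ((contMDiff_hamField ϖ h.smooth).of_le (by simp)) hγ
    ((h.isMIntegralCurve_flow hx).isMIntegralCurveOn _) (hγ0.trans (h.flow_zero hx).symm)

theorem flow_add (s t : ℝ) : flow ϖ H (s + t) x = flow ϖ H s (flow ϖ H t x) := by
  have h1 := (h.isMIntegralCurve_flow hx).comp_add t
  have h2 := isMIntegralCurve_Ioo_eq_of_contMDiff_boundaryless (t₀ := 0)
    ((contMDiff_hamField ϖ h.smooth).of_le (by simp)) h1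
    (h.isMIntegralCurve_flow (h.flow_mem hx t))
    (by simp [Function.comp, h.flow_zero (h.flow_mem hx t)])
  exact congrFun h2 s

theorem flow_neg_flow (t : ℝ) : flow ϖ H (-t) (flow ϖ H t x) = x := by
  rw [← h.flow_add hx, neg_add_cancel, h.flow_zero hx]

theorem flow_flow_neg (t : ℝ) : flow ϖ H t (flow ϖ H (-t) x) = x := by
  rw [← h.flow_add hx, add_neg_cancel, h.flow_zero hx]

end RegularLevel

/-- The flow at time `T` near `x` is the restriction to the energy surface of a symplectic
`C¹` map. -/
def HasSymplecticExtension (ϖ : SymplecticForm n M) (H : M → ℝ) (E : ℝ) (T : ℝ) (x : M) : Prop :=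
  ∃ Ψ : M → M, ContMDiffAt (𝓡 (2 * n)) (𝓡 (2 * n)) 1 Ψ x ∧
    (∀ᶠ y in 𝓝[energySurface H E] x, Ψ y = flow ϖ H T y) ∧
    ∀ᶠ y in 𝓝 x, ∀ v w : TangentSpace (𝓡 (2 * n)) y,
      ϖ.toFun (Ψ y) (mfderiv (𝓡 (2 * n)) (𝓡 (2 * n)) Ψ y v)
        (mfderiv (𝓡 (2 * n)) (𝓡 (2 * n)) Ψ y w) = ϖ.toFun y v w

theorem ContMDiffAt.eventually_mdifferentiableAt {F G N₁ N₂ : Type*}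
    [NormedAddCommGroup F] [NormedSpace ℝ F] [NormedAddCommGroup G] [NormedSpace ℝ G]
    [TopologicalSpace N₁] [ChartedSpace F N₁] [TopologicalSpace N₂] [ChartedSpace G N₂]
    [IsManifold 𝓘(ℝ, F) 1 N₁] [IsManifold 𝓘(ℝ, G) 1 N₂] {f : N₁ → N₂} {x : N₁}
    (hf : ContMDiffAt 𝓘(ℝ, F) 𝓘(ℝ, G) 1 f x) :
    ∀ᶠ y in 𝓝 x, MDifferentiableAt 𝓘(ℝ, F) 𝓘(ℝ, G) f y := by
  filter_upwards [(contMDiffAt_iff_contMDiffAt_nhds (by simp)).1 hf] with y hy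
  exact hy.mdifferentiableAt (by simp)

namespace RegularLevel

variable {ϖ : SymplecticForm n M} {H : M → ℝ} {E : ℝ} (h : RegularLevel ϖ H E) [T2Space M]

include h

theorem exists_local_flow_eq (p : M) :
    ∃ ε > 0, ∃ V : Set M, IsOpen V ∧ p ∈ V ∧ ∃ Ψ : ℝ → M → M,
      (∀ y ∈ V, Ψ 0 y = y) ∧
      (∀ y ∈ V, ∀ t ∈ Ioo (-ε) ε, H (Ψ t y) = H y) ∧
      (∀ y ∈ V, IsMIntegralCurveOn (I := 𝓡 (2 * n)) (Ψ · y) (hamField ϖ H) (Ioo (-ε) ε)) ∧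
      (∀ y ∈ V, y ∈ energySurface H E → ∀ t ∈ Ioo (-ε) ε, Ψ t y = flow ϖ H t y) ∧
      ContMDiffOn (𝓘(ℝ, ℝ).prod (𝓡 (2 * n))) (𝓡 (2 * n)) 1 (fun q : ℝ × M ↦ Ψ q.1 q.2)
        (Ioo (-ε) ε ×ˢ V) ∧
      ∀ y ∈ V, ∀ t ∈ Ioo (-ε) ε, ∀ v w : TangentSpace (𝓡 (2 * n)) y,
        ϖ.toFun (Ψ t y) (mfderiv (𝓡 (2 * n)) (𝓡 (2 * n)) (Ψ t) y v)
          (mfderiv (𝓡 (2 * n)) (𝓡 (2 * n)) (Ψ t) y w) = ϖ.toFun y v w := by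
  obtain ⟨ε, hε, V, hV, hpV, Ψ, h1, h2, h3⟩ := exists_symplectic_local_flow ϖ h.smooth p
  have h0 : (0 : ℝ) ∈ Ioo (-ε) ε := ⟨by linarith, hε⟩
  refine ⟨ε, hε, V, hV, hpV, Ψ, fun y hy ↦ (h1 y hy).1, fun y hy t ht ↦ ?_,
    fun y hy ↦ (h1 y hy).2, fun y hy hyA t ht ↦ ?_, h2, h3⟩
  · have := energy_eq_of_isMIntegralCurveOn h.smooth (h1 y hy).2 ht h0
    rwa [(h1 y hy).1] at this
  · exact h.flow_eq hyA h0 (h1 y hy).2 (h1 y hy).1 t ht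

theorem eventually_hasSymplecticExtension (p : M) :
    ∃ ε > 0, ∀ᶠ q in 𝓝 p, ∀ t ∈ Ioo (-ε) ε, HasSymplecticExtension ϖ H E t q := by
  obtain ⟨ε, hε, V, hV, hpV, Ψ, h0, -, -, h2, h3, h4⟩ := h.exists_local_flow_eq p
  refine ⟨ε, hε, ?_⟩
  filter_upwards [hV.mem_nhds hpV] with q hq t ht
  refine ⟨Ψ t, ?_, ?_, ?_⟩
  · have h5 : ContMDiffAt (𝓘(ℝ, ℝ).prod (𝓡 (2 * n))) (𝓡 (2 * n)) 1
        (fun q : ℝ × M ↦ Ψ q.1 q.2) (t, q) :=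
      h3.contMDiffAt ((isOpen_Ioo.prod hV).mem_nhds ⟨ht, hq⟩)
    exact ContMDiffAt.comp (g := fun q : ℝ × M ↦ Ψ q.1 q.2) (f := fun y : M ↦ (t, y)) q h5
      (contMDiffAt_const.prodMk contMDiffAt_id)
  · filter_upwards [nhdsWithin_le_nhds (hV.mem_nhds hq), self_mem_nhdsWithin] with y hy hyA
    exact h2 y hy hyA t ht
  · filter_upwards [hV.mem_nhds hq] with y hy
    exact h4 y hy t ht

omit [T2Space M] h in
theorem _root_.HamScattering.HasSymplecticExtension.continuousWithinAt {T : ℝ} {x : M}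
    (hx : x ∈ energySurface H E)
    (hT : HasSymplecticExtension ϖ H E T x) :
    ContinuousWithinAt (flow ϖ H T) (energySurface H E) x := by
  obtain ⟨Ψ, h1, h2, -⟩ := hT
  refine h1.continuousAt.continuousWithinAt.congr_of_eventuallyEq
    (h2.mono fun y hy ↦ hy.symm) ?_
  exact (h2.self_of_nhdsWithin hx).symm

theorem hasSymplecticExtension_add {S T : ℝ} {x : M} (hx : x ∈ energySurface H E)
    (hT : HasSymplecticExtension ϖ H E T x)
    (hS : HasSymplecticExtension ϖ H E S (flow ϖ H T x)) :
    HasSymplecticExtension ϖ H E (S + T) x := by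
  have hc := hT.continuousWithinAt hx
  obtain ⟨Ψ, h1, h2, h3⟩ := hT
  obtain ⟨Θ, k1, k2, k3⟩ := hS
  have hΨx : Ψ x = flow ϖ H T x := h2.self_of_nhdsWithin hx
  rw [← hΨx] at k1 k3
  refine ⟨Θ ∘ Ψ, k1.comp x h1, ?_, ?_⟩
  · have h4 : Tendsto (flow ϖ H T) (𝓝[energySurface H E] x)
        (𝓝[energySurface H E] (flow ϖ H T x)) :=
      tendsto_nhdsWithin_iff.2 ⟨hc, eventually_mem_nhdsWithin.mono fun y hy ↦ h.flow_mem hy T⟩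
    filter_upwards [h2, h4.eventually k2, self_mem_nhdsWithin] with y hy hy2 hyA
    rw [h.flow_add hyA, ← hy2, Function.comp, hy]
  · filter_upwards [ContMDiffAt.eventually_mdifferentiableAt h1, h3,
      h1.continuousAt.eventually (ContMDiffAt.eventually_mdifferentiableAt k1),
      h1.continuousAt.eventually k3] with y a1 a2 a3 a4 v w
    have h5 := mfderiv_comp (I := 𝓡 (2 * n)) (I' := 𝓡 (2 * n)) (I'' := 𝓡 (2 * n)) y a3 a1
    rw [h5, ← a2 v w]
    exact a4 _ _

/-- Orbits off the energy surface may not exist up to time T, so `flow` itself need not be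
symplectic on a neighbourhood of x. The set of times with a symplectic extension is nonempty, and it
is open and closed: near the point Φ_T x all short times have extensions, and extensions compose, so
membership of T and of any close T' are equivalent. -/
theorem hasSymplecticExtension {x : M} (hx : x ∈ energySurface H E) (T : ℝ) :
    HasSymplecticExtension ϖ H E T x := by
  let S : Set ℝ := {T | HasSymplecticExtension ϖ H E T x}
  have key : ∀ T, ∃ ε > 0, ∀ᶠ q in 𝓝 (flow ϖ H T x), ∀ t ∈ Ioo (-ε) ε,
      HasSymplecticExtension ϖ H E t q := fun T ↦
    h.eventually_hasSymplecticExtension _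
  have hne : S.Nonempty := by
    obtain ⟨ε, hε, h1⟩ := h.eventually_hasSymplecticExtension x
    exact ⟨0, h1.self_of_nhds 0 ⟨by linarith, hε⟩⟩
  have hnear : ∀ T, ∃ ε > 0, ∀ T', |T' - T| < ε → (T' ∈ S ↔ T ∈ S) := by
    intro T
    obtain ⟨ε, hε, h1⟩ := key T
    have h2 := (h.continuous_flow_time hx).continuousAt.eventually h1
    obtain ⟨δ, hδ, h3⟩ := Metric.eventually_nhds_iff.1 h2
    refine ⟨min ε δ, lt_min hε hδ, fun T' hT' ↦ ⟨fun hS ↦ ?_, fun hS ↦ ?_⟩⟩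
    · have h4 := h3 (y := T') (by rw [Real.dist_eq]; exact hT'.trans_le (min_le_right _ _))
        (T - T') (by
          have := abs_lt.1 (hT'.trans_le (min_le_left _ _))
          constructor <;> linarith)
      have := h.hasSymplecticExtension_add hx hS h4
      rwa [sub_add_cancel] at this
    · have h4 := h3 (y := T) (by simpa using hδ) (T' - T)
        (abs_lt.1 (hT'.trans_le (min_le_left _ _)))
      have := h.hasSymplecticExtension_add hx hS h4
      rwa [sub_add_cancel] at this
  have hclopen : IsClopen S := by
    constructor
    · rw [← isOpen_compl_iff, Metric.isOpen_iff]
      intro T hT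
      obtain ⟨ε, hε, h1⟩ := hnear T
      exact ⟨ε, hε, fun T' hT' hS ↦ hT ((h1 T' (by simpa [Real.dist_eq] using hT')).1 hS)⟩
    · rw [Metric.isOpen_iff]
      intro T hT
      obtain ⟨ε, hε, h1⟩ := hnear T
      exact ⟨ε, hε, fun T' hT' ↦ (h1 T' (by simpa [Real.dist_eq] using hT')).2 hT⟩
  have := hclopen.eq_univ hne
  exact (this.symm ▸ mem_univ T : T ∈ S)

theorem continuousOn_flow (T : ℝ) : ContinuousOn (flow ϖ H T) (energySurface H E) :=
  fun _ hx ↦ (h.hasSymplecticExtension hx T).continuousWithinAt hx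

omit [T2Space M] in
/-- The flow on the energy surface. -/
def flowS (t : ℝ) (x : energySurface H E) : energySurface H E :=
  ⟨flow ϖ H t x, h.flow_mem x.2 t⟩

omit [T2Space M] in
@[simp] theorem coe_flowS (t : ℝ) (x : energySurface H E) : (h.flowS t x : M) = flow ϖ H t x := rfl

omit [T2Space M] in
theorem flowS_zero (x : energySurface H E) : h.flowS 0 x = x := Subtype.ext (h.flow_zero x.2)

theorem flowS_add (s t : ℝ) (x : energySurface H E) :
    h.flowS (s + t) x = h.flowS s (h.flowS t x) := Subtype.ext (h.flow_add x.2 s t)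

@[simp] theorem flowS_neg_flowS (t : ℝ) (x : energySurface H E) :
    h.flowS (-t) (h.flowS t x) = x := Subtype.ext (h.flow_neg_flow x.2 t)

@[simp] theorem flowS_flowS_neg (t : ℝ) (x : energySurface H E) :
    h.flowS t (h.flowS (-t) x) = x := Subtype.ext (h.flow_flow_neg x.2 t)

/-- Near (T, x) the flow is Ψ_{t-T} ∘ Φ_T, with Ψ a jointly C¹ local flow near Φ_T x and Φ_T
continuous on the surface. -/
theorem continuous_flowS : Continuous fun q : ℝ × energySurface H E ↦ h.flowS q.1 q.2 := by
  rw [continuous_iff_continuousAt]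
  rintro ⟨T, x⟩
  obtain ⟨ε, hε, V, hV, hpV, Ψ, h0, -, -, h2, h3, -⟩ :=
    h.exists_local_flow_eq (flow ϖ H T x)
  have hc : Continuous (h.flowS T) := by
    refine Continuous.subtype_mk ?_ _
    exact (continuousOn_iff_continuous_domRestrict.1 (h.continuousOn_flow T))
  rw [ContinuousAt, tendsto_subtype_rng]
  have h4 : ContinuousAt (fun q : ℝ × M ↦ Ψ q.1 q.2) (T - T, flow ϖ H T x) :=
    (h3.contMDiffAt ((isOpen_Ioo.prod hV).mem_nhds
      ⟨by simpa using hε, hpV⟩)).continuousAt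
  have h5 : ContinuousAt (fun q : ℝ × energySurface H E ↦ (q.1 - T, (h.flowS T q.2 : M))) (T, x) :=
    ((continuous_fst.sub continuous_const).prodMk
      (continuous_subtype_val.comp (hc.comp continuous_snd))).continuousAt
  have h6 := ContinuousAt.comp (g := fun q : ℝ × M ↦ Ψ q.1 q.2) (x := (T, x)) h4 h5
  have h7 : ∀ᶠ q in 𝓝 (T, x), (q.1 - T, (h.flowS T q.2 : M)) ∈ Ioo (-ε) ε ×ˢ V :=
    h5.eventually ((isOpen_Ioo.prod hV).mem_nhds ⟨by simpa using hε, hpV⟩)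
  have h8 : ∀ᶠ q in 𝓝 (T, x), Ψ (q.1 - T) (h.flowS T q.2 : M) = h.flowS q.1 q.2 := by
    filter_upwards [h7] with q hq
    rw [h2 _ hq.2 (h.flowS T q.2).2 _ hq.1]
    simp only [coe_flowS]
    rw [← h.flow_add q.2.2, sub_add_cancel]
  have h9 := h6.tendsto.congr' h8
  have h10 : Ψ (T - T) (h.flowS T x) = (h.flowS T x : M) := by
    rw [sub_self]; exact h0 _ hpV
  simp only [Function.comp] at h9
  rwa [h10] at h9

theorem continuous_flowS_apply (t : ℝ) : Continuous (h.flowS t) :=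
  h.continuous_flowS.comp (by fun_prop : Continuous fun x : energySurface H E ↦ (t, x))

/-- `Quot` identifies points by the generated equivalence relation; by the group law the relation of
lying on one orbit already is an equivalence. -/
theorem orbitProj_eq_iff {x y : energySurface H E} :
    orbitProj ϖ H E x = orbitProj ϖ H E y ↔ ∃ t, h.flowS t x = y := by
  have heq : Equivalence fun x y : energySurface H E ↦ ∃ t : ℝ, flow ϖ H t x.1 = y.1 := by
    refine ⟨fun x ↦ ⟨0, h.flow_zero x.2⟩, ?_, ?_⟩
    · rintro x y ⟨t, ht⟩
      exact ⟨-t, by rw [← ht, h.flow_neg_flow x.2]⟩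
    · rintro x y z ⟨t, ht⟩ ⟨s, hs⟩
      exact ⟨s + t, by rw [h.flow_add x.2, ht, hs]⟩
  have : orbitProj ϖ H E x = orbitProj ϖ H E y ↔ ∃ t : ℝ, flow ϖ H t x.1 = y.1 := by
    refine ⟨fun hxy ↦ ?_, fun hxy ↦ Quot.sound hxy⟩
    exact heq.eqvGen_iff.1 (Quot.eqvGen_exact hxy)
  rw [this]
  exact exists_congr fun t ↦ (Subtype.ext_iff (a1 := h.flowS t x)).symm

theorem orbitProj_flowS (t : ℝ) (x : energySurface H E) :
    orbitProj ϖ H E (h.flowS t x) = orbitProj ϖ H E x :=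
  (h.orbitProj_eq_iff.2 ⟨t, rfl⟩).symm

end RegularLevel

theorem continuous_orbitProj {ϖ : SymplecticForm n M} {H : M → ℝ} {E : ℝ} :
    Continuous (orbitProj ϖ H E) := continuous_quot_mk

/-! ### Flow boxes around transversal pieces. -/

/-- A function with nonzero derivative in the direction `v` is locally injective along `v`. -/
theorem eventually_eq_zero_of_apply_add_smul_eq {F : Type*} [NormedAddCommGroup F]
    [NormedSpace ℝ F] {f : F → ℝ} {L : F →L[ℝ] ℝ} {x v : F} (hf : HasStrictFDerivAt f L x)
    (hv : L v ≠ 0) :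
    ∀ᶠ q in 𝓝 (x, (0 : ℝ)), f (q.1 + q.2 • v) = f q.1 → q.2 = 0 := by
  have hv0 : 0 < ‖v‖ := norm_pos_iff.2 fun h ↦ hv (by rw [h, map_zero])
  -- With this constant, equal values of f would give |q.2| ‖L v‖ ≤ |q.2| ‖L v‖ / 2.
  have hc : 0 < ‖L v‖ / (2 * ‖v‖) := div_pos (norm_pos_iff.2 hv) (by positivity)
  have h1 := hf.isLittleO.bound hc
  have h2 : Tendsto (fun q : F × ℝ ↦ (q.1 + q.2 • v, q.1)) (𝓝 (x, (0 : ℝ))) (𝓝 (x, x)) := by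
    have : Continuous fun q : F × ℝ ↦ (q.1 + q.2 • v, q.1) := by fun_prop
    simpa using this.tendsto (x, (0 : ℝ))
  filter_upwards [h2.eventually h1] with q hq heq
  by_contra h0
  simp only [heq, sub_self, zero_sub, add_sub_cancel_left, map_smul, norm_neg, norm_smul] at hq
  have h3 : 0 < ‖q.2‖ := norm_pos_iff.2 h0
  have h4 : ‖L v‖ / (2 * ‖v‖) * (‖q.2‖ * ‖v‖) = ‖q.2‖ * ‖L v‖ / 2 := by
    field_simp
  rw [h4] at hq
  have h5 : 0 < ‖q.2‖ * ‖L v‖ := mul_pos h3 (norm_pos_iff.2 hv)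
  linarith

namespace Piece

variable (σ : Piece n M)

theorem mdifferentiableAt {u : Eucl (2 * (n - 1))} (hu : u ∈ σ.dom) :
    MDifferentiableAt 𝓘(ℝ, Eucl (2 * (n - 1))) (𝓡 (2 * n)) σ.map u :=
  (σ.smoothOn.contMDiffAt (σ.isOpen_dom.mem_nhds hu)).mdifferentiableAt (by simp)

theorem mfderiv_energy {H : M → ℝ} {E : ℝ} (hH : ContMDiff (𝓡 (2 * n)) 𝓘(ℝ, ℝ) ∞ H)
    (hmem : ∀ u ∈ σ.dom, σ.map u ∈ energySurface H E) {u : Eucl (2 * (n - 1))} (hu : u ∈ σ.dom)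
    (a : Eucl (2 * (n - 1))) :
    mfderiv (𝓡 (2 * n)) 𝓘(ℝ, ℝ) H (σ.map u)
      (mfderiv 𝓘(ℝ, Eucl (2 * (n - 1))) (𝓡 (2 * n)) σ.map u a) = 0 := by
  have h1 := mfderiv_comp (I := 𝓘(ℝ, Eucl (2 * (n - 1)))) (I' := 𝓡 (2 * n)) (I'' := 𝓘(ℝ, ℝ)) u
    (hH.mdifferentiableAt (by simp) : MDifferentiableAt (𝓡 (2 * n)) 𝓘(ℝ, ℝ) H (σ.map u))
    (σ.mdifferentiableAt hu)
  have h2 : mfderiv 𝓘(ℝ, Eucl (2 * (n - 1))) 𝓘(ℝ, ℝ) (H ∘ σ.map) u = 0 := by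
    have : H ∘ σ.map =ᶠ[𝓝 u] fun _ ↦ E := by
      filter_upwards [σ.isOpen_dom.mem_nhds hu] with v hv
      exact hmem v hv
    rw [this.mfderiv_eq]
    exact mfderiv_const
  rw [h2] at h1
  exact (DFunLike.congr_fun h1 a).symm

end Piece

namespace RegularLevel

variable {ϖ : SymplecticForm n M} {H : M → ℝ} {E : ℝ} (h : RegularLevel ϖ H E) [T2Space M]

include h

/-- The flow box around a point of a transversal piece: near this point, `τ` and `ψ` invert the map
`(t, u) ↦ Φ_t (σ u)` on the energy surface. -/
theorem exists_flowBox (hn : 1 ≤ n) (σ : Piece n M)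
    (hmem : ∀ u ∈ σ.dom, σ.map u ∈ energySurface H E) {u₀ : Eucl (2 * (n - 1))}
    (hu₀ : u₀ ∈ σ.dom) (htr : hamField ϖ H (σ.map u₀) ∉
      Set.range (mfderiv 𝓘(ℝ, Eucl (2 * (n - 1))) (𝓡 (2 * n)) σ.map u₀)) :
    ∃ (τ : M → ℝ) (ψ : M → Eucl (2 * (n - 1))),
      (∀ᶠ y in 𝓝 (σ.map u₀), MDifferentiableAt (𝓡 (2 * n)) 𝓘(ℝ, ℝ) τ y) ∧
      (∀ᶠ y in 𝓝 (σ.map u₀),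
        MDifferentiableAt (𝓡 (2 * n)) 𝓘(ℝ, Eucl (2 * (n - 1))) ψ y) ∧
      (∀ᶠ q in 𝓝 ((0 : ℝ), u₀), τ (flow ϖ H q.1 (σ.map q.2)) = q.1 ∧
        ψ (flow ϖ H q.1 (σ.map q.2)) = q.2) ∧
      (∀ᶠ y in 𝓝[energySurface H E] (σ.map u₀),
        ψ y ∈ σ.dom ∧ flow ϖ H (τ y) (σ.map (ψ y)) = y) := by
  let p := σ.map u₀
  have hpA : p ∈ energySurface H E := hmem u₀ hu₀
  obtain ⟨ε, hε, V, hV, hpV, Ψ, hΨ0, hΨH, hΨi, hΨf, hΨs, -⟩ := h.exists_local_flow_eq p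
  let e := chartAt (Eucl (2 * n)) p
  have he : e ∈ atlas (Eucl (2 * n)) M := chart_mem_atlas _ p
  have hp : p ∈ e.source := mem_chart_source (Eucl (2 * n)) p
  have hep := e.map_source hp
  have hinv : e.symm (e p) = p := e.left_inv hp
  have hmd := chart_mdifferentiable he
  -- Time and section parameters give only 2n - 1 coordinates. A direction on which dH does not
  -- vanish supplies the missing one, so that the inverse function theorem applies on a full
  -- neighbourhood. Points off the surface are moved by the local flow Ψ.
  obtain ⟨w₀, hw₀⟩ : ∃ w₀ : TangentSpace (𝓡 (2 * n)) p,
      mfderiv (𝓡 (2 * n)) 𝓘(ℝ, ℝ) H p w₀ ≠ 0 := by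
    by_contra! hcon
    exact h.regular p hpA (ContinuousLinearMap.ext hcon)
  let De : Eucl (2 * n) →L[ℝ] Eucl (2 * n) := mfderiv (𝓡 (2 * n)) 𝓘(ℝ, Eucl (2 * n)) e p
  let Ds : Eucl (2 * (n - 1)) →L[ℝ] Eucl (2 * n) :=
    mfderiv 𝓘(ℝ, Eucl (2 * (n - 1))) (𝓡 (2 * n)) σ.map u₀
  let dH : Eucl (2 * n) →L[ℝ] ℝ := mfderiv (𝓡 (2 * n)) 𝓘(ℝ, ℝ) H p
  let X : Eucl (2 * n) := hamField ϖ H p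
  let w : Eucl (2 * n) := w₀
  have hDe : Function.Injective De := by
    intro a b hab
    have h1 := hmd.symm_comp_deriv hp
    exact (DFunLike.congr_fun h1 a).symm.trans
      ((congrArg (mfderiv 𝓘(ℝ, Eucl (2 * n)) (𝓡 (2 * n)) e.symm (e p)) hab).trans
        (DFunLike.congr_fun h1 b))
  let v₀ : Eucl (2 * n) := De w
  -- the map to be inverted
  let k : Eucl (2 * (n - 1)) × ℝ → M := fun q ↦ e.symm (e (σ.map q.1) + q.2 • v₀)
  let G : ℝ × Eucl (2 * (n - 1)) × ℝ → Eucl (2 * n) := fun q ↦ e (Ψ q.1 (k q.2))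
  let a₀ : ℝ × Eucl (2 * (n - 1)) × ℝ := (0, u₀, 0)
  have hk0 : k (u₀, 0) = p := by simp [k, p, hinv]
  have hσs : ContMDiffAt 𝓘(ℝ, Eucl (2 * (n - 1))) (𝓡 (2 * n)) 1 σ.map u₀ :=
    (σ.smoothOn.contMDiffAt (σ.isOpen_dom.mem_nhds hu₀)).of_le (by simp)
  have hes : ContMDiffAt (𝓡 (2 * n)) 𝓘(ℝ, Eucl (2 * n)) 1 e p :=
    ((chart_contMDiffOn he).contMDiffAt (e.open_source.mem_nhds hp)).of_le (by simp)
  have hes' : ContMDiffAt 𝓘(ℝ, Eucl (2 * n)) (𝓡 (2 * n)) 1 e.symm (e p) :=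
    ((chart_contMDiffOn_symm he).contMDiffAt (e.open_target.mem_nhds hep)).of_le (by simp)
  have hσe : ContDiffAt ℝ 1 (fun u ↦ e (σ.map u)) u₀ :=
    (ContMDiffAt.comp u₀ (g := e) (f := σ.map) hes hσs).contDiffAt
  have hin : ContDiffAt ℝ 1 (fun q : ℝ × Eucl (2 * (n - 1)) × ℝ ↦
      e (σ.map q.2.1) + q.2.2 • v₀) a₀ := by
    have h1 : ContDiffAt ℝ 1 (fun q : ℝ × Eucl (2 * (n - 1)) × ℝ ↦ e (σ.map q.2.1)) a₀ :=
      ContDiffAt.comp (g := fun u ↦ e (σ.map u)) (f := fun q : ℝ × Eucl (2 * (n - 1)) × ℝ ↦ q.2.1)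
        a₀ hσe (by fun_prop)
    exact h1.add (by fun_prop)
  have hin0 : e (σ.map u₀) + (0 : ℝ) • v₀ = e p := by simp [p]
  have hkc : ContMDiffAt 𝓘(ℝ, ℝ × Eucl (2 * (n - 1)) × ℝ) (𝓡 (2 * n)) 1
      (fun q : ℝ × Eucl (2 * (n - 1)) × ℝ ↦ k q.2) a₀ := by
    refine ContMDiffAt.comp (g := e.symm) (f := fun q : ℝ × Eucl (2 * (n - 1)) × ℝ ↦
      e (σ.map q.2.1) + q.2.2 • v₀) a₀ ?_ hin.contMDiffAt
    change ContMDiffAt _ _ _ _ (e (σ.map u₀) + (0 : ℝ) • v₀)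
    rw [hin0]
    exact hes'
  have hΨc : ContMDiffAt 𝓘(ℝ, ℝ × Eucl (2 * (n - 1)) × ℝ) (𝓡 (2 * n)) 1
      (fun q : ℝ × Eucl (2 * (n - 1)) × ℝ ↦ Ψ q.1 (k q.2)) a₀ := by
    refine ContMDiffAt.comp (g := fun q : ℝ × M ↦ Ψ q.1 q.2)
      (f := fun q : ℝ × Eucl (2 * (n - 1)) × ℝ ↦ (q.1, k q.2)) a₀
      (I' := 𝓘(ℝ, ℝ).prod (𝓡 (2 * n))) ?_ ?_
    · change ContMDiffAt _ _ _ _ (0, k (u₀, 0))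
      rw [hk0]
      exact hΨs.contMDiffAt ((isOpen_Ioo.prod hV).mem_nhds ⟨⟨by linarith, hε⟩, hpV⟩)
    · have h1 : ContMDiffAt 𝓘(ℝ, ℝ × Eucl (2 * (n - 1)) × ℝ) 𝓘(ℝ, ℝ) 1
          (fun q : ℝ × Eucl (2 * (n - 1)) × ℝ ↦ q.1) a₀ :=
        (contDiffAt_fst (𝕜 := ℝ)).contMDiffAt
      exact h1.prodMk hkc
  have hΨa : Ψ 0 (k (u₀, 0)) = p := by rw [hk0, hΨ0 p hpV]
  have hG : ContDiffAt ℝ 1 G a₀ := by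
    refine (ContMDiffAt.comp (g := e) (f := fun q : ℝ × Eucl (2 * (n - 1)) × ℝ ↦ Ψ q.1 (k q.2)) a₀
      ?_ hΨc).contDiffAt
    change ContMDiffAt _ _ _ _ (Ψ 0 (k (u₀, 0)))
    rw [hΨa]
    exact hes
  have hGa : G a₀ = e p := congrArg e hΨa
  -- its derivative
  have hGd : HasFDerivAt G (fderiv ℝ G a₀) a₀ :=
    (hG.differentiableAt (by simp)).hasFDerivAt
  have hd1 : ∀ t : ℝ, fderiv ℝ G a₀ (t, 0, 0) = De (t • X) := by
    intro t
    have h1 : HasFDerivAt (fun t : ℝ ↦ ((t, u₀, 0) : ℝ × Eucl (2 * (n - 1)) × ℝ))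
        (ContinuousLinearMap.inl ℝ ℝ (Eucl (2 * (n - 1)) × ℝ)) 0 :=
      hasFDerivAt_prodMk_left (0 : ℝ) (u₀, (0 : ℝ))
    have h2 := HasFDerivAt.comp (g := G) (0 : ℝ) hGd h1
    have h3 : HasMFDerivAt 𝓘(ℝ, ℝ) (𝓡 (2 * n)) (Ψ · p) 0 _ :=
      (hΨi p hpV 0 ⟨by linarith, hε⟩).hasMFDerivAt (isOpen_Ioo.mem_nhds ⟨by linarith, hε⟩)
    have hes0 : HasMFDerivAt (𝓡 (2 * n)) 𝓘(ℝ, Eucl (2 * n)) e (Ψ 0 p)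
        (mfderiv (𝓡 (2 * n)) 𝓘(ℝ, Eucl (2 * n)) e (Ψ 0 p)) := by
      refine (hmd.mdifferentiableAt ?_).hasMFDerivAt
      rw [hΨ0 p hpV]; exact hp
    have h4 := hasMFDerivAt_iff_hasFDerivAt.1 (HasMFDerivAt.comp 0 hes0 h3)
    have h5 : G ∘ (fun t : ℝ ↦ ((t, u₀, 0) : ℝ × Eucl (2 * (n - 1)) × ℝ)) = e ∘ (Ψ · p) := by
      funext t
      simp only [G, Function.comp, hk0]
    rw [h5] at h2
    have h6 := DFunLike.congr_fun (h2.unique h4) t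
    have h7 : ∀ q, q = p → mfderiv (𝓡 (2 * n)) 𝓘(ℝ, Eucl (2 * n)) e q (t • hamField ϖ H q) =
        De (t • X) := by rintro q rfl; rfl
    exact h6.trans (h7 _ (hΨ0 p hpV))
  have hd2 : ∀ (a : Eucl (2 * (n - 1))) (s : ℝ),
      fderiv ℝ G a₀ (0, a, s) = De (Ds a) + s • v₀ := by
    intro a s
    have h1 : HasFDerivAt (fun q : Eucl (2 * (n - 1)) × ℝ ↦
        (((0 : ℝ), q) : ℝ × Eucl (2 * (n - 1)) × ℝ))
        (ContinuousLinearMap.inr ℝ ℝ (Eucl (2 * (n - 1)) × ℝ)) (u₀, 0) :=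
      hasFDerivAt_prodMk_right (0 : ℝ) (u₀, (0 : ℝ))
    have h2 := HasFDerivAt.comp (g := G) (u₀, (0 : ℝ)) hGd h1
    have h3 := hasMFDerivAt_iff_hasFDerivAt.1 (HasMFDerivAt.comp u₀
      (hmd.mdifferentiableAt hp).hasMFDerivAt (σ.mdifferentiableAt hu₀).hasMFDerivAt)
    have h3' : HasFDerivAt (e ∘ σ.map) (De.comp Ds) u₀ := h3
    have h4 : HasFDerivAt (fun q : Eucl (2 * (n - 1)) × ℝ ↦ (e ∘ σ.map) q.1 + q.2 • v₀)
        ((De.comp Ds).comp (ContinuousLinearMap.fst ℝ _ ℝ) +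
          (ContinuousLinearMap.snd ℝ _ ℝ).smulRight v₀) (u₀, (0 : ℝ)) :=
      (HasFDerivAt.comp (u₀, (0 : ℝ)) (f := Prod.fst) h3' hasFDerivAt_fst).add
        (hasFDerivAt_snd.smul_const v₀)
    have h5 : G ∘ (fun q : Eucl (2 * (n - 1)) × ℝ ↦
        (((0 : ℝ), q) : ℝ × Eucl (2 * (n - 1)) × ℝ)) =ᶠ[𝓝 (u₀, (0 : ℝ))]
        fun q : Eucl (2 * (n - 1)) × ℝ ↦ (e ∘ σ.map) q.1 + q.2 • v₀ := by
      have h6 : ContinuousAt (fun q : Eucl (2 * (n - 1)) × ℝ ↦ (e ∘ σ.map) q.1 + q.2 • v₀)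
        (u₀, (0 : ℝ)) := h4.continuousAt
      have h7 : (e ∘ σ.map) u₀ + (0 : ℝ) • v₀ = e p := hin0
      have h8 : ContinuousAt k (u₀, 0) := by
        refine ContinuousAt.comp (g := e.symm) ?_ h6
        change ContinuousAt e.symm ((e ∘ σ.map) u₀ + (0 : ℝ) • v₀)
        rw [h7]
        exact hes'.continuousAt
      have h9 := h8.eventually (hV.mem_nhds (by rw [hk0]; exact hpV))
      have h10 := h6.eventually (e.open_target.mem_nhds (by simp only [h7]; exact hep))
      filter_upwards [h9, h10] with q hq hq'
      have h11 : G (0, q) = e (k q) := by simp only [G, hΨ0 _ hq]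
      exact h11.trans (e.right_inv hq')
    have h6 := DFunLike.congr_fun (h2.unique (h4.congr_of_eventuallyEq h5)) (a, s)
    simpa using h6
  have hd : ∀ q : ℝ × Eucl (2 * (n - 1)) × ℝ,
      fderiv ℝ G a₀ q = De (q.1 • X + Ds q.2.1 + q.2.2 • w) := by
    rintro ⟨t, a, s⟩
    have h1 : ((t, a, s) : ℝ × Eucl (2 * (n - 1)) × ℝ) = (t, 0, 0) + (0, a, s) := by simp
    rw [h1, map_add, hd1, hd2, ← h1]
    simp only [map_add, map_smul, add_assoc, v₀]
  -- dH kills X and the tangent vectors of the piece but not w, so s = 0; transversality of X then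
  -- gives t = 0, and the immersion property gives a = 0.
  have hinj : Function.Injective (fderiv ℝ G a₀) := by
    rw [injective_iff_map_eq_zero]
    rintro ⟨t, a, s⟩ hq
    rw [hd] at hq
    have h1 : t • X + Ds a + s • w = 0 := hDe (hq.trans (map_zero De).symm)
    have hX : dH X = 0 := mfderiv_energy_hamField ϖ p
    have hDs : dH (Ds a) = 0 := σ.mfderiv_energy h.smooth hmem hu₀ a
    have h2 := congrArg dH h1
    rw [map_add, map_add, map_smul, map_smul, hX, hDs, smul_zero, zero_add, zero_add, map_zero,
      smul_eq_mul] at h2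
    have hs : s = 0 := (mul_eq_zero.1 h2).resolve_right hw₀
    rw [hs, zero_smul, add_zero] at h1
    have ht : t = 0 := by
      by_contra ht
      refine htr ⟨-(t⁻¹ • a), ?_⟩
      have h3 : Ds (-(t⁻¹ • a)) = X := by
        have h4 : Ds a = -(t • X) := (neg_eq_of_add_eq_zero_right h1).symm
        rw [map_neg, map_smul, h4, smul_neg, neg_neg, smul_smul, inv_mul_cancel₀ ht, one_smul]
      exact h3
    rw [ht, zero_smul, zero_add] at h1
    have ha : a = 0 := σ.immersion u₀ hu₀ (h1.trans (map_zero Ds).symm)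
    rw [ht, ha, hs]
    rfl
  have hfr : Module.finrank ℝ (ℝ × Eucl (2 * (n - 1)) × ℝ) = Module.finrank ℝ (Eucl (2 * n)) := by
    simp only [Module.finrank_prod, Module.finrank_self, finrank_euclideanSpace, Fintype.card_fin]
    omega
  let L : (ℝ × Eucl (2 * (n - 1)) × ℝ) ≃L[ℝ] Eucl (2 * n) :=
    (LinearEquiv.ofInjectiveOfFinrankEq (fderiv ℝ G a₀).toLinearMap hinj hfr).toContinuousLinearEquiv
  have hL : HasFDerivAt G (L : (ℝ × Eucl (2 * (n - 1)) × ℝ) →L[ℝ] Eucl (2 * n)) a₀ := hGd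
  let N := hG.toOpenPartialHomeomorph G hL (by simp)
  have hNs : a₀ ∈ N.source := hG.mem_toOpenPartialHomeomorph_source hL (by simp)
  have hNt : e p ∈ N.target := by
    have := hG.image_mem_toOpenPartialHomeomorph_target hL (by simp)
    rwa [hGa] at this
  have hNcoe : ∀ q, N q = G q := fun q ↦ by
    rw [show (N : _ → _) = G from hG.toOpenPartialHomeomorph_coe hL (by simp)]
  have hNa : N.symm (e p) = a₀ := by
    rw [← hGa, ← hNcoe]
    exact N.left_inv hNs
  have hNsm : ContDiffAt ℝ 1 N.symm (e p) := by
    have := hG.to_localInverse hL (by simp)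
    rwa [hGa] at this
  let Q : M → ℝ × Eucl (2 * (n - 1)) × ℝ := fun y ↦ N.symm (e y)
  have hQp : Q p = a₀ := hNa
  have hQ : ContMDiffAt (𝓡 (2 * n)) 𝓘(ℝ, ℝ × Eucl (2 * (n - 1)) × ℝ) 1 Q p :=
    ContMDiffAt.comp (g := N.symm) (f := e) p hNsm.contMDiffAt hes
  have hQ1 : ContMDiffAt (𝓡 (2 * n)) 𝓘(ℝ, ℝ) 1 (fun y ↦ (Q y).1) p :=
    ContMDiffAt.comp (g := Prod.fst) (f := Q) p
      (contDiffAt_fst (𝕜 := ℝ)).contMDiffAt hQ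
  have hQ2 : ContMDiffAt (𝓡 (2 * n)) 𝓘(ℝ, Eucl (2 * (n - 1))) 1 (fun y ↦ (Q y).2.1) p :=
    ContMDiffAt.comp (g := fun q : ℝ × Eucl (2 * (n - 1)) × ℝ ↦ q.2.1) (f := Q) p
      (by
        have : ContDiffAt ℝ 1 (fun q : ℝ × Eucl (2 * (n - 1)) × ℝ ↦ q.2.1) (Q p) := by fun_prop
        exact this.contMDiffAt) hQ
  refine ⟨fun y ↦ (Q y).1, fun y ↦ (Q y).2.1, ContMDiffAt.eventually_mdifferentiableAt hQ1,
    ContMDiffAt.eventually_mdifferentiableAt hQ2, ?_, ?_⟩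
  · have hc : Tendsto (fun q : ℝ × Eucl (2 * (n - 1)) ↦
        ((q.1, q.2, 0) : ℝ × Eucl (2 * (n - 1)) × ℝ)) (𝓝 ((0 : ℝ), u₀)) (𝓝 a₀) := by
      have : Continuous fun q : ℝ × Eucl (2 * (n - 1)) ↦
        ((q.1, q.2, 0) : ℝ × Eucl (2 * (n - 1)) × ℝ) := by fun_prop
      exact this.tendsto ((0 : ℝ), u₀)
    have hc2 : Tendsto (fun q : ℝ × Eucl (2 * (n - 1)) ↦ σ.map q.2) (𝓝 ((0 : ℝ), u₀)) (𝓝 p) :=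
      Tendsto.comp (g := σ.map) (y := 𝓝 u₀) hσs.continuousAt continuous_snd.continuousAt
    have hc3 : ∀ᶠ q in 𝓝 ((0 : ℝ), u₀), q.1 ∈ Ioo (-ε) ε ∧ q.2 ∈ σ.dom :=
      (isOpen_Ioo.prod σ.isOpen_dom).mem_nhds ⟨⟨by linarith, hε⟩, hu₀⟩
    filter_upwards [hc.eventually (N.open_source.mem_nhds hNs),
      hc2.eventually (e.open_source.mem_nhds hp), hc2.eventually (hV.mem_nhds hpV), hc3]
      with q h1 h2 h3 h4
    have h5 : k (q.2, 0) = σ.map q.2 := by simp [k, e.left_inv h2]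
    have h6 : G (q.1, q.2, 0) = e (flow ϖ H q.1 (σ.map q.2)) := by
      simp only [G, h5]
      rw [hΨf _ h3 (hmem _ h4.2) _ h4.1]
    have h7 : Q (flow ϖ H q.1 (σ.map q.2)) = (q.1, q.2, 0) := by
      simp only [Q]
      rw [← h6, ← hNcoe]
      exact N.left_inv h1
    rw [h7]
    exact ⟨rfl, rfl⟩
  · have hQc : Tendsto Q (𝓝[energySurface H E] p) (𝓝 a₀) := by
      have := hQ.continuousAt.tendsto
      rw [hQp] at this
      exact this.mono_left nhdsWithin_le_nhds
    have hE : HasStrictFDerivAt (H ∘ e.symm) (fderiv ℝ (H ∘ e.symm) (e p)) (e p) :=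
      ((contDiffOn_chart_energy he h.smooth).contDiffAt (e.open_target.mem_nhds hep)
        ).hasStrictFDerivAt (by simp)
    have hE0 : fderiv ℝ (H ∘ e.symm) (e p) v₀ ≠ 0 := by
      rw [fderiv_chart_energy he hep h.smooth]
      have h1 : ∀ q, q = p → ∀ z : Eucl (2 * n), z = w →
          mfderiv (𝓡 (2 * n)) 𝓘(ℝ, ℝ) H q z ≠ (0 : ℝ) := by
        rintro q rfl z rfl; exact hw₀
      refine h1 _ hinv _ ?_
      exact DFunLike.congr_fun (hmd.symm_comp_deriv hp) w
    have hloc := eventually_eq_zero_of_apply_add_smul_eq hE hE0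
    have hc1 : Tendsto (fun q : ℝ × Eucl (2 * (n - 1)) × ℝ ↦ (e (σ.map q.2.1), q.2.2)) (𝓝 a₀)
        (𝓝 (e p, (0 : ℝ))) := by
      refine Tendsto.prodMk_nhds ?_ ?_
      · exact Tendsto.comp (g := fun u ↦ e (σ.map u)) (y := 𝓝 u₀) hσe.continuousAt
          ((by fun_prop : Continuous fun q : ℝ × Eucl (2 * (n - 1)) × ℝ ↦ q.2.1).tendsto a₀)
      · exact (by fun_prop : Continuous fun q : ℝ × Eucl (2 * (n - 1)) × ℝ ↦ q.2.2).tendsto a₀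
    have hc2 : ∀ᶠ q in 𝓝 a₀, q.1 ∈ Ioo (-ε) ε ∧ q.2.1 ∈ σ.dom := by
      have : (Ioo (-ε) ε ×ˢ (σ.dom ×ˢ (univ : Set ℝ))) ∈ 𝓝 a₀ :=
        (isOpen_Ioo.prod (σ.isOpen_dom.prod isOpen_univ)).mem_nhds
          ⟨⟨by simp [a₀, hε], hε⟩, hu₀, mem_univ _⟩
      filter_upwards [this] with q hq
      exact ⟨hq.1, hq.2.1⟩
    have hc3 : ∀ᶠ q in 𝓝 a₀, k q.2 ∈ V := by
      refine hkc.continuousAt.eventually (hV.mem_nhds ?_)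
      change k (u₀, 0) ∈ V
      rw [hk0]; exact hpV
    have hc4 : ∀ᶠ q in 𝓝 a₀, Ψ q.1 (k q.2) ∈ e.source := by
      refine hΨc.continuousAt.eventually (e.open_source.mem_nhds ?_)
      change Ψ 0 (k (u₀, 0)) ∈ e.source
      rw [hΨa]; exact hp
    have hσc : Tendsto (fun q : ℝ × Eucl (2 * (n - 1)) × ℝ ↦ σ.map q.2.1) (𝓝 a₀) (𝓝 p) :=
      Tendsto.comp (g := σ.map) (y := 𝓝 u₀) hσs.continuousAt
          ((by fun_prop : Continuous fun q : ℝ × Eucl (2 * (n - 1)) × ℝ ↦ q.2.1).tendsto a₀)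
    filter_upwards [hQc.eventually (hc1.eventually hloc), hQc.eventually hc2, hQc.eventually hc3,
      hQc.eventually hc4, hQc.eventually (hσc.eventually (e.open_source.mem_nhds hp)),
      hQc.eventually (hσc.eventually (hV.mem_nhds hpV)), self_mem_nhdsWithin,
      nhdsWithin_le_nhds (e.open_source.mem_nhds hp),
      nhdsWithin_le_nhds (hes.continuousAt.eventually (N.open_target.mem_nhds hNt))]
      with y b1 b2 b3 b4 b5 b6 hyA b7 b8
    have c1 : G (Q y) = e y := by
      rw [← hNcoe]
      exact N.right_inv b8
    have c2 : Ψ (Q y).1 (k (Q y).2) = y := e.injOn b4 b7 c1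
    have c3 : H (k (Q y).2) = E := by
      rw [← hΨH _ b3 _ b2.1, c2]
      exact hyA
    have c4 : (Q y).2.2 = 0 := by
      refine b1 ?_
      simp only [Function.comp, e.left_inv b5]
      exact c3.trans (hmem _ b2.2).symm
    have c5 : k (Q y).2 = σ.map (Q y).2.1 := by
      simp only [k, c4, zero_smul, add_zero]
      exact e.left_inv b5
    refine ⟨b2.2, ?_⟩
    rw [c5, hΨf _ b6 (hmem _ b2.2) _ b2.1] at c2
    exact c2

end RegularLevel

/-! ### The top exterior power of a bilinear form and determinants. -/

/-- The index k belongs to exactly one of the pairs, the one numbered k / 2, and its parity tells in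
which slot. All other factors are constant in z, so multilinearity of the product reduces to
linearity of B in that slot. -/
theorem exists_linearMap_prod_update {V : Type*} [AddCommGroup V] [Module ℝ V]
    (B : V →ₗ[ℝ] V →ₗ[ℝ] ℝ) (m : ℕ) [DecidableEq (Fin (2 * m))] (v : Fin (2 * m) → V)
    (k : Fin (2 * m)) : ∃ ℓ : V →ₗ[ℝ] ℝ, ∀ z, ∏ i : Fin m,
      B (Function.update v k z ⟨2 * i.1, by omega⟩)
        (Function.update v k z ⟨2 * i.1 + 1, by omega⟩) = ℓ z := by
  have hk : k.1 / 2 < m := by omega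
  have h1 : ∀ z, ∏ i : Fin m, B (Function.update v k z ⟨2 * i.1, by omega⟩)
      (Function.update v k z ⟨2 * i.1 + 1, by omega⟩) =
      B (Function.update v k z ⟨2 * (k.1 / 2), by omega⟩)
        (Function.update v k z ⟨2 * (k.1 / 2) + 1, by omega⟩) *
      ∏ i ∈ Finset.univ.erase (⟨k.1 / 2, hk⟩ : Fin m), B (v ⟨2 * i.1, by omega⟩)
        (v ⟨2 * i.1 + 1, by omega⟩) := by
    intro z
    rw [← Finset.mul_prod_erase Finset.univ _ (Finset.mem_univ (⟨k.1 / 2, hk⟩ : Fin m))]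
    congr 1
    refine Finset.prod_congr rfl fun i hi ↦ ?_
    have hi' : i.1 ≠ k.1 / 2 := fun hc ↦ (Finset.mem_erase.1 hi).1 (Fin.ext hc)
    rw [Function.update_of_ne (fun hc ↦ hi' (by rw [← hc]; simp)),
      Function.update_of_ne (fun hc ↦ hi' (by rw [← hc]; simp; omega))]
  generalize (∏ i ∈ Finset.univ.erase (⟨k.1 / 2, hk⟩ : Fin m), B (v ⟨2 * i.1, by omega⟩)
        (v ⟨2 * i.1 + 1, by omega⟩)) = c at h1
  rcases Nat.mod_two_eq_zero_or_one k.1 with h0 | h0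
  · have e1 : (⟨2 * (k.1 / 2), by omega⟩ : Fin (2 * m)) = k := Fin.ext (by simp; omega)
    have e2 : (⟨2 * (k.1 / 2) + 1, by omega⟩ : Fin (2 * m)) ≠ k :=
      fun hc ↦ by have := congrArg Fin.val hc; simp at this; omega
    refine ⟨c • B.flip (v ⟨2 * (k.1 / 2) + 1, by omega⟩), fun z ↦ ?_⟩
    rw [h1, e1, Function.update_self, Function.update_of_ne e2, mul_comm]
    rfl
  · have e1 : (⟨2 * (k.1 / 2), by omega⟩ : Fin (2 * m)) ≠ k :=
      fun hc ↦ by have := congrArg Fin.val hc; simp at this; omega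
    have e2 : (⟨2 * (k.1 / 2) + 1, by omega⟩ : Fin (2 * m)) = k := Fin.ext (by simp; omega)
    refine ⟨c • B (v ⟨2 * (k.1 / 2), by omega⟩), fun z ↦ ?_⟩
    rw [h1, e2, Function.update_self, Function.update_of_ne e1, mul_comm]
    rfl

/-- The product of the values of a bilinear form on consecutive pairs, as a multilinear map. -/
def pairProd {V : Type*} [AddCommGroup V] [Module ℝ V] (B : V →ₗ[ℝ] V →ₗ[ℝ] ℝ) (m : ℕ) :
    MultilinearMap ℝ (fun _ : Fin (2 * m) ↦ V) ℝ where
  toFun v := ∏ i : Fin m, B (v ⟨2 * i.1, by omega⟩) (v ⟨2 * i.1 + 1, by omega⟩)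
  map_update_add' v k x y := by
    obtain ⟨ℓ, hℓ⟩ := exists_linearMap_prod_update B m v k
    rw [hℓ, hℓ, hℓ, map_add]
  map_update_smul' v k c x := by
    obtain ⟨ℓ, hℓ⟩ := exists_linearMap_prod_update B m v k
    rw [hℓ, hℓ, map_smul]

/-- Once the sum is an alternating map of top degree, it is a multiple of the determinant of a
basis, which yields its transformation law. -/
theorem extPow_eq_alternatization {V : Type*} [AddCommGroup V] [Module ℝ V]
    (B : V →ₗ[ℝ] V →ₗ[ℝ] ℝ) (m : ℕ) (v : Fin (2 * m) → V) :
    extPow (fun x y ↦ B x y) m v =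
      ((1 / (2 ^ m * (m.factorial : ℝ))) • MultilinearMap.alternatization (pairProd B m)) v := by
  rw [AlternatingMap.smul_apply, MultilinearMap.alternatization_apply, smul_eq_mul, extPow]
  congr 1
  refine Finset.sum_congr rfl fun p _ ↦ ?_
  rw [MultilinearMap.domDomCongr_apply, Units.smul_def, zsmul_eq_mul]
  rfl

/-- The top exterior power of an alternating form on `ℝ^{2m}` is multiplied by the determinant. -/
theorem extPow_comp {m : ℕ} (B : Eucl (2 * m) →ₗ[ℝ] Eucl (2 * m) →ₗ[ℝ] ℝ)
    (A : Eucl (2 * m) →ₗ[ℝ] Eucl (2 * m)) :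
    extPow (fun x y ↦ B (A x) (A y)) m (fun i ↦ EuclideanSpace.single i (1 : ℝ)) =
      LinearMap.det A * extPow (fun x y ↦ B x y) m (fun i ↦ EuclideanSpace.single i (1 : ℝ)) := by
  let e := (EuclideanSpace.basisFun (Fin (2 * m)) ℝ).toBasis
  have he : (fun i ↦ EuclideanSpace.single i (1 : ℝ)) = e := by
    funext i; simp [e]
  have h1 : extPow (fun x y ↦ B (A x) (A y)) m (fun i ↦ EuclideanSpace.single i (1 : ℝ)) =
      extPow (fun x y ↦ B x y) m (A ∘ (fun i ↦ EuclideanSpace.single i (1 : ℝ))) := rfl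
  rw [h1, extPow_eq_alternatization, extPow_eq_alternatization, he]
  generalize ((1 / (2 ^ m * (m.factorial : ℝ))) • MultilinearMap.alternatization (pairProd B m)) = f
  rw [f.eq_smul_basis_det e]
  simp only [AlternatingMap.smul_apply, smul_eq_mul]
  rw [Module.Basis.det_comp, Module.Basis.det_self]
  ring

/-- The form `ϖ` at `x` as a function on pairs of vectors of the model space. -/
def SymplecticForm.ev (ϖ : SymplecticForm n M) (x : M) (v w : Eucl (2 * n)) : ℝ :=
  ϖ.toFun x v w

namespace SymplecticForm

variable (ϖ : SymplecticForm n M)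

theorem ev_add_left (x : M) (a b c : Eucl (2 * n)) : ϖ.ev x (a + b) c = ϖ.ev x a c + ϖ.ev x b c :=
  congrArg (fun f : Eucl (2 * n) →L[ℝ] ℝ ↦ f c) (map_add (ϖ.toFun x) a b)

theorem ev_add_right (x : M) (a b c : Eucl (2 * n)) : ϖ.ev x a (b + c) = ϖ.ev x a b + ϖ.ev x a c :=
  map_add (ϖ.toFun x a) b c

theorem ev_smul_left (x : M) (r : ℝ) (a c : Eucl (2 * n)) : ϖ.ev x (r • a) c = r * ϖ.ev x a c :=
  congrArg (fun f : Eucl (2 * n) →L[ℝ] ℝ ↦ f c) (map_smul (ϖ.toFun x) r a)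

theorem ev_smul_right (x : M) (r : ℝ) (a c : Eucl (2 * n)) : ϖ.ev x a (r • c) = r * ϖ.ev x a c :=
  map_smul (ϖ.toFun x a) r c

theorem ev_self (x : M) (a : Eucl (2 * n)) : ϖ.ev x a a = 0 := ϖ.alternating x a

theorem ev_swap (x : M) (a b : Eucl (2 * n)) : ϖ.ev x a b = -ϖ.ev x b a := by
  have h := ϖ.ev_self x (a + b)
  rw [ev_add_left, ev_add_right, ev_add_right, ev_self, ev_self] at h
  linarith

/-- This is why the form descends to the orbit space: vectors tangent to the energy surface are
ϖ-orthogonal to X, so components along X do not count. -/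
theorem ev_hamField (H : M → ℝ) (x : M) (a : Eucl (2 * n))
    (ha : mfderiv (𝓡 (2 * n)) 𝓘(ℝ, ℝ) H x a = (0 : ℝ)) : ϖ.ev x (hamField ϖ H x) a = 0 := by
  have h := DFunLike.congr_fun (hamField_spec ϖ H x) a
  refine h.trans ?_
  exact neg_eq_zero.2 ha

end SymplecticForm

theorem Piece.coeff_eq (ϖ : SymplecticForm n M) (σ : Piece n M) (u : Eucl (2 * (n - 1)))
    (D : Eucl (2 * (n - 1)) →L[ℝ] Eucl (2 * n))
    (hD : D = mfderiv 𝓘(ℝ, Eucl (2 * (n - 1))) (𝓡 (2 * n)) σ.map u) :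
    σ.coeff ϖ u = extPow (fun v w ↦ ϖ.ev (σ.map u) (D v) (D w)) (n - 1)
      (fun i ↦ EuclideanSpace.single i (1 : ℝ)) := by
  subst hD; rfl

/-! ### Comparison of two sections through one orbit. -/

namespace RegularLevel

variable {ϖ : SymplecticForm n M} {H : M → ℝ} {E : ℝ} (h : RegularLevel ϖ H E) [T2Space M]

include h

/-- Two transversal pieces which meet the same orbit are related, near the intersection, by a
map between the parameter domains, whose determinant relates the coefficients of the volumes. -/
theorem exists_transition (hn : 1 ≤ n) (σ₁ σ₂ : Piece n M)
    (hmem₁ : ∀ u ∈ σ₁.dom, σ₁.map u ∈ energySurface H E)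
    (hmem₂ : ∀ u ∈ σ₂.dom, σ₂.map u ∈ energySurface H E) {u₁ u₂ : Eucl (2 * (n - 1))}
    (hu₁ : u₁ ∈ σ₁.dom) (hu₂ : u₂ ∈ σ₂.dom)
    (htr : hamField ϖ H (σ₂.map u₂) ∉
      Set.range (mfderiv 𝓘(ℝ, Eucl (2 * (n - 1))) (𝓡 (2 * n)) σ₂.map u₂))
    {T : ℝ} (hT : flow ϖ H T (σ₁.map u₁) = σ₂.map u₂) :
    ∃ (g : Eucl (2 * (n - 1)) → Eucl (2 * (n - 1))) (s : Eucl (2 * (n - 1)) → ℝ)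
      (G : Eucl (2 * (n - 1)) →L[ℝ] Eucl (2 * (n - 1))), HasFDerivAt g G u₁ ∧ g u₁ = u₂ ∧
      (∀ᶠ u in 𝓝 u₁, g u ∈ σ₂.dom ∧
        flow ϖ H (s u) (σ₂.map (g u)) = flow ϖ H T (σ₁.map u)) ∧
      σ₁.coeff ϖ u₁ = G.det * σ₂.coeff ϖ u₂ := by
  obtain ⟨τ, ψ, hτ, hψ, hinv, hbox⟩ := h.exists_flowBox hn σ₂ hmem₂ hu₂ htr
  obtain ⟨Ψ, hΨ, hΨf, hΨs⟩ := h.hasSymplecticExtension (hmem₁ u₁ hu₁) T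
  obtain ⟨ε, hε, V, hV, hpV, Θ, hΘ0, hΘH, hΘi, hΘf, hΘs, -⟩ := h.exists_local_flow_eq (σ₂.map u₂)
  have h0ε : (0 : ℝ) ∈ Ioo (-ε) ε := ⟨by linarith, hε⟩
  have hΨ1 : Ψ (σ₁.map u₁) = σ₂.map u₂ :=
    (hΨf.self_of_nhdsWithin (hmem₁ u₁ hu₁)).trans hT
  have hΨd : MDifferentiableAt (𝓡 (2 * n)) (𝓡 (2 * n)) Ψ (σ₁.map u₁) :=
    hΨ.mdifferentiableAt (by simp)
  have hσd₁ := σ₁.mdifferentiableAt hu₁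
  have hσd₂ := σ₂.mdifferentiableAt hu₂
  -- the first piece transported by the flow
  let f : Eucl (2 * (n - 1)) → M := Ψ ∘ σ₁.map
  have hf1 : f u₁ = σ₂.map u₂ := hΨ1
  have hfd : MDifferentiableAt 𝓘(ℝ, Eucl (2 * (n - 1))) (𝓡 (2 * n)) f u₁ := hΨd.comp u₁ hσd₁
  have hτd : MDifferentiableAt (𝓡 (2 * n)) 𝓘(ℝ, ℝ) τ (f u₁) := by
    rw [hf1]; exact hτ.self_of_nhds
  have hψd : MDifferentiableAt (𝓡 (2 * n)) 𝓘(ℝ, Eucl (2 * (n - 1))) ψ (f u₁) := by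
    rw [hf1]; exact hψ.self_of_nhds
  let g := ψ ∘ f
  let s := τ ∘ f
  have hgd : DifferentiableAt ℝ g u₁ := (hψd.comp u₁ hfd).differentiableAt
  have hsd : DifferentiableAt ℝ s u₁ := (hτd.comp u₁ hfd).differentiableAt
  have hq0 := hinv.self_of_nhds
  simp only [h.flow_zero (hmem₂ u₂ hu₂)] at hq0
  have hs1 : s u₁ = 0 := (congrArg τ hf1).trans hq0.1
  have hg1 : g u₁ = u₂ := (congrArg ψ hf1).trans hq0.2
  have hσA : Tendsto σ₁.map (𝓝 u₁) (𝓝[energySurface H E] (σ₁.map u₁)) := by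
    refine tendsto_nhdsWithin_iff.2 ⟨hσd₁.continuousAt, ?_⟩
    filter_upwards [σ₁.isOpen_dom.mem_nhds hu₁] with u hu using hmem₁ u hu
  have hfA : Tendsto f (𝓝 u₁) (𝓝[energySurface H E] (σ₂.map u₂)) := by
    refine tendsto_nhdsWithin_iff.2 ⟨?_, ?_⟩
    · rw [← hf1]; exact hfd.continuousAt
    · filter_upwards [hσA.eventually hΨf, σ₁.isOpen_dom.mem_nhds hu₁] with u hu hu'
      change Ψ (σ₁.map u) ∈ _
      rw [hu]
      exact h.flow_mem (hmem₁ u hu') T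
  have hfl : ∀ᶠ u in 𝓝 u₁, f u = flow ϖ H T (σ₁.map u) := hσA.eventually hΨf
  have hloc : ∀ᶠ u in 𝓝 u₁, g u ∈ σ₂.dom ∧ flow ϖ H (s u) (σ₂.map (g u)) = f u :=
    hfA.eventually hbox
  refine ⟨g, s, fderiv ℝ g u₁, hgd.hasFDerivAt, hg1, ?_, ?_⟩
  · filter_upwards [hloc, hfl] with u hu hu'
    exact ⟨hu.1, hu.2.trans hu'⟩
  -- the derivative of the transported piece
  let D₁ : Eucl (2 * (n - 1)) →L[ℝ] Eucl (2 * n) :=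
    mfderiv 𝓘(ℝ, Eucl (2 * (n - 1))) (𝓡 (2 * n)) σ₁.map u₁
  let D₂ : Eucl (2 * (n - 1)) →L[ℝ] Eucl (2 * n) :=
    mfderiv 𝓘(ℝ, Eucl (2 * (n - 1))) (𝓡 (2 * n)) σ₂.map u₂
  let DΨ : Eucl (2 * n) →L[ℝ] Eucl (2 * n) := mfderiv (𝓡 (2 * n)) (𝓡 (2 * n)) Ψ (σ₁.map u₁)
  let X : Eucl (2 * n) := hamField ϖ H (σ₂.map u₂)
  let F : ℝ × Eucl (2 * (n - 1)) → M := fun q ↦ Θ q.1 (σ₂.map q.2)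
  have hF : MDifferentiableAt 𝓘(ℝ, ℝ × Eucl (2 * (n - 1))) (𝓡 (2 * n)) F (0, u₂) := by
    have h1 : ContMDiffAt 𝓘(ℝ, ℝ × Eucl (2 * (n - 1))) (𝓡 (2 * n)) 1 F (0, u₂) := by
      refine ContMDiffAt.comp (g := fun q : ℝ × M ↦ Θ q.1 q.2)
        (f := fun q : ℝ × Eucl (2 * (n - 1)) ↦ (q.1, σ₂.map q.2)) (0, u₂)
        (I' := 𝓘(ℝ, ℝ).prod (𝓡 (2 * n))) ?_ ?_
      · exact hΘs.contMDiffAt ((isOpen_Ioo.prod hV).mem_nhds ⟨h0ε, hpV⟩)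
      · have h1 : ContMDiffAt 𝓘(ℝ, ℝ × Eucl (2 * (n - 1))) 𝓘(ℝ, ℝ) 1
            (fun q : ℝ × Eucl (2 * (n - 1)) ↦ q.1) (0, u₂) :=
          (contDiffAt_fst (𝕜 := ℝ)).contMDiffAt
        have h2 : ContMDiffAt 𝓘(ℝ, ℝ × Eucl (2 * (n - 1))) 𝓘(ℝ, Eucl (2 * (n - 1))) 1
            (fun q : ℝ × Eucl (2 * (n - 1)) ↦ q.2) (0, u₂) :=
          (contDiffAt_snd (𝕜 := ℝ)).contMDiffAt
        have h3 : ContMDiffAt 𝓘(ℝ, Eucl (2 * (n - 1))) (𝓡 (2 * n)) 1 σ₂.map u₂ :=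
          (σ₂.smoothOn.contMDiffAt (σ₂.isOpen_dom.mem_nhds hu₂)).of_le (by simp)
        exact h1.prodMk (ContMDiffAt.comp (g := σ₂.map)
          (f := fun q : ℝ × Eucl (2 * (n - 1)) ↦ q.2) (0, u₂) h3 h2)
    exact h1.mdifferentiableAt (by simp)
  let DF : ℝ × Eucl (2 * (n - 1)) →L[ℝ] Eucl (2 * n) :=
    mfderiv 𝓘(ℝ, ℝ × Eucl (2 * (n - 1))) (𝓡 (2 * n)) F (0, u₂)
  have hDF1 : ∀ t : ℝ, DF (t, 0) = t • X := by
    intro t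
    have h1 : HasMFDerivAt 𝓘(ℝ, ℝ) 𝓘(ℝ, ℝ × Eucl (2 * (n - 1)))
        (fun t : ℝ ↦ ((t, u₂) : ℝ × Eucl (2 * (n - 1)))) 0
        (ContinuousLinearMap.inl ℝ ℝ (Eucl (2 * (n - 1)))) :=
      (hasFDerivAt_prodMk_left (0 : ℝ) u₂).hasMFDerivAt
    have h2 := HasMFDerivAt.comp (g := F) (0 : ℝ) hF.hasMFDerivAt h1
    have h3 : HasMFDerivAt 𝓘(ℝ, ℝ) (𝓡 (2 * n)) (Θ · (σ₂.map u₂)) 0 _ :=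
      (hΘi _ hpV 0 h0ε).hasMFDerivAt (isOpen_Ioo.mem_nhds h0ε)
    have h6 := DFunLike.congr_fun (hasMFDerivAt_unique h2 h3) t
    have h7 : ∀ q, q = σ₂.map u₂ → (t • hamField ϖ H q : Eucl (2 * n)) = t • X := by
      rintro q rfl; rfl
    exact Eq.trans h6 (h7 _ (hΘ0 _ hpV))
  have hDF2 : ∀ a : Eucl (2 * (n - 1)), DF (0, a) = D₂ a := by
    intro a
    have h1 : HasMFDerivAt 𝓘(ℝ, Eucl (2 * (n - 1))) 𝓘(ℝ, ℝ × Eucl (2 * (n - 1)))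
        (fun w : Eucl (2 * (n - 1)) ↦ (((0 : ℝ), w) : ℝ × Eucl (2 * (n - 1)))) u₂
        (ContinuousLinearMap.inr ℝ ℝ (Eucl (2 * (n - 1)))) :=
      (hasFDerivAt_prodMk_right (0 : ℝ) u₂).hasMFDerivAt
    have h2 := HasMFDerivAt.comp (g := F) u₂ hF.hasMFDerivAt h1
    have h3 : F ∘ (fun w : Eucl (2 * (n - 1)) ↦ (((0 : ℝ), w) : ℝ × Eucl (2 * (n - 1))))
        =ᶠ[𝓝 u₂] σ₂.map := by
      filter_upwards [hσd₂.continuousAt.eventually (hV.mem_nhds hpV)] with w hw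
      exact hΘ0 _ hw
    have h4 := h2.mfderiv.symm.trans h3.mfderiv_eq
    exact DFunLike.congr_fun h4 a
  have hfF : f =ᶠ[𝓝 u₁] F ∘ fun u ↦ (s u, g u) := by
    have c1 : ∀ᶠ u in 𝓝 u₁, s u ∈ Ioo (-ε) ε :=
      hsd.continuousAt.eventually (isOpen_Ioo.mem_nhds (by rw [hs1]; exact h0ε))
    have c2 : ∀ᶠ u in 𝓝 u₁, σ₂.map (g u) ∈ V := by
      have : ContinuousAt (σ₂.map ∘ g) u₁ :=
        ContinuousAt.comp (by rw [hg1]; exact hσd₂.continuousAt) hgd.continuousAt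
      exact this.eventually (hV.mem_nhds (by simpa only [Function.comp, hg1] using hpV))
    filter_upwards [hloc, c1, c2] with u hu hs hv
    exact (hu.2.symm.trans (hΘf _ hv (hmem₂ _ hu.1) _ hs).symm)
  -- Chain rule for f = F ∘ (s, g) at u₁, where (s, g) takes the value (0, u₂): there F has time
  -- derivative X and parameter derivative D₂.
  have hkey : ∀ v, DΨ (D₁ v) = fderiv ℝ s u₁ v • X + D₂ (fderiv ℝ g u₁ v) := by
    intro v
    have h1 : HasMFDerivAt 𝓘(ℝ, Eucl (2 * (n - 1))) (𝓡 (2 * n)) f u₁ (DΨ.comp D₁) :=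
      HasMFDerivAt.comp u₁ hΨd.hasMFDerivAt hσd₁.hasMFDerivAt
    have h2 : HasMFDerivAt 𝓘(ℝ, Eucl (2 * (n - 1))) 𝓘(ℝ, ℝ × Eucl (2 * (n - 1)))
        (fun u ↦ (s u, g u)) u₁ ((fderiv ℝ s u₁).prod (fderiv ℝ g u₁)) :=
      (hsd.hasFDerivAt.prodMk hgd.hasFDerivAt).hasMFDerivAt
    have hsg : (s u₁, g u₁) = (0, u₂) := by rw [hs1, hg1]
    have h3 : HasMFDerivAt 𝓘(ℝ, ℝ × Eucl (2 * (n - 1))) (𝓡 (2 * n)) F (s u₁, g u₁)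
        (mfderiv 𝓘(ℝ, ℝ × Eucl (2 * (n - 1))) (𝓡 (2 * n)) F (s u₁, g u₁)) := by
      refine MDifferentiableAt.hasMFDerivAt ?_
      rw [hsg]; exact hF
    have h4 := HasMFDerivAt.comp (g := F) (f := fun u ↦ (s u, g u)) u₁ h3 h2
    have h5 := h1.mfderiv.symm.trans (hfF.mfderiv_eq.trans h4.mfderiv)
    have h6 : DΨ (D₁ v) = (mfderiv 𝓘(ℝ, ℝ × Eucl (2 * (n - 1))) (𝓡 (2 * n)) F (s u₁, g u₁)
      (fderiv ℝ s u₁ v, fderiv ℝ g u₁ v) : Eucl (2 * n)) := DFunLike.congr_fun h5 v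
    have h7 : ∀ q, q = ((0 : ℝ), u₂) →
        (mfderiv 𝓘(ℝ, ℝ × Eucl (2 * (n - 1))) (𝓡 (2 * n)) F q
      (fderiv ℝ s u₁ v, fderiv ℝ g u₁ v) : Eucl (2 * n)) = DF (fderiv ℝ s u₁ v, fderiv ℝ g u₁ v) := by
      rintro q rfl; rfl
    rw [h6, h7 _ hsg, ← hDF1, ← hDF2, ← map_add]
    simp
  -- Ψ preserves the form and the terms containing X vanish by `ev_hamField`, so the pullback of ϖ
  -- by σ₁ is the pullback by g of its pullback by σ₂.
  have hform : ∀ v w, ϖ.ev (σ₁.map u₁) (D₁ v) (D₁ w) =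
      ϖ.ev (σ₂.map u₂) (D₂ (fderiv ℝ g u₁ v)) (D₂ (fderiv ℝ g u₁ w)) := by
    intro v w
    have h1 : ϖ.ev (σ₁.map u₁) (D₁ v) (D₁ w) =
        ϖ.ev (Ψ (σ₁.map u₁)) (DΨ (D₁ v)) (DΨ (D₁ w)) := (hΨs.self_of_nhds _ _).symm
    have hX : ∀ a, ϖ.ev (σ₂.map u₂) X (D₂ a) = 0 := fun a ↦
      ϖ.ev_hamField H _ _ (σ₂.mfderiv_energy h.smooth hmem₂ hu₂ a)
    have hX' : ∀ a, ϖ.ev (σ₂.map u₂) (D₂ a) X = 0 := fun a ↦ by rw [ϖ.ev_swap, hX, neg_zero]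
    rw [h1, hΨ1, hkey, hkey]
    simp only [ϖ.ev_add_left, ϖ.ev_add_right, ϖ.ev_smul_left, ϖ.ev_smul_right, hX, hX', ϖ.ev_self,
      mul_zero, zero_add, add_zero]
  rw [σ₁.coeff_eq ϖ u₁ D₁ rfl, σ₂.coeff_eq ϖ u₂ D₂ rfl]
  simp only [hform]
  let B : Eucl (2 * (n - 1)) →ₗ[ℝ] Eucl (2 * (n - 1)) →ₗ[ℝ] ℝ :=
    LinearMap.mk₂ ℝ (fun a b ↦ ϖ.ev (σ₂.map u₂) (D₂ a) (D₂ b))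
      (fun a b c ↦ by rw [map_add, ϖ.ev_add_left]) (fun r a c ↦ by rw [map_smul, ϖ.ev_smul_left]; rfl)
      (fun a b c ↦ by rw [map_add, ϖ.ev_add_right]) (fun r a c ↦ by rw [map_smul, ϖ.ev_smul_right]; rfl)
  exact extPow_comp B (fderiv ℝ g u₁).toLinearMap

end RegularLevel

/-! ### The reduced volume in the charts given by local sections. -/

/-- If a family of measures is compatible on overlaps, then its supremum restricts on each of the
sets to the measure given there. -/
theorem iSup_restrict_eq {ι Y : Type*} [MeasurableSpace Y] (μ : ι → Measure Y) (R : ι → Set Y)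
    (hR : ∀ i, MeasurableSet (R i)) (h0 : ∀ i, μ i (R i)ᶜ = 0)
    (hc : ∀ i j, ∀ B, MeasurableSet B → B ⊆ R i → B ⊆ R j → μ i B = μ j B) (i : ι) :
    (⨆ j, μ j).restrict (R i) = μ i := by
  have hi : ∀ j, (μ j).restrict (R j) = μ j := fun j ↦
    Measure.restrict_eq_self_of_ae_mem (mem_ae_iff.2 (h0 j))
  refine le_antisymm ?_ ?_
  · have h1 : (⨆ j, μ j) ≤ μ i + (⨆ j, μ j).restrict (R i)ᶜ := by
      refine iSup_le fun j ↦ ?_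
      rw [← Measure.restrict_add_restrict_compl (μ := μ j) (hR i)]
      refine add_le_add ?_ (Measure.restrict_mono le_rfl (le_iSup μ j))
      refine Measure.le_iff.2 fun B hB ↦ ?_
      rw [Measure.restrict_apply hB]
      have h2 : μ j (B ∩ R i) = μ j (B ∩ R i ∩ R j) := by
        conv_lhs => rw [← hi j]
        rw [Measure.restrict_apply (hB.inter (hR i))]
      rw [h2, hc j i _ ((hB.inter (hR i)).inter (hR j)) inter_subset_right
        (inter_subset_left.trans inter_subset_right)]
      exact measure_mono (inter_subset_left.trans inter_subset_left)
    calc (⨆ j, μ j).restrict (R i) ≤ (μ i + (⨆ j, μ j).restrict (R i)ᶜ).restrict (R i) :=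
          Measure.restrict_mono le_rfl h1
      _ = μ i := by
          rw [Measure.restrict_add, hi, Measure.restrict_restrict (hR i), inter_compl_self,
            Measure.restrict_empty, add_zero]
  · conv_lhs => rw [← hi i]
    exact Measure.restrict_mono le_rfl (le_iSup μ i)

namespace Piece

variable (ϖ : SymplecticForm n M) (σ : Piece n M)

theorem continuousOn_coeff : ContinuousOn (σ.coeff ϖ) σ.dom := by
  unfold Piece.coeff extPow
  refine continuousOn_const.mul (continuousOn_finsetSum _ fun p _ ↦ continuousOn_const.mul
    (continuousOn_finsetProd _ fun i _ ↦ ?_))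
  exact (contDiffOn_pullback ϖ σ.isOpen_dom σ.smoothOn _ _).continuousOn

theorem measure_apply {Y : Type*} [MeasurableSpace Y] {f : σ.dom → Y} (hf : Measurable f)
    {B : Set Y} (hB : MeasurableSet B) : σ.measure ϖ f B =
      ∫⁻ u in Subtype.val '' (f ⁻¹' B), ENNReal.ofReal |σ.coeff ϖ u| := by
  have h1 : MeasurableSet (Subtype.val '' (f ⁻¹' B)) :=
    σ.isOpen_dom.measurableSet.subtype_image (hf hB)
  rw [Piece.measure, Measure.map_apply hf hB, comap_subtype_coe_apply σ.isOpen_dom.measurableSet,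
    withDensity_apply _ h1, Measure.restrict_restrict h1,
    inter_eq_self_of_subset_left (Subtype.coe_image_subset _ _)]

end Piece

namespace LocalSection

variable {ϖ : SymplecticForm n M} {H : M → ℝ} {E : ℝ}

/-- The local section as a map to the energy surface. -/
def toSurface (σ : LocalSection ϖ H E) (u : σ.dom) : energySurface H E :=
  ⟨σ.map u.1, σ.mem u.1 u.2⟩

/-- The local section as a map to the orbit space. -/
def proj (σ : LocalSection ϖ H E) (u : σ.dom) : OrbitSpace ϖ H E :=
  orbitProj ϖ H E (σ.toSurface u)

theorem continuous_toSurface (σ : LocalSection ϖ H E) : Continuous σ.toSurface :=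
  (continuousOn_iff_continuous_domRestrict.1 σ.smoothOn.continuousOn).subtype_mk _

theorem proj_injective (σ : LocalSection ϖ H E) : Function.Injective σ.proj := σ.injective

end LocalSection

namespace RegularLevel

variable {ϖ : SymplecticForm n M} {H : M → ℝ} {E : ℝ} (h : RegularLevel ϖ H E) [T2Space M]

include h

/-- Openness: if x lies on the orbit of σ(u₀), one fixed Φ_t carries a neighbourhood of x into the
flow box at σ(u₀), where ψ continuously reads off the parameter of the orbit. -/
theorem isOpenEmbedding_proj (hn : 1 ≤ n) (σ : LocalSection ϖ H E) : IsOpenEmbedding σ.proj := by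
  refine IsOpenEmbedding.of_continuous_injective_isOpenMap
    (continuous_orbitProj.comp σ.continuous_toSurface) σ.proj_injective ?_
  intro U hU
  have hq : IsQuotientMap (orbitProj ϖ H E) := isQuotientMap_quot_mk
  rw [← hq.isOpen_preimage, isOpen_iff_mem_nhds]
  rintro x ⟨u₀, hu₀, hx⟩
  obtain ⟨t, ht⟩ := (h.orbitProj_eq_iff).1 hx.symm
  obtain ⟨τ, ψ, hτ, hψ, hinv, hbox⟩ := h.exists_flowBox hn σ.toPiece σ.mem u₀.2
    (σ.transversal u₀ u₀.2)
  have h1 := hinv.self_of_nhds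
  simp only [h.flow_zero (σ.mem u₀ u₀.2)] at h1
  obtain ⟨O, hO, hOU⟩ := isOpen_induced_iff.1 hU
  have hψO : ∀ᶠ y in 𝓝[energySurface H E] (σ.map u₀), ψ y ∈ O := by
    refine (hψ.self_of_nhds.continuousAt.eventually (hO.mem_nhds ?_)).filter_mono
      nhdsWithin_le_nhds
    rw [h1.2]
    exact (hOU ▸ hu₀ : u₀ ∈ Subtype.val ⁻¹' O)
  have h2 : ∀ᶠ y in 𝓝 (σ.toSurface u₀), ψ y.1 ∈ O ∧ ψ y.1 ∈ σ.dom ∧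
      flow ϖ H (τ y.1) (σ.map (ψ y.1)) = y.1 := by
    have h3 := hψO.and hbox
    rw [nhdsWithin_eq_map_subtype_coe (σ.mem u₀ u₀.2)] at h3
    exact h3
  have h4 := (h.continuous_flowS_apply t).continuousAt (x := x)
  rw [ContinuousAt, ht] at h4
  filter_upwards [h4.eventually h2] with y hy
  refine ⟨⟨ψ (h.flowS t y).1, hy.2.1⟩, ?_, ?_⟩
  · rw [← hOU]; exact hy.1
  · rw [← h.orbitProj_flowS t y]
    refine (h.orbitProj_eq_iff).2 ⟨τ (h.flowS t y).1, Subtype.ext ?_⟩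
    exact hy.2.2

/-- The change of parameters between the two sections coincides locally with the map of
`exists_transition`. Its Jacobian relates the two densities, so the change of variables formula
equates the integrals. -/
theorem measure_eq_of_subset_range (hn : 1 ≤ n) (σ₁ σ₂ : LocalSection ϖ H E)
    {B : Set (OrbitSpace ϖ H E)} (hB : MeasurableSet B) (h₁ : B ⊆ range σ₁.proj)
    (h₂ : B ⊆ range σ₂.proj) :
    σ₁.toPiece.measure ϖ σ₁.proj B = σ₂.toPiece.measure ϖ σ₂.proj B := by
  classical
  have e₁ := h.isOpenEmbedding_proj hn σ₁
  have e₂ := h.isOpenEmbedding_proj hn σ₂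
  rw [Piece.measure_apply ϖ _ e₁.continuous.measurable hB,
    Piece.measure_apply ϖ _ e₂.continuous.measurable hB]
  have m₁ : MeasurableSet (Subtype.val '' (σ₁.proj ⁻¹' B)) :=
    σ₁.isOpen_dom.measurableSet.subtype_image (e₁.continuous.measurable hB)
  -- The change of parameters; its value 0 off the overlap plays no role, because the integral runs
  -- over parameters of B only.
  let g : Eucl (2 * (n - 1)) → Eucl (2 * (n - 1)) := fun u ↦
    if hu : ∃ (hu : u ∈ σ₁.dom) (v : σ₂.dom), σ₂.proj v = σ₁.proj ⟨u, hu⟩ then hu.choose_spec.choose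
    else 0
  have hg : ∀ (u : σ₁.dom) (v : σ₂.dom), σ₂.proj v = σ₁.proj u → g u = v := by
    intro u v huv
    have hu : ∃ (hu : u.1 ∈ σ₁.dom) (v : σ₂.dom), σ₂.proj v = σ₁.proj ⟨u.1, hu⟩ := ⟨u.2, v, huv⟩
    simp only [g, dif_pos hu]
    exact congrArg Subtype.val (σ₂.proj_injective (hu.choose_spec.choose_spec.trans huv.symm))
  have himg : Subtype.val '' (σ₂.proj ⁻¹' B) = g '' (Subtype.val '' (σ₁.proj ⁻¹' B)) := by
    ext v
    constructor
    · rintro ⟨v, hv, rfl⟩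
      obtain ⟨u, hu⟩ := h₁ hv
      exact ⟨u, ⟨u, by rw [mem_preimage, hu]; exact hv, rfl⟩, hg u v hu.symm⟩
    · rintro ⟨_, ⟨u, hu, rfl⟩, rfl⟩
      obtain ⟨v, hv⟩ := h₂ hu
      exact ⟨v, by rw [mem_preimage, hv]; exact hu, (hg u v hv).symm⟩
  have hex : ∀ u ∈ Subtype.val '' (σ₁.proj ⁻¹' B), ∃ G : Eucl (2 * (n - 1)) →L[ℝ] Eucl (2 * (n - 1)),
      HasFDerivAt g G u ∧ σ₁.coeff ϖ u = G.det * σ₂.coeff ϖ (g u) := by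
    rintro _ ⟨u, hu, rfl⟩
    obtain ⟨v, hv⟩ := h₂ hu
    obtain ⟨T, hT⟩ := (h.orbitProj_eq_iff).1 hv.symm
    obtain ⟨g', s, G, hG, hg', hloc, hco⟩ := h.exists_transition hn σ₁.toPiece σ₂.toPiece σ₁.mem
      σ₂.mem u.2 v.2 (σ₂.transversal v v.2) (congrArg Subtype.val hT)
    refine ⟨G, hG.congr_of_eventuallyEq ?_, ?_⟩
    · filter_upwards [hloc, σ₁.isOpen_dom.mem_nhds u.2] with w hw hw'
      refine hg ⟨w, hw'⟩ ⟨g' w, hw.1⟩ ?_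
      refine (h.orbitProj_flowS (s w) _).symm.trans (Eq.trans ?_ (h.orbitProj_flowS T _))
      exact congrArg _ (Subtype.ext hw.2)
    · rw [hg u v hv]; exact hco
  choose! G hG hco using hex
  have hinj : InjOn g (Subtype.val '' (σ₁.proj ⁻¹' B)) := by
    rintro _ ⟨u, hu, rfl⟩ _ ⟨u', hu', rfl⟩ huu
    obtain ⟨v, hv⟩ := h₂ hu
    obtain ⟨v', hv'⟩ := h₂ hu'
    rw [hg u v hv, hg u' v' hv'] at huu
    have := Subtype.ext huu
    subst this
    rw [σ₁.proj_injective (hv.symm.trans hv')]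
  rw [himg, lintegral_image_eq_lintegral_abs_det_fderiv_mul volume m₁
    (fun u hu ↦ (hG u hu).hasFDerivWithinAt) hinj]
  refine setLIntegral_congr_fun m₁ fun u hu ↦ ?_
  rw [hco u hu, abs_mul, ENNReal.ofReal_mul (abs_nonneg _)]

theorem reducedVolume_restrict_range (hn : 1 ≤ n) (σ : LocalSection ϖ H E) :
    (reducedVolume ϖ H E).restrict (range σ.proj) = σ.toPiece.measure ϖ σ.proj := by
  refine iSup_restrict_eq (fun σ : LocalSection ϖ H E ↦ σ.toPiece.measure ϖ σ.proj)
    (fun σ ↦ range σ.proj) (fun σ ↦ (h.isOpenEmbedding_proj hn σ).isOpen_range.measurableSet)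
    (fun σ ↦ ?_) (fun σ₁ σ₂ B hB h₁ h₂ ↦ h.measure_eq_of_subset_range hn σ₁ σ₂ hB h₁ h₂) σ
  have e := h.isOpenEmbedding_proj hn σ
  rw [Piece.measure_apply ϖ _ e.continuous.measurable e.isOpen_range.measurableSet.compl,
    preimage_compl, preimage_range, compl_univ, image_empty, Measure.restrict_empty,
    lintegral_zero_measure]

end RegularLevel

/-! ### Existence of transversal pieces. -/

/-- Two independent linear forms on `ℝ^{2n}` can be completed to an injective linear map. -/
theorem exists_injective_prod (hn : 1 ≤ n) (a b : Eucl (2 * n) →L[ℝ] ℝ) (X : Eucl (2 * n))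
    (ha : a ≠ 0) (haX : a X = 0) (hbX : b X ≠ 0) :
    ∃ R : Eucl (2 * n) →L[ℝ] Eucl (2 * (n - 1)), Function.Injective (a.prod (b.prod R)) := by
  obtain ⟨w, hw⟩ : ∃ w, a w ≠ 0 := by
    by_contra! hcon
    exact ha (ContinuousLinearMap.ext hcon)
  let f : Eucl (2 * n) →ₗ[ℝ] ℝ × ℝ := (a.prod b).toLinearMap
  have hf : Function.Surjective f := by
    rintro ⟨r, s⟩
    refine ⟨(r / a w) • w + ((s - r / a w * b w) / b X) • X, ?_⟩
    have : f ((r / a w) • w + ((s - r / a w * b w) / b X) • X) =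
      (a ((r / a w) • w + ((s - r / a w * b w) / b X) • X),
        b ((r / a w) • w + ((s - r / a w * b w) / b X) • X)) := rfl
    rw [this]
    simp only [map_add, map_smul, smul_eq_mul, haX, mul_zero, add_zero]
    rw [div_mul_cancel₀ _ hw, div_mul_cancel₀ _ hbX]
    simp
  have hK : Module.finrank ℝ (LinearMap.ker f) = Module.finrank ℝ (Eucl (2 * (n - 1))) := by
    have h1 := LinearMap.finrank_range_add_finrank_ker f
    rw [LinearMap.range_eq_top.2 hf, finrank_top] at h1
    simp only [Module.finrank_prod, Module.finrank_self, finrank_euclideanSpace,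
      Fintype.card_fin] at h1 ⊢
    omega
  -- R is a linear retraction onto the common kernel of a and b, followed by an identification of
  -- this kernel with the parameter space.
  let i := LinearEquiv.ofFinrankEq _ _ hK
  obtain ⟨g, hg⟩ := (LinearMap.ker f).subtype.exists_leftInverse_of_injective
    (Submodule.ker_subtype _)
  refine ⟨LinearMap.toContinuousLinearMap (i.toLinearMap ∘ₗ g), ?_⟩
  rw [injective_iff_map_eq_zero]
  intro v hv
  have hv1 : a v = 0 := congrArg Prod.fst hv
  have hv2 : b v = 0 := congrArg (fun q ↦ q.2.1) hv
  have hv3 : i (g v) = 0 := congrArg (fun q ↦ q.2.2) hv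
  have hvK : v ∈ LinearMap.ker f := LinearMap.mem_ker.2 (Prod.ext hv1 hv2)
  have h1 : g v = ⟨v, hvK⟩ := DFunLike.congr_fun hg ⟨v, hvK⟩
  rw [h1, map_eq_zero_iff i i.injective] at hv3
  exact congrArg Subtype.val hv3

namespace RegularLevel

variable {ϖ : SymplecticForm n M} {H : M → ℝ} {E : ℝ} (h : RegularLevel ϖ H E)

include h

/-- Through every point of a regular energy surface there is a transversal piece. -/
theorem exists_piece (hn : 1 ≤ n) {x : M} (hx : x ∈ energySurface H E) {O : Set M}
    (hO : IsOpen O) (hxO : x ∈ O) :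
    ∃ σ : Piece n M, (∃ u ∈ σ.dom, σ.map u = x) ∧ (∀ u ∈ σ.dom, σ.map u ∈ energySurface H E) ∧
      (∀ u ∈ σ.dom, σ.map u ∈ O) ∧ ∀ u ∈ σ.dom, hamField ϖ H (σ.map u) ∉
        Set.range (mfderiv 𝓘(ℝ, Eucl (2 * (n - 1))) (𝓡 (2 * n)) σ.map u) := by
  let e := chartAt (Eucl (2 * n)) x
  have he : e ∈ atlas (Eucl (2 * n)) M := chart_mem_atlas _ x
  have hp : x ∈ e.source := mem_chart_source (Eucl (2 * n)) x
  have hep := e.map_source hp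
  have hinv : e.symm (e x) = x := e.left_inv hp
  let Ĥ : Eucl (2 * n) → ℝ := H ∘ e.symm
  have hĤ : ContDiffOn ℝ ∞ Ĥ e.target := contDiffOn_chart_energy he h.smooth
  have hdH : fderiv ℝ Ĥ (e x) ≠ 0 := by
    intro hc
    refine h.regular (e.symm (e x)) (by rw [hinv]; exact hx) (ContinuousLinearMap.ext fun v ↦ ?_)
    have h1 := fderiv_chart_energy he hep h.smooth
      (mfderiv (𝓡 (2 * n)) 𝓘(ℝ, Eucl (2 * n)) e (e.symm (e x)) v)
    rw [chartInv_surjective he hep] at h1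
    refine h1.symm.trans ?_
    rw [hc]; rfl
  have hXH : fderiv ℝ Ĥ (e x) (chartField ϖ H e (e x)) = 0 := by
    have h1 := chartForm_chartField ϖ he hep h.smooth (chartField ϖ H e (e x))
    rw [chartForm_self] at h1
    exact neg_eq_zero.1 h1.symm
  have hX : chartField ϖ H e (e x) ≠ 0 := by
    intro hc
    refine hdH (ContinuousLinearMap.ext fun v ↦ ?_)
    have h1 := chartForm_chartField ϖ he hep h.smooth v
    rw [hc, map_zero] at h1
    exact neg_eq_zero.1 h1.symm
  -- The piece is the slice where H equals E and ℓ is constant. Since ℓ is nonzero on X near the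
  -- point, X cannot be tangent to the slice.
  let ℓ : Eucl (2 * n) →L[ℝ] ℝ := innerSL ℝ (chartField ϖ H e (e x))
  have hℓ : ℓ (chartField ϖ H e (e x)) ≠ 0 := by
    simp only [ℓ, innerSL_apply_apply]
    exact inner_self_ne_zero.2 hX
  obtain ⟨R, hR⟩ := exists_injective_prod hn (fderiv ℝ Ĥ (e x)) ℓ _ hdH hXH hℓ
  let G : Eucl (2 * n) → ℝ × ℝ × Eucl (2 * (n - 1)) := fun y ↦ (Ĥ y, ℓ y, R y)
  have hG : ContDiffOn ℝ ∞ G e.target :=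
    hĤ.prodMk (ℓ.contDiff.contDiffOn.prodMk R.contDiff.contDiffOn)
  have hGa : ContDiffAt ℝ ∞ G (e x) := hG.contDiffAt (e.open_target.mem_nhds hep)
  have hGd : ∀ y ∈ e.target, HasFDerivAt G ((fderiv ℝ Ĥ y).prod (ℓ.prod R)) y := fun y hy ↦
    (((hĤ.contDiffAt (e.open_target.mem_nhds hy)).differentiableAt (by simp)).hasFDerivAt).prodMk
      (ℓ.hasFDerivAt.prodMk R.hasFDerivAt)
  have hfr : Module.finrank ℝ (Eucl (2 * n)) =
      Module.finrank ℝ (ℝ × ℝ × Eucl (2 * (n - 1))) := by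
    simp only [Module.finrank_prod, Module.finrank_self, finrank_euclideanSpace, Fintype.card_fin]
    omega
  let L : Eucl (2 * n) ≃L[ℝ] ℝ × ℝ × Eucl (2 * (n - 1)) :=
    (LinearEquiv.ofInjectiveOfFinrankEq ((fderiv ℝ Ĥ (e x)).prod (ℓ.prod R)).toLinearMap hR
      hfr).toContinuousLinearEquiv
  have hL : HasFDerivAt G (L : Eucl (2 * n) →L[ℝ] _) (e x) := hGd _ hep
  let N := hGa.toOpenPartialHomeomorph G hL (by simp)
  have hNs : e x ∈ N.source := hGa.mem_toOpenPartialHomeomorph_source hL (by simp)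
  have hNcoe : ∀ q, N q = G q := fun q ↦ by
    rw [show (N : _ → _) = G from hGa.toOpenPartialHomeomorph_coe hL (by simp)]
  -- the set of good points
  have hgood : ∀ᶠ y in 𝓝 (e x), y ∈ e.target ∧ e.symm y ∈ O ∧
      (fderiv ℝ G y ∈ range ((↑) : (Eucl (2 * n) ≃L[ℝ] ℝ × ℝ × Eucl (2 * (n - 1))) → _)) ∧
      ℓ (chartField ϖ H e y) ≠ 0 := by
    have h1 : ContinuousAt (fderiv ℝ G) (e x) :=
      (hG.continuousOn_fderiv_of_isOpen e.open_target (by simp)).continuousAt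
        (e.open_target.mem_nhds hep)
    have h2 : ContinuousAt (fun y ↦ ℓ (chartField ϖ H e y)) (e x) :=
      ℓ.continuous.continuousAt.comp ((contDiffOn_chartField ϖ he h.smooth).continuousOn.continuousAt
        (e.open_target.mem_nhds hep))
    have h3 : ContinuousAt e.symm (e x) := e.continuousAt_symm hep
    filter_upwards [e.open_target.mem_nhds hep, h3.eventually (hO.mem_nhds (by rw [hinv]; exact hxO)),
      h1.eventually (by rw [hL.fderiv]; exact L.nhds), h2.eventually_ne hℓ] with y a b c d
    exact ⟨a, b, c, d⟩
  obtain ⟨S, hSg, hS, hxS⟩ := eventually_nhds_iff.1 hgood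
  let ι : Eucl (2 * (n - 1)) → ℝ × ℝ × Eucl (2 * (n - 1)) := fun a ↦ (E, ℓ (e x), a)
  have hι : ContDiff ℝ ∞ ι := by fun_prop
  let dom : Set (Eucl (2 * (n - 1))) := ι ⁻¹' (N.target ∩ N.symm ⁻¹' S)
  have hdom : IsOpen dom := (N.symm.isOpen_inter_preimage hS).preimage hι.continuous
  let σ' : Eucl (2 * (n - 1)) → Eucl (2 * n) := fun a ↦ N.symm (ι a)
  have hσN : ∀ a ∈ dom, G (σ' a) = ι a := fun a ha ↦ by
    rw [← hNcoe]; exact N.right_inv ha.1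
  have hσ' : ∀ a ∈ dom, ContDiffAt ℝ ∞ σ' a := by
    intro a ha
    obtain ⟨h1, h2, ⟨L', hL'⟩, h4⟩ := hSg _ ha.2
    have h5 : HasFDerivAt N (L' : Eucl (2 * n) →L[ℝ] _) (N.symm (ι a)) := by
      rw [hL', show (N : _ → _) = G from funext hNcoe]
      exact (hGd _ h1).differentiableAt.hasFDerivAt
    have h6 : ContDiffAt ℝ ∞ N (N.symm (ι a)) := by
      rw [show (N : _ → _) = G from funext hNcoe]
      exact hG.contDiffAt (e.open_target.mem_nhds h1)
    exact ContDiffAt.comp a (N.contDiffAt_symm ha.1 h5 h6) hι.contDiffAt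
  -- Tangent vectors of the slice lie in the kernel of ℓ, which gives transversality; R inverts the
  -- derivative, which gives the immersion property.
  have hσd : ∀ a ∈ dom, ∀ v, ℓ (fderiv ℝ σ' a v) = 0 ∧ R (fderiv ℝ σ' a v) = v := by
    intro a ha v
    have h1 := ((hσ' a ha).differentiableAt (by simp)).hasFDerivAt
    have h2 : ∀ᶠ b in 𝓝 a, G (σ' b) = ι b := by
      filter_upwards [hdom.mem_nhds ha] with b hb using hσN b hb
    constructor
    · have h3 := ℓ.hasFDerivAt.comp a h1
      have h4 : ℓ ∘ σ' =ᶠ[𝓝 a] fun _ ↦ ℓ (e x) := by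
        filter_upwards [h2] with b hb using congrArg (fun q ↦ q.2.1) hb
      exact DFunLike.congr_fun (h3.unique ((hasFDerivAt_const _ _).congr_of_eventuallyEq h4)) v
    · have h3 := R.hasFDerivAt.comp a h1
      have h4 : R ∘ σ' =ᶠ[𝓝 a] fun b ↦ b := by
        filter_upwards [h2] with b hb using congrArg (fun q ↦ q.2.2) hb
      exact DFunLike.congr_fun (h3.unique ((hasFDerivAt_id _).congr_of_eventuallyEq h4)) v
  have hmf : ∀ a ∈ dom, ∀ v, mfderiv 𝓘(ℝ, Eucl (2 * (n - 1))) (𝓡 (2 * n)) (fun a ↦ e.symm (σ' a)) a v =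
      chartInv e (σ' a) (fderiv ℝ σ' a v) := by
    intro a ha v
    have h1 : HasMFDerivAt 𝓘(ℝ, Eucl (2 * (n - 1))) 𝓘(ℝ, Eucl (2 * n)) σ' a (fderiv ℝ σ' a) :=
      ((hσ' a ha).differentiableAt (by simp)).hasFDerivAt.hasMFDerivAt
    have h2 := HasMFDerivAt.comp (g := e.symm) a
      ((chart_mdifferentiable he).mdifferentiableAt_symm (hSg _ ha.2).1).hasMFDerivAt h1
    exact DFunLike.congr_fun h2.mfderiv v
  refine ⟨⟨dom, hdom, fun a ↦ e.symm (σ' a), ?_, ?_⟩, ⟨R (e x), ?_, ?_⟩, ?_, ?_, ?_⟩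
  · intro a ha
    refine ContMDiffAt.contMDiffWithinAt ?_
    exact ContMDiffAt.comp (g := e.symm) (f := σ') a ((chart_contMDiffOn_symm he).contMDiffAt
      (e.open_target.mem_nhds (hSg _ ha.2).1)) (hσ' a ha).contMDiffAt
  · intro a ha v w hvw
    rw [hmf a ha, hmf a ha] at hvw
    have := chartInv_injective he (hSg _ ha.2).1 hvw
    rw [← (hσd a ha v).2, this, (hσd a ha w).2]
  · have h1 : ι (R (e x)) = N (e x) := by
      rw [hNcoe]
      simp only [ι, G, Ĥ, Function.comp, hinv]
      rw [show H x = E from hx]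
    refine ⟨?_, ?_⟩
    · rw [h1]; exact N.map_source hNs
    · rw [mem_preimage, h1, N.left_inv hNs]; exact hxS
  · have h1 : ι (R (e x)) = N (e x) := by
      rw [hNcoe]
      simp only [ι, G, Ĥ, Function.comp, hinv]
      rw [show H x = E from hx]
    simp only [σ']
    rw [h1, N.left_inv hNs, hinv]
  · intro a ha
    exact congrArg Prod.fst (hσN a ha)
  · intro a ha
    exact (hSg _ ha.2).2.1
  · rintro a ha ⟨v, hv⟩
    have h1 := hSg _ ha.2
    rw [hmf a ha, ← chartInv_chartField ϖ H he h1.1] at hv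
    refine h1.2.2.2 ?_
    rw [← chartInv_injective he h1.1 hv]
    exact (hσd a ha v).1

end RegularLevel

/-! ### Non-trapping and local sections of the orbit space. -/

/-- No orbit on the energy surface is trapped, uniformly on compact sets. -/
def NonTrapping (ϖ : SymplecticForm n M) (H : M → ℝ) (E : ℝ) : Prop :=
  ∀ K ⊆ energySurface H E, IsCompact K → ∃ T > 0, ∀ x ∈ K, ∀ t : ℝ, T ≤ |t| → flow ϖ H t x ∉ K

/-- The restriction of a piece to an open subset of its domain. -/
def Piece.restrict (σ : Piece n M) (V : Set (Eucl (2 * (n - 1)))) (hV : IsOpen V)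
    (hVσ : V ⊆ σ.dom) : Piece n M where
  dom := V
  isOpen_dom := hV
  map := σ.map
  smoothOn := σ.smoothOn.mono hVσ
  immersion u hu := σ.immersion u (hVσ hu)

theorem Piece.tendsto_map {H : M → ℝ} {E : ℝ} (σ : Piece n M)
    (hmem : ∀ u ∈ σ.dom, σ.map u ∈ energySurface H E)
    {u₀ : Eucl (2 * (n - 1))} (hu₀ : u₀ ∈ σ.dom) :
    Tendsto σ.map (𝓝 u₀) (𝓝[energySurface H E] (σ.map u₀)) := by
  refine tendsto_nhdsWithin_iff.2 ⟨(σ.mdifferentiableAt hu₀).continuousAt, ?_⟩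
  filter_upwards [σ.isOpen_dom.mem_nhds hu₀] with u hu using hmem u hu

namespace RegularLevel

variable {ϖ : SymplecticForm n M} {H : M → ℝ} {E : ℝ} (h : RegularLevel ϖ H E) [T2Space M]

include h

theorem tendsto_flow {x : M} (hx : x ∈ energySurface H E) (t : ℝ) :
    Tendsto (fun q : ℝ × M ↦ flow ϖ H q.1 q.2) (𝓝 t ×ˢ 𝓝[energySurface H E] x)
      (𝓝[energySurface H E] (flow ϖ H t x)) := by
  have h1 := (h.continuous_flowS).continuousAt (x := (t, ⟨x, hx⟩))
  rw [ContinuousAt, nhds_prod_eq] at h1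
  rw [nhdsWithin_eq_map_subtype_coe hx, nhdsWithin_eq_map_subtype_coe (h.flow_mem hx t),
    ← Filter.map_id (f := 𝓝 t), Filter.prod_map_map_eq, tendsto_map'_iff]
  exact tendsto_map.comp h1

/-- A periodic orbit would return to x at all multiples of its period, contrary to non-trapping for
the compact set {x}. -/
theorem flow_injective_time (hnt : NonTrapping ϖ H E) {x : M} (hx : x ∈ energySurface H E)
    {t : ℝ} (ht : flow ϖ H t x = x) : t = 0 := by
  by_contra h0
  obtain ⟨T, hT, hK⟩ := hnt {x} (singleton_subset_iff.2 hx) isCompact_singleton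
  have h1 : ∀ k : ℕ, flow ϖ H (k * t) x = x := by
    intro k
    induction k with
    | zero => simpa using h.flow_zero hx
    | succ k ih =>
      have : ((k + 1 : ℕ) : ℝ) * t = k * t + t := by push_cast; ring
      rw [this, h.flow_add hx, ht, ih]
  obtain ⟨k, hk⟩ := exists_nat_ge (T / |t|)
  refine hK x rfl (k * t) ?_ (h1 k)
  rw [abs_mul, Nat.abs_cast]
  exact (div_le_iff₀ (abs_pos.2 h0)).1 hk

/-- A small transversal piece meets every orbit at most once. -/
theorem exists_nhds_injective (hn : 1 ≤ n) (hnt : NonTrapping ϖ H E) (σ : Piece n M)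
    (hmem : ∀ u ∈ σ.dom, σ.map u ∈ energySurface H E) {u₀ : Eucl (2 * (n - 1))}
    (hu₀ : u₀ ∈ σ.dom) (htr : hamField ϖ H (σ.map u₀) ∉
      Set.range (mfderiv 𝓘(ℝ, Eucl (2 * (n - 1))) (𝓡 (2 * n)) σ.map u₀)) :
    ∀ᶠ V in (𝓝 u₀).smallSets, ∀ u ∈ V, ∀ v ∈ V, ∀ t, flow ϖ H t (σ.map u) = σ.map v → u = v := by
  obtain ⟨τ, ψ, -, -, hinv, -⟩ := h.exists_flowBox hn σ hmem hu₀ htr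
  obtain ⟨K, hK, hKσ, hKc⟩ := local_compact_nhds (σ.isOpen_dom.mem_nhds hu₀)
  obtain ⟨T, hT, hKT⟩ := hnt (σ.map '' K) (image_subset_iff.2 fun u hu ↦ hmem u (hKσ hu))
    (hKc.image_of_continuousOn (σ.smoothOn.continuousOn.mono hKσ))
  have hσ := σ.tendsto_map hmem hu₀
  -- Returns at times |t| ≥ T are excluded by non-trapping. On the compact interval of remaining
  -- times, the flow box treats t near 0, and the absence of periods together with continuity treats
  -- times near any t ≠ 0.
  have key : ∀ᶠ q in 𝓝 (u₀, u₀), ∀ t ∈ Icc (-T) T,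
      flow ϖ H t (σ.map q.1) = σ.map q.2 → q.1 = q.2 := by
    refine isCompact_Icc.eventually_forall_of_forall_eventually fun t _ ↦ ?_
    have c1 : Tendsto (fun q : (Eucl (2 * (n - 1)) × Eucl (2 * (n - 1))) × ℝ ↦ q.1.1)
        (𝓝 ((u₀, u₀), t)) (𝓝 u₀) := Continuous.tendsto' (by fun_prop) _ _ rfl
    have c2 : Tendsto (fun q : (Eucl (2 * (n - 1)) × Eucl (2 * (n - 1))) × ℝ ↦ q.1.2)
        (𝓝 ((u₀, u₀), t)) (𝓝 u₀) := Continuous.tendsto' (by fun_prop) _ _ rfl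
    have c3 : Tendsto (fun q : (Eucl (2 * (n - 1)) × Eucl (2 * (n - 1))) × ℝ ↦ q.2)
        (𝓝 ((u₀, u₀), t)) (𝓝 t) := Continuous.tendsto' (by fun_prop) _ _ rfl
    by_cases ht : t = 0
    · subst ht
      have c4 := c3.prodMk_nhds c1
      have c5 : Tendsto (fun q : (Eucl (2 * (n - 1)) × Eucl (2 * (n - 1))) × ℝ ↦ ((0 : ℝ), q.1.2))
        (𝓝 ((u₀, u₀), 0)) (𝓝 (0, u₀)) := tendsto_const_nhds.prodMk_nhds c2
      filter_upwards [c4.eventually hinv, c5.eventually hinv,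
        c2.eventually (σ.isOpen_dom.mem_nhds hu₀)] with q h1 h2 h3 h4
      have h5 := h2.2
      simp only [h.flow_zero (hmem _ h3)] at h5
      exact h1.2.symm.trans ((congrArg ψ h4).trans h5)
    · have hne : flow ϖ H t (σ.map u₀) ≠ σ.map u₀ := fun hc ↦
        ht (h.flow_injective_time hnt (hmem _ hu₀) hc)
      have d1 := (h.tendsto_flow (hmem _ hu₀) t).comp (c3.prodMk (hσ.comp c1))
      have d2 := (hσ.comp c2)
      have d3 := ((d1.mono_right nhdsWithin_le_nhds).prodMk_nhds
        (d2.mono_right nhdsWithin_le_nhds)).eventually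
        (isClosed_diagonal.isOpen_compl.mem_nhds (x := (flow ϖ H t (σ.map u₀), σ.map u₀)) hne)
      filter_upwards [d3] with q hq hq'
      exact absurd hq' hq
  rw [nhds_prod_eq] at key
  obtain ⟨V, hV, hVK⟩ := Filter.mem_prod_same_iff.1 key
  filter_upwards [eventually_smallSets_subset.2 hV, eventually_smallSets_subset.2 hK]
    with W hWV hWK u hu v hv t ht
  refine hVK (show (u, v) ∈ V ×ˢ V from ⟨hWV hu, hWV hv⟩) t (abs_le.1 ?_) ht
  by_contra hcon
  refine hKT (σ.map u) ⟨u, hWK hu, rfl⟩ t (le_of_lt (not_le.1 hcon)) ?_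
  rw [ht]
  exact ⟨v, hWK hv, rfl⟩

/-- A transversal piece which meets every orbit at most once, as a local section. -/
def toLocalSection (σ : Piece n M)
    (hmem : ∀ u ∈ σ.dom, σ.map u ∈ energySurface H E)
    (htr : ∀ u ∈ σ.dom, hamField ϖ H (σ.map u) ∉
      Set.range (mfderiv 𝓘(ℝ, Eucl (2 * (n - 1))) (𝓡 (2 * n)) σ.map u))
    (hinj : ∀ u ∈ σ.dom, ∀ v ∈ σ.dom, ∀ t, flow ϖ H t (σ.map u) = σ.map v → u = v) :
    LocalSection ϖ H E where
  toPiece := σ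
  mem := hmem
  transversal := htr
  injective u v huv := by
    obtain ⟨t, ht⟩ := h.orbitProj_eq_iff.1 huv
    exact Subtype.ext (hinj u u.2 v v.2 t (congrArg Subtype.val ht))

/-- Through every point of the energy surface there is a local section. -/
theorem exists_localSection (hn : 1 ≤ n) (hnt : NonTrapping ϖ H E) (x : energySurface H E) :
    ∃ (σ : LocalSection ϖ H E) (u : σ.dom), σ.toSurface u = x := by
  obtain ⟨σ, ⟨u, hu, hux⟩, hmem, -, htr⟩ := h.exists_piece hn x.2 isOpen_univ (mem_univ _)
  obtain ⟨V, hV, hVi⟩ := eventually_smallSets.1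
    ((h.exists_nhds_injective hn hnt σ hmem hu (htr u hu)).and
      (eventually_smallSets_subset.2 (σ.isOpen_dom.mem_nhds hu)))
  obtain ⟨W, hWV, hW, huW⟩ := mem_nhds_iff.1 hV
  refine ⟨h.toLocalSection (σ.restrict W hW (hVi W hWV).2) (fun v hv ↦ hmem v ((hVi W hWV).2 hv))
    (fun v hv ↦ htr v ((hVi W hWV).2 hv)) (hVi W hWV).1, ⟨u, huW⟩, Subtype.ext hux⟩

/-- The flow of a local section, as a map from `dom × ℝ` to the energy surface. -/
def sweep (σ : LocalSection ϖ H E) (q : σ.dom × ℝ) : energySurface H E :=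
  h.flowS q.2 (σ.toSurface q.1)

theorem continuous_sweep (σ : LocalSection ϖ H E) : Continuous (h.sweep σ) :=
  h.continuous_flowS.comp (continuous_snd.prodMk (σ.continuous_toSurface.comp continuous_fst))

theorem sweep_injective (hnt : NonTrapping ϖ H E) (σ : LocalSection ϖ H E) :
    Function.Injective (h.sweep σ) := by
  rintro ⟨u, t⟩ ⟨v, s⟩ huv
  have h1 := congrArg (orbitProj ϖ H E) huv
  simp only [sweep, h.orbitProj_flowS] at h1
  obtain rfl : u = v := σ.proj_injective h1
  have h2 := congrArg (h.flowS (-s)) huv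
  simp only [sweep, h.flowS_neg_flowS, ← h.flowS_add] at h2
  have h3 := h.flow_injective_time hnt (σ.toSurface u).2 (congrArg Subtype.val h2)
  rw [Prod.mk.injEq]
  exact ⟨rfl, by linarith⟩

theorem isOpen_range_proj (hn : 1 ≤ n) (σ : LocalSection ϖ H E) : IsOpen (range σ.proj) :=
  (h.isOpenEmbedding_proj hn σ).isOpen_range

/-- The orbit space is covered by countably many local sections. -/
theorem exists_countable_cover [SecondCountableTopology M] (hn : 1 ≤ n)
    (hnt : NonTrapping ϖ H E) : ∃ S : Set (LocalSection ϖ H E), S.Countable ∧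
      ⋃ σ ∈ S, range σ.proj = univ := by
  obtain ⟨S, hS, hSu⟩ := TopologicalSpace.isOpen_iUnion_countable
    (fun σ : LocalSection ϖ H E ↦ orbitProj ϖ H E ⁻¹' range σ.proj)
    (fun σ ↦ (h.isOpen_range_proj hn σ).preimage continuous_orbitProj)
  refine ⟨S, hS, eq_univ_of_forall fun y ↦ ?_⟩
  obtain ⟨x, rfl⟩ := Quot.exists_rep y
  obtain ⟨σ, u, hu⟩ := h.exists_localSection hn hnt x
  have h1 : x ∈ ⋃ σ ∈ S, orbitProj ϖ H E ⁻¹' range σ.proj := by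
    rw [hSu]
    exact mem_iUnion.2 ⟨σ, u, by rw [← hu]; rfl⟩
  obtain ⟨σ', hσ', hx⟩ := mem_iUnion₂.1 h1
  exact mem_iUnion₂.2 ⟨σ', hσ', hx⟩

end RegularLevel

namespace LocalSection

variable {ϖ : SymplecticForm n M} {H : M → ℝ} {E : ℝ}

/-- The density of a local section on its parameter domain. -/
def paramMeasure (σ : LocalSection ϖ H E) : Measure σ.dom :=
  ((volume.restrict σ.dom).withDensity fun u ↦ ENNReal.ofReal |σ.coeff ϖ u|).comap
    (Subtype.val : σ.dom → Eucl (2 * (n - 1)))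

theorem map_paramMeasure (σ : LocalSection ϖ H E) :
    σ.paramMeasure.map σ.proj = σ.toPiece.measure ϖ σ.proj := rfl

end LocalSection

/-! ### The Liouville measure on the energy surface. -/

/-- A representative of an orbit. -/
def OrbitSpace.rep {ϖ : SymplecticForm n M} {H : M → ℝ} {E : ℝ} (y : OrbitSpace ϖ H E) :
    energySurface H E := Quot.out y

theorem OrbitSpace.orbitProj_rep {ϖ : SymplecticForm n M} {H : M → ℝ} {E : ℝ}
    (y : OrbitSpace ϖ H E) : orbitProj ϖ H E y.rep = y := Quot.out_eq y

namespace RegularLevel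

variable {ϖ : SymplecticForm n M} {H : M → ℝ} {E : ℝ} (h : RegularLevel ϖ H E) [T2Space M]

/-- The time which an orbit spends in `B`. -/
def orbitTime (B : Set (energySurface H E)) (y : OrbitSpace ϖ H E) : ENNReal :=
  volume {t : ℝ | h.flowS t y.rep ∈ B}

include h

/-- Another representative shifts the set of times, and Lebesgue measure is translation invariant.
-/
theorem orbitTime_orbitProj (B : Set (energySurface H E)) (x : energySurface H E) :
    h.orbitTime B (orbitProj ϖ H E x) = volume {t : ℝ | h.flowS t x ∈ B} := by
  obtain ⟨s, hs⟩ := h.orbitProj_eq_iff.1 (OrbitSpace.orbitProj_rep (orbitProj ϖ H E x)).symm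
  rw [orbitTime, ← hs, ← measure_preimage_add_right volume s {t : ℝ | h.flowS t x ∈ B}]
  simp only [← h.flowS_add]
  rfl

theorem orbitTime_proj (σ : LocalSection ϖ H E) (B : Set (energySurface H E)) (u : σ.dom) :
    h.orbitTime B (σ.proj u) = volume (Prod.mk u ⁻¹' (h.sweep σ ⁻¹' B)) :=
  h.orbitTime_orbitProj B (σ.toSurface u)

variable [SecondCountableTopology M] [MeasurableSpace M] [BorelSpace M]

/-- The representatives come from choice and need not depend measurably on the orbit. In the chart
of a local section, however, the function is the measure of the slices of a Borel set in dom × ℝ,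
and countably many charts cover the orbit space. -/
theorem measurable_orbitTime (hn : 1 ≤ n) (hnt : NonTrapping ϖ H E)
    {B : Set (energySurface H E)} (hB : MeasurableSet B) : Measurable (h.orbitTime B) := by
  obtain ⟨S, hS, hSu⟩ := h.exists_countable_cover hn hnt
  intro O hO
  have h1 : h.orbitTime B ⁻¹' O = ⋃ σ ∈ S, σ.proj '' ((fun u : σ.dom ↦
      volume (Prod.mk u ⁻¹' (h.sweep σ ⁻¹' B))) ⁻¹' O) := by
    ext y
    simp only [mem_iUnion]
    constructor
    · intro hy
      obtain ⟨σ, hσ, u, rfl⟩ := mem_iUnion₂.1 (hSu ▸ mem_univ y : y ∈ ⋃ σ ∈ S, range σ.proj)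
      refine ⟨σ, hσ, u, ?_, rfl⟩
      rw [mem_preimage, ← h.orbitTime_proj]
      exact hy
    · rintro ⟨σ, hσ, u, hu, rfl⟩
      rw [mem_preimage, h.orbitTime_proj]
      exact hu
  rw [h1]
  refine MeasurableSet.biUnion hS fun σ _ ↦ ?_
  refine (h.isOpenEmbedding_proj hn σ).measurableEmbedding.measurableSet_image.2 ?_
  exact measurable_measure_prodMk_left ((h.continuous_sweep σ).measurable hB) hO

/-- The Liouville measure on the energy surface: the reduced volume of the orbit times the time
along the orbit. -/
def liouville : Measure (energySurface H E) :=
  (reducedVolume ϖ H E).bind fun y ↦ volume.map fun t : ℝ ↦ h.flowS t y.rep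

omit [SecondCountableTopology M] in
theorem measurable_flowS_time (x : energySurface H E) : Measurable fun t : ℝ ↦ h.flowS t x :=
  (h.continuous_flowS.comp (by fun_prop : Continuous fun t : ℝ ↦ (t, x))).measurable

theorem liouville_apply (hn : 1 ≤ n) (hnt : NonTrapping ϖ H E) {B : Set (energySurface H E)}
    (hB : MeasurableSet B) : h.liouville B = ∫⁻ y, h.orbitTime B y ∂(reducedVolume ϖ H E) := by
  have h1 : ∀ C : Set (energySurface H E), MeasurableSet C → ∀ y : OrbitSpace ϖ H E,
      (volume.map fun t : ℝ ↦ h.flowS t y.rep) C = h.orbitTime C y := fun C hC y ↦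
    Measure.map_apply (h.measurable_flowS_time _) hC
  rw [liouville, Measure.bind_apply hB]
  · exact lintegral_congr (h1 B hB)
  · refine (Measure.measurable_of_measurable_coe _ fun C hC ↦ ?_).aemeasurable
    simp only [h1 C hC]
    exact h.measurable_orbitTime hn hnt hC

theorem map_flowS_liouville (hn : 1 ≤ n) (hnt : NonTrapping ϖ H E) (s : ℝ) :
    h.liouville.map (h.flowS s) = h.liouville := by
  ext B hB
  have hm := (h.continuous_flowS_apply s).measurable
  rw [Measure.map_apply hm hB, h.liouville_apply hn hnt hB, h.liouville_apply hn hnt (hm hB)]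
  refine lintegral_congr fun y ↦ ?_
  rw [orbitTime, orbitTime,
    ← measure_preimage_add volume s {t : ℝ | h.flowS t y.rep ∈ B}]
  simp only [preimage_ofPred_eq, h.flowS_add]
  rfl

/-- The Liouville measure in the coordinates given by a local section and the time. -/
theorem liouville_apply_of_subset (hn : 1 ≤ n) (hnt : NonTrapping ϖ H E) (σ : LocalSection ϖ H E)
    {B : Set (energySurface H E)} (hB : MeasurableSet B)
    (hBσ : B ⊆ orbitProj ϖ H E ⁻¹' range σ.proj) :
    h.liouville B = (σ.paramMeasure.prod volume) (h.sweep σ ⁻¹' B) := by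
  rw [h.liouville_apply hn hnt hB, Measure.prod_apply ((h.continuous_sweep σ).measurable hB)]
  have h0 : ∀ y ∉ range σ.proj, h.orbitTime B y = 0 := by
    intro y hy
    have : {t : ℝ | h.flowS t y.rep ∈ B} = ∅ := by
      refine eq_empty_of_forall_notMem fun t ht ↦ hy ?_
      have h1 := hBσ ht
      rwa [mem_preimage, h.orbitProj_flowS, OrbitSpace.orbitProj_rep] at h1
    rw [orbitTime, this, measure_empty]
  have hr := (h.isOpen_range_proj hn σ).measurableSet
  rw [← lintegral_add_compl _ hr, setLIntegral_congr_fun (g := 0) hr.compl h0,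
    h.reducedVolume_restrict_range hn, ← σ.map_paramMeasure,
    lintegral_map (h.measurable_orbitTime hn hnt hB)
      (h.isOpenEmbedding_proj hn σ).continuous.measurable]
  simp only [Pi.zero_apply, lintegral_zero, add_zero, h.orbitTime_proj]

/-- In section coordinates a small flow box lies in K × [-1, 1] with K compact, on which the
continuous density is bounded. Injectivity of the sweep excludes other preimages from later returns.
-/
theorem isLocallyFiniteMeasure_liouville (hn : 1 ≤ n) (hnt : NonTrapping ϖ H E) :
    IsLocallyFiniteMeasure h.liouville := by
  refine ⟨fun x ↦ ?_⟩
  obtain ⟨σ, u, rfl⟩ := h.exists_localSection hn hnt x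
  obtain ⟨τ, ψ, hτ, hψ, hinv, hbox⟩ := h.exists_flowBox hn σ.toPiece σ.mem u.2
    (σ.transversal u u.2)
  have h1 := hinv.self_of_nhds
  simp only [h.flow_zero (σ.mem u u.2)] at h1
  obtain ⟨K, hK, hKσ, hKc⟩ := local_compact_nhds (σ.isOpen_dom.mem_nhds u.2)
  have e1 : ∀ᶠ y in 𝓝[energySurface H E] (σ.map u), ψ y ∈ K := by
    refine (hψ.self_of_nhds.continuousAt.eventually ?_).filter_mono nhdsWithin_le_nhds
    rw [h1.2]; exact hK
  have e2 : ∀ᶠ y in 𝓝[energySurface H E] (σ.map u), τ y ∈ Icc (-1 : ℝ) 1 := by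
    refine (hτ.self_of_nhds.continuousAt.eventually ?_).filter_mono nhdsWithin_le_nhds
    rw [h1.1]; exact Icc_mem_nhds (by norm_num) (by norm_num)
  have e3 := (e1.and e2).and hbox
  rw [nhdsWithin_eq_map_subtype_coe (σ.mem u u.2), eventually_map] at e3
  obtain ⟨N, hN, hNo, hxN⟩ := eventually_nhds_iff.1 e3
  refine ⟨N, hNo.mem_nhds hxN, ?_⟩
  have hNeq : ∀ y ∈ N, ∃ q : σ.dom × ℝ, q.1.1 ∈ K ∧ q.2 ∈ Icc (-1 : ℝ) 1 ∧ h.sweep σ q = y :=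
    fun y hy ↦ ⟨(⟨ψ y.1, (hN y hy).2.1⟩, τ y.1), (hN y hy).1.1, (hN y hy).1.2,
      Subtype.ext (hN y hy).2.2⟩
  rw [h.liouville_apply_of_subset hn hnt σ hNo.measurableSet]
  · have hsub : h.sweep σ ⁻¹' N ⊆ (Subtype.val ⁻¹' K) ×ˢ Icc (-1 : ℝ) 1 := by
      intro q hq
      obtain ⟨q', h2, h3, h4⟩ := hNeq _ hq
      rw [← h.sweep_injective hnt σ h4]
      exact ⟨h2, h3⟩
    refine (measure_mono hsub).trans_lt ?_
    rw [Measure.prod_prod]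
    refine ENNReal.mul_lt_top ?_ (by simp)
    rw [LocalSection.paramMeasure, comap_subtype_coe_apply σ.isOpen_dom.measurableSet,
      Subtype.image_preimage_coe, inter_eq_self_of_subset_right hKσ,
      withDensity_apply _ hKc.measurableSet, Measure.restrict_restrict hKc.measurableSet,
      inter_eq_self_of_subset_left hKσ]
    have hc := ((σ.continuousOn_coeff ϖ).mono hKσ).abs
    obtain ⟨C, hC⟩ := hKc.bddAbove_image hc
    refine (setLIntegral_mono' (g := fun _ ↦ ENNReal.ofReal C) hKc.measurableSet fun v hv ↦
      ENNReal.ofReal_le_ofReal (hC ⟨v, hv, rfl⟩)).trans_lt ?_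
    rw [setLIntegral_const]
    exact ENNReal.mul_lt_top ENNReal.ofReal_lt_top hKc.measure_lt_top
  · intro y hy
    obtain ⟨q, -, -, rfl⟩ := hNeq y hy
    exact ⟨q.1, (h.orbitProj_flowS _ _).symm⟩

omit [SecondCountableTopology M] [MeasurableSpace M] [BorelSpace M] in
-- All visits to Ω happen within time T of any given one, with T taken from non-trapping for the
-- closure of Ω in the surface.
theorem orbitTime_lt_top (hnt : NonTrapping ϖ H E) {Ω : Set M} (hΩ : IsCompact (closure Ω))
    (y : OrbitSpace ϖ H E) : h.orbitTime (Subtype.val ⁻¹' Ω) y < ⊤ := by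
  obtain ⟨T, hT, hK⟩ := hnt (closure Ω ∩ energySurface H E) inter_subset_right
    (hΩ.inter_right h.isClosed)
  by_cases hne : ∃ t₀ : ℝ, h.flowS t₀ y.rep ∈ (Subtype.val ⁻¹' Ω : Set (energySurface H E))
  · obtain ⟨t₀, ht₀⟩ := hne
    have hsub : {t : ℝ | h.flowS t y.rep ∈ (Subtype.val ⁻¹' Ω : Set (energySurface H E))} ⊆
        Icc (t₀ - T) (t₀ + T) := by
      intro t ht
      by_contra hcon
      refine hK (h.flowS t₀ y.rep) ⟨subset_closure ht₀, Subtype.coe_prop _⟩ (t - t₀) ?_ ?_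
      · by_contra! hlt
        have := abs_lt.1 hlt
        exact hcon ⟨by linarith [this.1], by linarith [this.2]⟩
      · rw [← h.coe_flowS, ← h.flowS_add, sub_add_cancel]
        exact ⟨subset_closure ht, Subtype.coe_prop _⟩
    exact (measure_mono hsub).trans_lt (by simp)
  · push Not at hne
    rw [orbitTime, show {t : ℝ | h.flowS t y.rep ∈
      (Subtype.val ⁻¹' Ω : Set (energySurface H E))} = ∅ from
        eq_empty_of_forall_notMem hne, measure_empty]
    exact ENNReal.zero_lt_top

omit [SecondCountableTopology M] in
theorem integrable_indicator_flow (hnt : NonTrapping ϖ H E) {Ω : Set M} (hΩo : IsOpen Ω)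
    (hΩ : IsCompact (closure Ω)) {x : M} (hx : x ∈ energySurface H E) :
    Integrable fun t : ℝ ↦ Ω.indicator (fun _ ↦ (1 : ℝ)) (flow ϖ H t x) := by
  have hm : MeasurableSet {t : ℝ | flow ϖ H t x ∈ Ω} :=
    (continuous_subtype_val.measurable.comp (h.measurable_flowS_time ⟨x, hx⟩)) hΩo.measurableSet
  have h1 : (fun t : ℝ ↦ Ω.indicator (fun _ ↦ (1 : ℝ)) (flow ϖ H t x)) =
      {t : ℝ | flow ϖ H t x ∈ Ω}.indicator fun _ ↦ 1 := rfl
  rw [h1, integrable_indicator_iff hm, integrableOn_const_iff]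
  right
  have h2 := h.orbitTime_lt_top hnt hΩ (orbitProj ϖ H E ⟨x, hx⟩)
  rw [h.orbitTime_orbitProj] at h2
  exact h2

omit [SecondCountableTopology M] in
theorem reducedSojourn_eq {Ω : Set M} (hΩo : IsOpen Ω) (y : OrbitSpace ϖ H E) :
    reducedSojourn ϖ H E Ω y = (h.orbitTime (Subtype.val ⁻¹' Ω) y).toReal := by
  have hm : MeasurableSet {t : ℝ | flow ϖ H t y.rep.1 ∈ Ω} :=
    (continuous_subtype_val.measurable.comp (h.measurable_flowS_time y.rep))
      hΩo.measurableSet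
  have h1 : (fun t : ℝ ↦ Ω.indicator (fun _ ↦ (1 : ℝ)) (flow ϖ H t y.rep.1)) =
      {t : ℝ | flow ϖ H t y.rep.1 ∈ Ω}.indicator fun _ ↦ 1 := rfl
  have h0 : reducedSojourn ϖ H E Ω y =
      ∫ t : ℝ, Ω.indicator (fun _ ↦ (1 : ℝ)) (flow ϖ H t y.rep.1) := rfl
  rw [h0, h1, integral_indicator_const _ hm, smul_eq_mul, mul_one]
  rfl

theorem liouville_preimage_lt_top (hn : 1 ≤ n) (hnt : NonTrapping ϖ H E) {Ω : Set M}
    (hΩ : IsCompact (closure Ω)) : h.liouville (Subtype.val ⁻¹' Ω) < ⊤ := by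
  have := h.isLocallyFiniteMeasure_liouville hn hnt
  exact (measure_mono (preimage_mono subset_closure)).trans_lt
    (h.isClosed.isClosedEmbedding_subtypeVal.isCompact_preimage hΩ).measure_lt_top

/-- Fubini for the Liouville measure. It replaces the integrals over orbit spaces by volumes of
sets, which can be compared between H and H₀. -/
theorem integrable_reducedSojourn (hn : 1 ≤ n) (hnt : NonTrapping ϖ H E) {Ω : Set M}
    (hΩo : IsOpen Ω) (hΩ : IsCompact (closure Ω)) :
    Integrable (reducedSojourn ϖ H E Ω) (reducedVolume ϖ H E) ∧
      ∫ y, reducedSojourn ϖ H E Ω y ∂(reducedVolume ϖ H E) =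
        (h.liouville (Subtype.val ⁻¹' Ω)).toReal := by
  have hB : MeasurableSet (Subtype.val ⁻¹' Ω : Set (energySurface H E)) :=
    (hΩo.preimage continuous_subtype_val).measurableSet
  have h1 := h.liouville_preimage_lt_top hn hnt hΩ
  rw [h.liouville_apply hn hnt hB] at h1 ⊢
  have hm := h.measurable_orbitTime hn hnt hB
  rw [show reducedSojourn ϖ H E Ω = fun y ↦ (h.orbitTime (Subtype.val ⁻¹' Ω) y).toReal from
    funext (h.reducedSojourn_eq hΩo)]
  exact ⟨integrable_toReal_of_lintegral_ne_top hm.aemeasurable h1.ne,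
    integral_toReal hm.aemeasurable (Eventually.of_forall fun y ↦ h.orbitTime_lt_top hnt hΩ y)⟩

end RegularLevel

/-! ### Locality of the Liouville measure in the Hamiltonian. -/

/-- Two measures which agree near every point of `U` agree on the measurable subsets of `U`. -/
theorem measure_eq_of_locally_eq {X : Type*} [TopologicalSpace X] [SecondCountableTopology X]
    [MeasurableSpace X] {μ ν : Measure X} {U : Set X}
    (hloc : ∀ x ∈ U, ∃ N : Set X, IsOpen N ∧ x ∈ N ∧ μ.restrict N = ν.restrict N) {B : Set X}
    (hB : MeasurableSet B) (hBU : B ⊆ U) : μ B = ν B := by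
  choose! N hN hxN hNe using hloc
  obtain ⟨S, hS, hSu⟩ := TopologicalSpace.isOpen_iUnion_countable (fun x : U ↦ N x)
    (fun x ↦ hN x x.2)
  have := hS.to_subtype
  have h1 := (Measure.restrict_iUnion_congr (μ := μ) (ν := ν) (s := fun x : S ↦ N x)).2
    fun x ↦ hNe x.1 x.1.2
  have h2 : B ⊆ ⋃ x : S, N x := by
    intro x hx
    have h3 : x ∈ ⋃ i ∈ S, N i := by
      rw [hSu]
      exact mem_iUnion.2 ⟨⟨x, hBU hx⟩, hxN x (hBU hx)⟩
    obtain ⟨i, hi, hxi⟩ := mem_iUnion₂.1 h3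
    exact mem_iUnion.2 ⟨⟨i, hi⟩, hxi⟩
  have h3 := congrArg (fun μ ↦ μ B) h1
  simpa only [Measure.restrict_apply hB, inter_eq_self_of_subset_left h2] using h3

theorem hamField_congr (ϖ : SymplecticForm n M) {H H₀ : M → ℝ} {x : M} (hx : H =ᶠ[𝓝 x] H₀) :
    hamField ϖ H x = hamField ϖ H₀ x := by
  have h1 : ∀ φ ψ : TangentSpace (𝓡 (2 * n)) x →L[ℝ] ℝ, φ = ψ →
      (ϖ.exists_eq x φ).choose = (ϖ.exists_eq x ψ).choose := by rintro _ _ rfl; rfl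
  refine h1 _ _ ?_
  have h2 : (mfderiv (𝓡 (2 * n)) 𝓘(ℝ, ℝ) H x : Eucl (2 * n) →L[ℝ] ℝ) =
    mfderiv (𝓡 (2 * n)) 𝓘(ℝ, ℝ) H₀ x := hx.mfderiv_eq
  exact congrArg (fun f : Eucl (2 * n) →L[ℝ] ℝ ↦ -f) h2

namespace RegularLevel

variable {ϖ : SymplecticForm n M} {H H₀ : M → ℝ} {E : ℝ} (h : RegularLevel ϖ H E)
  (h₀ : RegularLevel ϖ H₀ E) [T2Space M]

include h h₀

/-- The flows of two Hamiltonians agree as long as they stay where the Hamiltonians agree. -/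
theorem flow_congr {U : Set M} (hU : IsOpen U) (hHU : EqOn H H₀ U) {x : M}
    (hx : x ∈ energySurface H E) {a b : ℝ} (h0 : (0 : ℝ) ∈ Ioo a b)
    (hflow : ∀ t ∈ Ioo a b, flow ϖ H t x ∈ U) :
    ∀ t ∈ Ioo a b, flow ϖ H t x = flow ϖ H₀ t x := by
  have hxU : x ∈ U := by simpa only [h.flow_zero hx] using hflow 0 h0
  have hx₀ : x ∈ energySurface H₀ E := (hHU hxU).symm.trans hx
  refine h₀.flow_eq hx₀ (γ := fun t ↦ flow ϖ H t x) h0 ?_ (h.flow_zero hx)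
  intro t ht
  have h1 := (h.isMIntegralCurve_flow hx t).hasMFDerivWithinAt (s := Ioo a b)
  have h2 : hamField ϖ H (flow ϖ H t x) = hamField ϖ H₀ (flow ϖ H t x) :=
    hamField_congr ϖ (hHU.eventuallyEq_of_mem (hU.mem_nhds (hflow t ht)))
  rw [h2] at h1
  exact h1

variable [SecondCountableTopology M] [MeasurableSpace M] [BorelSpace M]

/-- Where the Hamiltonians agree, one and the same small piece is a local section for both flows
with the same density, and its short-time sweeps coincide. -/
theorem eventually_liouville_eq (hn : 1 ≤ n) (hnt : NonTrapping ϖ H E)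
    (hnt₀ : NonTrapping ϖ H₀ E) {U : Set M} (hU : IsOpen U) (hHU : EqOn H H₀ U) {x : M}
    (hx : x ∈ energySurface H E) (hxU : x ∈ U) :
    ∀ᶠ B in (𝓝 x).smallSets, MeasurableSet B →
      h.liouville (Subtype.val ⁻¹' B) = h₀.liouville (Subtype.val ⁻¹' B) := by
  obtain ⟨σ, ⟨u, hu, rfl⟩, hmem, hσU, htr⟩ := h.exists_piece hn hx hU hxU
  have hmem₀ : ∀ u ∈ σ.dom, σ.map u ∈ energySurface H₀ E := fun v hv ↦
    (hHU (hσU v hv)).symm.trans (hmem v hv)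
  have htr₀ : ∀ u ∈ σ.dom, hamField ϖ H₀ (σ.map u) ∉
      Set.range (mfderiv 𝓘(ℝ, Eucl (2 * (n - 1))) (𝓡 (2 * n)) σ.map u) := by
    intro v hv
    rw [← hamField_congr ϖ (hHU.eventuallyEq_of_mem (hU.mem_nhds (hσU v hv)))]
    exact htr v hv
  obtain ⟨V, hV, hVi⟩ := eventually_smallSets.1
    (((h.exists_nhds_injective hn hnt σ hmem hu (htr u hu)).and
      (h₀.exists_nhds_injective hn hnt₀ σ hmem₀ hu (htr₀ u hu))).and
      (eventually_smallSets_subset.2 (σ.isOpen_dom.mem_nhds hu)))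
  obtain ⟨W, hWV, hW, huW⟩ := mem_nhds_iff.1 hV
  have hWσ := (hVi W hWV).2
  let s : Piece n M := σ.restrict W hW hWσ
  let σ₁ := h.toLocalSection s (fun v hv ↦ hmem v (hWσ hv)) (fun v hv ↦ htr v (hWσ hv))
    (hVi W hWV).1.1
  let σ₀ := h₀.toLocalSection s (fun v hv ↦ hmem₀ v (hWσ hv)) (fun v hv ↦ htr₀ v (hWσ hv))
    (hVi W hWV).1.2
  -- times and points for which the flow stays in `U`
  have hstay : ∀ᶠ q in 𝓝 ((0 : ℝ), u), flow ϖ H q.1 (σ.map q.2) ∈ U := by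
    have h1 := (h.tendsto_flow (hmem u hu) 0).comp
      (Tendsto.prodMap (tendsto_id (α := ℝ) (x := 𝓝 0)) (σ.tendsto_map hmem hu))
    rw [h.flow_zero (hmem u hu), ← nhds_prod_eq] at h1
    exact (h1.mono_right nhdsWithin_le_nhds).eventually (hU.mem_nhds hxU)
  obtain ⟨I, hI, V', hV', hIV⟩ := mem_nhds_prod_iff.1 hstay
  obtain ⟨ε, hε, hεI⟩ := Metric.mem_nhds_iff.1 hI
  rw [Real.ball_eq_Ioo, zero_sub, zero_add] at hεI
  have h0ε : (0 : ℝ) ∈ Ioo (-ε) ε := ⟨by linarith, hε⟩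
  have hfl : ∀ v ∈ V' ∩ W, ∀ t ∈ Ioo (-ε) ε, flow ϖ H t (σ.map v) = flow ϖ H₀ t (σ.map v) := by
    intro v hv
    exact h.flow_congr h₀ hU hHU (hmem v (hWσ hv.2)) h0ε fun t ht ↦
      hIV (show (t, v) ∈ I ×ˢ V' from ⟨hεI ht, hv.1⟩)
  obtain ⟨τ, ψ, hτ, hψ, hinv, hbox⟩ := h.exists_flowBox hn s σ₁.mem huW (σ₁.transversal u huW)
  have h1 : τ (flow ϖ H 0 (s.map u)) = 0 ∧ ψ (flow ϖ H 0 (s.map u)) = u := hinv.self_of_nhds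
  have hf0 : flow ϖ H 0 (s.map u) = s.map u := h.flow_zero (σ₁.mem u huW)
  rw [hf0] at h1
  have e1 : ∀ᶠ y in 𝓝[energySurface H E] (s.map u), ψ y ∈ V' := by
    refine (hψ.self_of_nhds.continuousAt.eventually ?_).filter_mono nhdsWithin_le_nhds
    rw [h1.2]; exact hV'
  have e2 : ∀ᶠ y in 𝓝[energySurface H E] (s.map u), τ y ∈ Ioo (-ε) ε := by
    refine (hτ.self_of_nhds.continuousAt.eventually ?_).filter_mono nhdsWithin_le_nhds
    rw [h1.1]; exact isOpen_Ioo.mem_nhds h0ε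
  have e3 := eventually_nhdsWithin_iff.1 ((e1.and e2).and hbox)
  filter_upwards [eventually_smallSets_subset.2 e3, eventually_smallSets_subset.2 (hU.mem_nhds hxU)]
    with B hB hBU hBm
  have hB₁ : MeasurableSet (Subtype.val ⁻¹' B : Set (energySurface H E)) :=
    measurable_subtype_coe hBm
  have hB₀ : MeasurableSet (Subtype.val ⁻¹' B : Set (energySurface H₀ E)) :=
    measurable_subtype_coe hBm
  have hk : ∀ y ∈ B, y ∈ energySurface H E → ∃ q : W × ℝ,
      flow ϖ H q.2 (σ.map q.1) = y ∧ flow ϖ H₀ q.2 (σ.map q.1) = y := by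
    intro y hy hyA
    obtain ⟨⟨c1, c2⟩, c3, c4⟩ := hB hy hyA
    exact ⟨(⟨ψ y, c3⟩, τ y), c4, by rw [← hfl _ ⟨c1, c3⟩ _ c2]; exact c4⟩
  have hk₀ : ∀ y ∈ B, y ∈ energySurface H₀ E → ∃ q : W × ℝ,
      flow ϖ H q.2 (σ.map q.1) = y ∧ flow ϖ H₀ q.2 (σ.map q.1) = y := fun y hy hyA ↦
    hk y hy ((hHU (hBU hy)).trans hyA)
  rw [h.liouville_apply_of_subset hn hnt σ₁ hB₁, h₀.liouville_apply_of_subset hn hnt₀ σ₀ hB₀]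
  · have hset : h.sweep σ₁ ⁻¹' (Subtype.val ⁻¹' B) = h₀.sweep σ₀ ⁻¹' (Subtype.val ⁻¹' B) := by
      ext q
      constructor
      · intro hq
        obtain ⟨q', d1, d2⟩ := hk _ hq (Subtype.coe_prop _)
        have d3 : q' = q := h.sweep_injective hnt σ₁ (Subtype.ext d1)
        subst d3
        change flow ϖ H₀ q'.2 (σ.map q'.1) ∈ B
        rw [d2]; exact hq
      · intro hq
        obtain ⟨q', d1, d2⟩ := hk₀ _ hq (Subtype.coe_prop _)
        have d3 : q' = q := h₀.sweep_injective hnt₀ σ₀ (Subtype.ext d2)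
        subst d3
        change flow ϖ H q'.2 (σ.map q'.1) ∈ B
        rw [d1]; exact hq
    rw [hset]
    rfl
  · intro y hy
    obtain ⟨q, -, d2⟩ := hk₀ _ hy y.2
    refine ⟨q.1, ?_⟩
    rw [show y = h₀.flowS q.2 (σ₀.toSurface q.1) from Subtype.ext d2.symm, h₀.orbitProj_flowS]
    rfl
  · intro y hy
    obtain ⟨q, d1, -⟩ := hk _ hy y.2
    refine ⟨q.1, ?_⟩
    rw [show y = h.flowS q.2 (σ₁.toSurface q.1) from Subtype.ext d1.symm, h.orbitProj_flowS]
    rfl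

/-- The Liouville measures of two Hamiltonians agree where the Hamiltonians agree. -/
theorem liouville_eq_of_subset (hn : 1 ≤ n) (hnt : NonTrapping ϖ H E)
    (hnt₀ : NonTrapping ϖ H₀ E) {U : Set M} (hU : IsOpen U) (hHU : EqOn H H₀ U) {B : Set M}
    (hB : MeasurableSet B) (hBU : B ⊆ U) :
    h.liouville (Subtype.val ⁻¹' B) = h₀.liouville (Subtype.val ⁻¹' B) := by
  have key : ∀ x ∈ U, ∃ N : Set M, IsOpen N ∧ x ∈ N ∧
      (h.liouville.map Subtype.val).restrict N = (h₀.liouville.map Subtype.val).restrict N := by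
    intro x hxU
    have hev : ∀ᶠ C in (𝓝 x).smallSets, MeasurableSet C →
        h.liouville (Subtype.val ⁻¹' C) = h₀.liouville (Subtype.val ⁻¹' C) := by
      by_cases hx : x ∈ energySurface H E
      · exact h.eventually_liouville_eq h₀ hn hnt hnt₀ hU hHU hx hxU
      · have hO : IsOpen (U ∩ (energySurface H E)ᶜ) := hU.inter h.isClosed.isOpen_compl
        filter_upwards [eventually_smallSets_subset.2 (hO.mem_nhds ⟨hxU, hx⟩)] with C hC _
        have c1 : (Subtype.val ⁻¹' C : Set (energySurface H E)) = ∅ :=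
          eq_empty_of_forall_notMem fun y hy ↦ (hC hy).2 y.2
        have c2 : (Subtype.val ⁻¹' C : Set (energySurface H₀ E)) = ∅ :=
          eq_empty_of_forall_notMem fun y hy ↦ (hC hy).2 ((hHU (hC hy).1).trans y.2)
        rw [c1, c2, measure_empty, measure_empty]
    obtain ⟨N, hN, hNs⟩ := eventually_smallSets.1 hev
    obtain ⟨O, hON, hO, hxO⟩ := mem_nhds_iff.1 hN
    refine ⟨O, hO, hxO, Measure.ext fun C hC ↦ ?_⟩
    have hCO := hC.inter hO.measurableSet
    rw [Measure.restrict_apply hC, Measure.restrict_apply hC,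
      Measure.map_apply measurable_subtype_coe hCO, Measure.map_apply measurable_subtype_coe hCO]
    exact hNs _ (inter_subset_right.trans hON) hCO
  have h1 := measure_eq_of_locally_eq key hB hBU
  rwa [Measure.map_apply measurable_subtype_coe hB,
    Measure.map_apply measurable_subtype_coe hB] at h1

end RegularLevel

/-! ### Wave operators as measure preserving conjugacies. -/

/-- `W` is locally of the form `Φ_{-t} ∘ Φ⁰_t`, where `t` is far in the direction of `l`
and the points `Φ⁰_t x` lie in the region `U` without interaction. -/
def IsWaveMap (ϖ : SymplecticForm n M) (H₀ H : M → ℝ) (E : ℝ) (U : Set M) (l : Filter ℝ)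
    (W : M → M) : Prop :=
  ∀ x ∈ energySurface H₀ E, ∀ᶠ t in l, ∀ᶠ y in 𝓝[energySurface H₀ E] x,
    flow ϖ H₀ t y ∈ U ∧ W y = flow ϖ H (-t) (flow ϖ H₀ t y)

namespace RegularLevel

variable {ϖ : SymplecticForm n M} {H H₀ : M → ℝ} {E : ℝ} (h : RegularLevel ϖ H E)
  (h₀ : RegularLevel ϖ H₀ E) [T2Space M]

include h h₀

section WaveExistence

/-- The comparison of the two flows does not depend on the time, while the orbit is in `U`. -/
theorem flow_neg_flow_congr {U : Set M} (hU : IsOpen U) (hHU : EqOn H H₀ U) {x : M}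
    (hx : x ∈ energySurface H₀ E) {a b : ℝ} (hflow : ∀ t ∈ Ioo a b, flow ϖ H₀ t x ∈ U)
    {t t' : ℝ} (ht : t ∈ Ioo a b) (ht' : t' ∈ Ioo a b) :
    flow ϖ H (-t') (flow ϖ H₀ t' x) = flow ϖ H (-t) (flow ϖ H₀ t x) := by
  have hz := h₀.flow_mem hx t
  have hzA : flow ϖ H₀ t x ∈ energySurface H E := (hHU (hflow t ht)).trans hz
  have h1 := h₀.flow_congr h hU hHU.symm hz (a := a - t) (b := b - t)
    ⟨by linarith [ht.1], by linarith [ht.2]⟩ (fun s hs ↦ by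
      rw [← h₀.flow_add hx]
      exact hflow _ ⟨by linarith [hs.1], by linarith [hs.2]⟩) (t' - t)
      ⟨by linarith [ht'.1], by linarith [ht'.2]⟩
  rw [← h₀.flow_add hx, sub_add_cancel] at h1
  rw [h1, ← h.flow_add hzA]
  congr 1
  ring

variable [LocallyCompactSpace M]

omit h [T2Space M] in
-- Non-trapping is applied to the union of a compact neighbourhood of x and the interaction region:
-- an orbit starting in the first part cannot be in the second at times |t| ≥ T.
theorem exists_time_flow_mem (hnt₀ : NonTrapping ϖ H₀ E) {U : Set M}
    (hc : IsCompact (energySurface H₀ E ∩ Uᶜ)) (x : M) :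
    ∃ T > 0, ∀ᶠ y in 𝓝[energySurface H₀ E] x, ∀ t : ℝ, T ≤ |t| → flow ϖ H₀ t y ∈ U := by
  obtain ⟨C, hC, hxC⟩ := exists_compact_mem_nhds x
  obtain ⟨T, hT, hK⟩ := hnt₀ ((C ∩ energySurface H₀ E) ∪ (energySurface H₀ E ∩ Uᶜ))
    (union_subset inter_subset_right inter_subset_left) ((hC.inter_right h₀.isClosed).union hc)
  refine ⟨T, hT, ?_⟩
  filter_upwards [nhdsWithin_le_nhds hxC, self_mem_nhdsWithin] with y hy hyA t ht
  by_contra hcon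
  exact hK y (Or.inl ⟨hy, hyA⟩) t ht (Or.inr ⟨h₀.flow_mem hyA t, hcon⟩)

/-- From time T on the free orbit stays in U, so s ↦ Φ_{-s} Φ⁰_s y is constant there and the limit
equals each of these values. The same T serves all y near x. -/
theorem isWaveMap_waveOpPlus (hnt₀ : NonTrapping ϖ H₀ E) {U : Set M} (hU : IsOpen U)
    (hHU : EqOn H H₀ U) (hc : IsCompact (energySurface H₀ E ∩ Uᶜ)) :
    IsWaveMap ϖ H₀ H E U atTop (waveOpPlus ϖ H₀ H) := by
  intro x hx
  obtain ⟨T, hT, hev⟩ := h₀.exists_time_flow_mem hnt₀ hc x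
  filter_upwards [eventually_gt_atTop T] with t ht
  filter_upwards [hev, self_mem_nhdsWithin] with y hy hyA
  refine ⟨hy t (ht.le.trans (le_abs_self t)), ?_⟩
  have : Nonempty M := ⟨y⟩
  refine Tendsto.limUnder_eq (tendsto_const_nhds.congr' ?_)
  filter_upwards [eventually_gt_atTop T] with s hs
  refine h.flow_neg_flow_congr h₀ hU hHU hyA (a := T) (b := max s t + 1) (fun r hr ↦
    hy r (hr.1.le.trans (le_abs_self r))) ⟨hs, by linarith [le_max_left s t]⟩
    ⟨ht, by linarith [le_max_right s t]⟩

theorem isWaveMap_waveOpMinus (hnt₀ : NonTrapping ϖ H₀ E) {U : Set M} (hU : IsOpen U)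
    (hHU : EqOn H H₀ U) (hc : IsCompact (energySurface H₀ E ∩ Uᶜ)) :
    IsWaveMap ϖ H₀ H E U atBot (waveOpMinus ϖ H₀ H) := by
  intro x hx
  obtain ⟨T, hT, hev⟩ := h₀.exists_time_flow_mem hnt₀ hc x
  filter_upwards [eventually_lt_atBot (-T)] with t ht
  filter_upwards [hev, self_mem_nhdsWithin] with y hy hyA
  refine ⟨hy t (by linarith [neg_le_abs t]), ?_⟩
  have : Nonempty M := ⟨y⟩
  refine Tendsto.limUnder_eq (tendsto_const_nhds.congr' ?_)
  filter_upwards [eventually_lt_atBot (-T)] with s hs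
  refine h.flow_neg_flow_congr h₀ hU hHU hyA (a := min s t - 1) (b := -T) (fun r hr ↦
    hy r (by linarith [neg_le_abs r, hr.2])) ⟨by linarith [min_le_left s t], hs⟩
    ⟨by linarith [min_le_right s t], ht⟩

end WaveExistence

section WaveMap

variable {U : Set M} {l : Filter ℝ} [l.NeBot] {W : M → M}
  (hU : IsOpen U) (hHU : EqOn H H₀ U) (hW : IsWaveMap ϖ H₀ H E U l W)

include hHU hW

omit [T2Space M] in
theorem waveMap_mem {x : M} (hx : x ∈ energySurface H₀ E) : W x ∈ energySurface H E := by
  obtain ⟨t, ht⟩ := (hW x hx).exists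
  obtain ⟨h1, h2⟩ := ht.self_of_nhdsWithin hx
  rw [h2]
  exact h.flow_mem ((hHU h1).trans (h₀.flow_mem hx t)) _

theorem waveMap_injOn : InjOn W (energySurface H₀ E) := by
  intro x hx y hy hxy
  obtain ⟨t, ht, ht'⟩ := ((hW x hx).and (hW y hy)).exists
  obtain ⟨h1, h2⟩ := ht.self_of_nhdsWithin hx
  obtain ⟨h3, h4⟩ := ht'.self_of_nhdsWithin hy
  rw [h2, h4] at hxy
  have h5 := congrArg (flow ϖ H t) hxy
  rw [h.flow_flow_neg ((hHU h1).trans (h₀.flow_mem hx t)),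
    h.flow_flow_neg ((hHU h3).trans (h₀.flow_mem hy t))] at h5
  have h6 := congrArg (flow ϖ H₀ (-t)) h5
  rwa [h₀.flow_neg_flow hx, h₀.flow_neg_flow hy] at h6

/-- The formula for W at Φ⁰_s x with time t is compared with the one at x with time t + s; this is
why the filter has to be invariant under shifts. -/
theorem waveMap_flow (hl : ∀ s : ℝ, Tendsto (· + s) l l) {x : M} (hx : x ∈ energySurface H₀ E)
    (s : ℝ) : W (flow ϖ H₀ s x) = flow ϖ H s (W x) := by
  obtain ⟨t, ht, ht'⟩ := (((hl s).eventually (hW x hx)).and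
    (hW _ (h₀.flow_mem hx s))).exists
  obtain ⟨h1, h2⟩ := ht.self_of_nhdsWithin hx
  obtain ⟨h3, h4⟩ := ht'.self_of_nhdsWithin (h₀.flow_mem hx s)
  have h5 : flow ϖ H₀ (t + s) x ∈ energySurface H E := (hHU h1).trans (h₀.flow_mem hx _)
  rw [h2, h4, ← h₀.flow_add hx, ← h.flow_add h5]
  congr 1
  ring

/-- A wave map as a bijection between the energy surfaces. -/
def waveEquiv (hs : W '' energySurface H₀ E = energySurface H E) :
    energySurface H₀ E ≃ energySurface H E :=
  Equiv.ofBijective (fun x ↦ ⟨W x, h.waveMap_mem h₀ hHU hW x.2⟩) <| by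
    constructor
    · intro x y hxy
      exact Subtype.ext (h.waveMap_injOn h₀ hHU hW x.2 y.2 (congrArg Subtype.val hxy))
    · intro y
      obtain ⟨x, hx, hxy⟩ := (congrArg (y.1 ∈ ·) hs).mpr y.2
      exact ⟨⟨x, hx⟩, Subtype.ext hxy⟩

theorem coe_waveEquiv (hs : W '' energySurface H₀ E = energySurface H E)
    (x : energySurface H₀ E) : (h.waveEquiv h₀ hHU hW hs x : M) = W x := rfl

theorem waveEquiv_flowS (hl : ∀ s : ℝ, Tendsto (· + s) l l)
    (hs : W '' energySurface H₀ E = energySurface H E) (s : ℝ) (x : energySurface H₀ E) :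
    h.waveEquiv h₀ hHU hW hs (h₀.flowS s x) = h.flowS s (h.waveEquiv h₀ hHU hW hs x) :=
  Subtype.ext (h.waveMap_flow h₀ hHU hW hl x.2 s)

theorem eventually_waveEquiv (hs : W '' energySurface H₀ E = energySurface H E)
    (x : energySurface H₀ E) : ∃ t, ∀ᶠ y in 𝓝 x, (h₀.flowS t y : M) ∈ U ∧
      (h.flowS t (h.waveEquiv h₀ hHU hW hs y) : M) = h₀.flowS t y := by
  obtain ⟨t, ht⟩ := (hW x x.2).exists
  rw [nhdsWithin_eq_map_subtype_coe x.2, eventually_map] at ht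
  refine ⟨t, ?_⟩
  filter_upwards [ht] with y hy
  refine ⟨hy.1, ?_⟩
  rw [h.coe_flowS, coe_waveEquiv, hy.2]
  exact h.flow_flow_neg ((hHU hy.1).trans (h₀.flow_mem y.2 t)) _

theorem continuous_waveEquiv (hs : W '' energySurface H₀ E = energySurface H E) :
    Continuous (h.waveEquiv h₀ hHU hW hs) := by
  refine continuous_iff_continuousAt.2 fun x ↦ ?_
  obtain ⟨t, ht⟩ := h.eventually_waveEquiv h₀ hHU hW hs x
  have h1 : Tendsto (fun y ↦ h.flowS t (h.waveEquiv h₀ hHU hW hs y)) (𝓝 x)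
      (𝓝 (h.flowS t (h.waveEquiv h₀ hHU hW hs x))) := by
    rw [tendsto_subtype_rng, ht.self_of_nhds.2]
    refine Tendsto.congr' (ht.mono fun y hy ↦ hy.2.symm) ?_
    exact (continuous_subtype_val.comp (h₀.continuous_flowS_apply t)).tendsto x
  have h2 := ((h.continuous_flowS_apply (-t)).tendsto _).comp h1
  simp only [Function.comp_def, h.flowS_neg_flowS] at h2
  exact h2

include hU

/-- Locally the inverse is Φ⁰_{-t} ∘ Φ_t. Near W x the points Φ_t w lie in U, hence also on A₀, and
their images under Φ⁰_{-t} are close to x, where W is given by the local formula. -/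
theorem continuous_waveEquiv_symm (hs : W '' energySurface H₀ E = energySurface H E) :
    Continuous (h.waveEquiv h₀ hHU hW hs).symm := by
  refine continuous_iff_continuousAt.2 fun w ↦ ?_
  obtain ⟨x, rfl⟩ := (h.waveEquiv h₀ hHU hW hs).surjective w
  obtain ⟨t, ht⟩ := h.eventually_waveEquiv h₀ hHU hW hs x
  have hv := ht.self_of_nhds
  have h1 : ∀ᶠ w in 𝓝 (h.waveEquiv h₀ hHU hW hs x), (h.flowS t w : M) ∈ U := by
    refine (continuous_subtype_val.comp (h.continuous_flowS_apply t)).continuousAt.eventually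
      (hU.mem_nhds ?_)
    simp only [Function.comp]
    rw [hv.2]; exact hv.1
  -- the candidate for the inverse, as a map to `M`
  let V : energySurface H E → M := fun w ↦ flow ϖ H₀ (-t) (h.flowS t w)
  have hVA : ∀ w : energySurface H E, (h.flowS t w : M) ∈ U → V w ∈ energySurface H₀ E :=
    fun w hw ↦ h₀.flow_mem ((hHU hw).symm.trans (h.flowS t w).2) _
  have h2 : Tendsto V (𝓝 (h.waveEquiv h₀ hHU hW hs x)) (𝓝[energySurface H₀ E] (x : M)) := by
    have c1 : Tendsto (fun w ↦ (h.flowS t w : M)) (𝓝 (h.waveEquiv h₀ hHU hW hs x))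
        (𝓝[energySurface H₀ E] (h₀.flowS t x : M)) := by
      refine tendsto_nhdsWithin_iff.2 ⟨?_, ?_⟩
      · rw [← hv.2]
        exact (continuous_subtype_val.comp (h.continuous_flowS_apply t)).tendsto _
      · filter_upwards [h1] with w hw
        exact (hHU hw).symm.trans (h.flowS t w).2
    have c2 := (h₀.tendsto_flow (h₀.flowS t x).2 (-t)).comp
      ((tendsto_const_nhds (x := -t)).prodMk c1)
    rw [← h₀.coe_flowS, h₀.flowS_neg_flowS] at c2
    exact c2
  rw [nhdsWithin_eq_map_subtype_coe x.2] at h2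
  have h3 : ∀ᶠ w in 𝓝 (h.waveEquiv h₀ hHU hW hs x), ∃ y : energySurface H₀ E,
      ((h₀.flowS t y : M) ∈ U ∧
        (h.flowS t (h.waveEquiv h₀ hHU hW hs y) : M) = h₀.flowS t y) ∧ (y : M) = V w :=
    h2.eventually (p := fun z ↦ ∃ y : energySurface H₀ E, ((h₀.flowS t y : M) ∈ U ∧
        (h.flowS t (h.waveEquiv h₀ hHU hW hs y) : M) = h₀.flowS t y) ∧ (y : M) = z)
      (eventually_map.2 (ht.mono fun y hy ↦ ⟨y, hy, rfl⟩))
  have h4 : ∀ᶠ w in 𝓝 (h.waveEquiv h₀ hHU hW hs x),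
      V w = ((h.waveEquiv h₀ hHU hW hs).symm w : M) := by
    filter_upwards [h1, h3] with w hw ⟨y, ⟨hy1, hy2⟩, hyw⟩
    have c1 : (h₀.flowS t y : M) = h.flowS t w := by
      rw [h₀.coe_flowS, hyw]
      exact h₀.flow_flow_neg ((hHU hw).symm.trans (h.flowS t w).2) _
    have c2 : h.waveEquiv h₀ hHU hW hs y = w := by
      have := congrArg (h.flowS (-t)) (Subtype.ext (hy2.trans c1))
      rwa [h.flowS_neg_flowS, h.flowS_neg_flowS] at this
    rw [← c2, Equiv.symm_apply_apply, c2, hyw]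
  rw [ContinuousAt, tendsto_subtype_rng, Equiv.symm_apply_apply]
  refine Tendsto.congr' h4 (h2.mono_right ?_)
  rw [← nhdsWithin_eq_map_subtype_coe x.2]
  exact nhdsWithin_le_nhds

/-- A wave map as a homeomorphism between the energy surfaces. -/
def waveHomeo (hs : W '' energySurface H₀ E = energySurface H E) :
    energySurface H₀ E ≃ₜ energySurface H E where
  toEquiv := h.waveEquiv h₀ hHU hW hs
  continuous_toFun := h.continuous_waveEquiv h₀ hHU hW hs
  continuous_invFun := h.continuous_waveEquiv_symm h₀ hU hHU hW hs

theorem coe_waveHomeo (hs : W '' energySurface H₀ E = energySurface H E)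
    (x : energySurface H₀ E) : (h.waveHomeo h₀ hU hHU hW hs x : M) = W x := rfl

theorem waveHomeo_flowS (hl : ∀ s : ℝ, Tendsto (· + s) l l)
    (hs : W '' energySurface H₀ E = energySurface H E) (s : ℝ) (x : energySurface H₀ E) :
    h.waveHomeo h₀ hU hHU hW hs (h₀.flowS s x) = h.flowS s (h.waveHomeo h₀ hU hHU hW hs x) :=
  h.waveEquiv_flowS h₀ hHU hW hl hs s x

/-- Non-trapping is assumed for H₀ only; a homeomorphism conjugating the flows carries it to H. -/
theorem nonTrapping_of_waveMap (hnt₀ : NonTrapping ϖ H₀ E) (hl : ∀ s : ℝ, Tendsto (· + s) l l)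
    (hs : W '' energySurface H₀ E = energySurface H E) : NonTrapping ϖ H E := by
  intro K hK hKc
  let e := h.waveHomeo h₀ hU hHU hW hs
  have h1 : IsCompact (Subtype.val '' (e ⁻¹' (Subtype.val ⁻¹' K))) := by
    refine IsCompact.image (e.isCompact_preimage.2 ?_) continuous_subtype_val
    exact h.isClosed.isClosedEmbedding_subtypeVal.isCompact_preimage hKc
  obtain ⟨T, hT, hT'⟩ := hnt₀ _ (Subtype.coe_image_subset _ _) h1
  refine ⟨T, hT, fun x hx t ht hxt ↦ ?_⟩
  let y : energySurface H₀ E := e.symm ⟨x, hK hx⟩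
  have hy : e y = ⟨x, hK hx⟩ := e.apply_symm_apply _
  refine hT' y ⟨y, ?_, rfl⟩ t ht ⟨h₀.flowS t y, ?_, rfl⟩
  · rw [mem_preimage, hy]; exact hx
  · rw [mem_preimage, h.waveHomeo_flowS h₀ hU hHU hW hl, hy]
    exact hxt

variable [SecondCountableTopology M] [MeasurableSpace M] [BorelSpace M]

/-- The wave maps preserve the Liouville measure. -/
theorem map_waveHomeo_liouville (hn : 1 ≤ n) (hnt₀ : NonTrapping ϖ H₀ E) (hnt : NonTrapping ϖ H E)
    (hs : W '' energySurface H₀ E = energySurface H E) :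
    h₀.liouville.map (h.waveHomeo h₀ hU hHU hW hs) = h.liouville := by
  let e := h.waveHomeo h₀ hU hHU hW hs
  have hem : Measurable e := e.continuous.measurable
  refine Measure.ext fun B hB ↦ measure_eq_of_locally_eq (U := univ) (fun w _ ↦ ?_) hB
    (subset_univ B)
  obtain ⟨x, rfl⟩ := e.surjective w
  obtain ⟨t, ht⟩ := h.eventually_waveEquiv h₀ hHU hW hs x
  obtain ⟨N, hN, hNo, hxN⟩ := eventually_nhds_iff.1 ht
  have heN : IsOpen (e '' N) := e.isOpenMap N hNo
  refine ⟨e '' N, heN, ⟨x, hxN, rfl⟩, Measure.ext fun C hC ↦ ?_⟩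
  rw [Measure.restrict_apply hC, Measure.restrict_apply hC]
  have hCN := hC.inter heN.measurableSet
  generalize hD : C ∩ e '' N = D at hCN
  have hDN : ∀ w ∈ D, ∃ y ∈ N, e y = w := fun w hw ↦ by
    rw [← hD] at hw; exact hw.2
  rw [Measure.map_apply hem hCN]
  -- the image in the region without interaction
  let D' : Set M := Subtype.val '' (h.flowS (-t) ⁻¹' D)
  have hD'm : MeasurableSet D' :=
    h.isClosed.measurableSet.subtype_image ((h.continuous_flowS_apply _).measurable hCN)
  have e1 : h.liouville D = h.liouville (Subtype.val ⁻¹' D') := by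
    conv_lhs => rw [← h.map_flowS_liouville hn hnt (-t),
      Measure.map_apply (h.continuous_flowS_apply _).measurable hCN]
    rw [preimage_image_eq _ Subtype.val_injective]
  have hD'U : ∀ z ∈ D', ∃ y ∈ N, e y ∈ D ∧ (h₀.flowS t y : M) = z := by
    rintro _ ⟨z, hz, rfl⟩
    obtain ⟨y, hy, hyz⟩ := hDN _ hz
    refine ⟨y, hy, hyz ▸ hz, ?_⟩
    rw [← (hN y hy).2]
    have : h.flowS t (e y) = z := by rw [hyz, h.flowS_flowS_neg]
    exact congrArg Subtype.val this
  -- Here D' is Φ_t D. Since Φ_t ∘ W = Φ⁰_t near x, it is also the image of W⁻¹ D under Φ⁰_t, so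
  -- flow invariance moves both volumes to the same subset of U.
  have e2 : h₀.liouville (e ⁻¹' D) = h₀.liouville (Subtype.val ⁻¹' D') := by
    conv_lhs => rw [← h₀.map_flowS_liouville hn hnt₀ (-t),
      Measure.map_apply (h₀.continuous_flowS_apply _).measurable (hem hCN)]
    congr 1
    ext z
    constructor
    · intro hz
      obtain ⟨y, hy, hyz⟩ := hDN _ hz
      have hyz' := e.injective hyz
      refine ⟨h.flowS t (e y), ?_, ?_⟩
      · rw [mem_preimage, h.flowS_neg_flowS, hyz]; exact hz
      · refine (hN y hy).2.trans ?_
        rw [hyz', h₀.flowS_flowS_neg]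
    · intro hz
      obtain ⟨y, hy, hyD, hyz⟩ := hD'U _ hz
      have : h₀.flowS t y = z := Subtype.ext hyz
      rw [mem_preimage, ← this, h₀.flowS_neg_flowS]
      exact hyD
  rw [e1, e2]
  refine (h.liouville_eq_of_subset h₀ hn hnt hnt₀ hU hHU hD'm fun z hz ↦ ?_).symm
  obtain ⟨y, hy, -, hyz⟩ := hD'U _ hz
  exact hyz ▸ (hN y hy).1

end WaveMap

end RegularLevel

/-! ### Measures of displaced sets and exhaustions. -/

/-- The abstract form of the time delay: the difference of the volumes of large sets, transported by
the wave operators, is computed by the displacement of the set `D` under the scattering map. -/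
theorem measure_displacement_eq {Z Y : Type*} [MeasurableSpace Z] [MeasurableSpace Y]
    {μ : Measure Z} {ι Wm Wp : Z → Y} {S : Z → Z}
    (hWp : Measurable Wp) (hS : MeasurePreserving S μ μ) (hWS : ∀ z, Wp (S z) = Wm z)
    (hinj : Function.Injective ι) {D : Set Z} (hD : MeasurableSet D)
    (hQm : MeasurableSet {z | Wm z ≠ ι z}) (hQp : MeasurableSet {z | Wp z ≠ ι z})
    (hfm : μ ({z | Wm z ≠ ι z} \ D) < ⊤) (hfp : μ ({z | Wp z ≠ ι z} ∩ D) < ⊤)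
    {Ω : ℕ → Set Y} (hΩ : Monotone Ω) (hΩm : ∀ k, MeasurableSet (Ω k)) (hΩu : ⋃ k, Ω k = univ)
    (hfι : ∀ k, μ (ι ⁻¹' Ω k) < ⊤) (hfW : ∀ k, μ (Wm ⁻¹' Ω k) < ⊤) {T : ℝ}
    (hT : Tendsto (fun k ↦ (μ (Wm ⁻¹' Ω k)).toReal - (μ (ι ⁻¹' Ω k)).toReal) atTop (𝓝 T)) :
    μ (D \ S ⁻¹' D) < ⊤ ∧ μ (S ⁻¹' D \ D) < ⊤ ∧
      T = (μ (D \ S ⁻¹' D)).toReal - (μ (S ⁻¹' D \ D)).toReal := by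
  have hs1 : ∀ A B C : Set Z, (A \ B) ∩ C = A ∩ (C \ B) := fun A B C ↦ by
    ext z; simp only [mem_inter_iff, Set.mem_sdiff]; tauto
  have hs2 : ∀ A B C : Set Z, (A \ B) \ C = (A \ C) \ B := fun A B C ↦ by
    ext z; simp only [Set.mem_sdiff]; tauto
  have hSD : MeasurableSet (S ⁻¹' D) := hS.measurable hD
  have hlim : ∀ (f : Z → Y) (P : Set Z),
      Tendsto (fun k ↦ μ (f ⁻¹' Ω k ∩ P)) atTop (𝓝 (μ P)) := by
    intro f P
    have h1 : Monotone fun k ↦ f ⁻¹' Ω k ∩ P := fun i j hij ↦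
      inter_subset_inter_left _ (preimage_mono (hΩ hij))
    have h2 := tendsto_measure_iUnion_atTop (μ := μ) h1
    rwa [← iUnion_inter, ← preimage_iUnion, hΩu, preimage_univ, univ_inter] at h2
  have hlimr : ∀ (f : Z → Y) (P : Set Z), μ P < ⊤ →
      Tendsto (fun k ↦ (μ (f ⁻¹' Ω k ∩ P)).toReal) atTop (𝓝 (μ P).toReal) := fun f P hP ↦
    (ENNReal.tendsto_toReal hP.ne).comp (hlim f P)
  -- finiteness of one of the displacements
  have hfin : μ (S ⁻¹' D \ D) < ⊤ := by
    -- A point outside D at which Wm is the inclusion, and whose image S z lies in D where Wp is the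
    -- inclusion, satisfies S z = Wp (S z) = Wm z = z, which is absurd.
    have hsub : S ⁻¹' D \ D ⊆ ({z | Wm z ≠ ι z} \ D) ∪ S ⁻¹' ({z | Wp z ≠ ι z} ∩ D) := by
      rintro z ⟨h1, h2⟩
      by_contra hcon
      rw [mem_union, not_or] at hcon
      have h3 : Wm z = ι z := by
        by_contra h3; exact hcon.1 ⟨h3, h2⟩
      have h4 : Wp (S z) = ι (S z) := by
        by_contra h4; exact hcon.2 ⟨h4, h1⟩
      have h5 : S z = z := hinj (by rw [← h4, hWS, h3])
      rw [mem_preimage, h5] at h1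
      exact h2 h1
    refine (measure_mono hsub).trans_lt ((measure_union_le _ _).trans_lt ?_)
    rw [hS.measure_preimage (hQp.inter hD).nullMeasurableSet]
    exact ENNReal.add_lt_top.2 ⟨hfm, hfp⟩
  have hadd : ∀ {A B : Set Z}, MeasurableSet B → μ A < ⊤ →
      (μ A).toReal = (μ (A ∩ B)).toReal + (μ (A \ B)).toReal := by
    intro A B hB hA
    rw [← ENNReal.toReal_add ((measure_mono inter_subset_left).trans_lt hA).ne
      ((measure_mono sdiff_subset).trans_lt hA).ne, measure_inter_add_sdiff A hB]
  have hWpf : ∀ k, μ (Wp ⁻¹' Ω k) < ⊤ := by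
    intro k
    rw [← hS.measure_preimage (hWp (hΩm k)).nullMeasurableSet, ← preimage_comp,
      show Wp ∘ S = Wm from funext hWS]
    exact hfW k
  -- a map which agrees with `ι` up to a set of finite measure
  have hcmp : ∀ (f : Z → Y) (P : Set Z), MeasurableSet {z | f z ≠ ι z} →
      μ ({z | f z ≠ ι z} ∩ P) < ⊤ → (∀ k, μ (f ⁻¹' Ω k) < ⊤) →
      Tendsto (fun k ↦ (μ (f ⁻¹' Ω k ∩ P)).toReal - (μ (ι ⁻¹' Ω k ∩ P)).toReal) atTop (𝓝 0) := by
    intro f P hm hf hfk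
    have h1 : ∀ k, (μ (f ⁻¹' Ω k ∩ P)).toReal - (μ (ι ⁻¹' Ω k ∩ P)).toReal =
        (μ (f ⁻¹' Ω k ∩ ({z | f z ≠ ι z} ∩ P))).toReal -
          (μ (ι ⁻¹' Ω k ∩ ({z | f z ≠ ι z} ∩ P))).toReal := by
      intro k
      rw [hadd hm ((measure_mono inter_subset_left).trans_lt (hfk k) : μ (f ⁻¹' Ω k ∩ P) < ⊤),
        hadd hm ((measure_mono inter_subset_left).trans_lt (hfι k) : μ (ι ⁻¹' Ω k ∩ P) < ⊤)]
      have h2 : (f ⁻¹' Ω k ∩ P) \ {z | f z ≠ ι z} = (ι ⁻¹' Ω k ∩ P) \ {z | f z ≠ ι z} := by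
        ext z
        simp only [Set.mem_sdiff, mem_inter_iff, mem_preimage, mem_ofPred_eq, not_not]
        constructor
        · rintro ⟨⟨a, b⟩, c⟩; exact ⟨⟨c ▸ a, b⟩, c⟩
        · rintro ⟨⟨a, b⟩, c⟩; exact ⟨⟨c.symm ▸ a, b⟩, c⟩
      have h3 : ∀ A : Set Z, A ∩ P ∩ {z | f z ≠ ι z} = A ∩ ({z | f z ≠ ι z} ∩ P) := fun A ↦ by
        rw [inter_assoc, inter_comm P]
      rw [h2, h3, h3]
      ring
    simp only [h1]
    have h4 := (hlimr f _ hf).sub (hlimr ι _ hf)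
    rwa [sub_self] at h4
  have hp := hcmp Wp D hQp hfp hWpf
  have hm := hcmp Wm Dᶜ hQm hfm hfW
  -- Wm⁻¹ Ω is cut along S⁻¹ D, whose part has the measure of Wp⁻¹ Ω ∩ D by invariance; the rest is
  -- Wm⁻¹ Ω ∩ Dᶜ corrected by the two displacement sets.
  have hid : ∀ k, (μ (Wm ⁻¹' Ω k ∩ (D \ S ⁻¹' D))).toReal =
      ((μ (Wm ⁻¹' Ω k)).toReal - (μ (ι ⁻¹' Ω k)).toReal) -
      ((μ (Wp ⁻¹' Ω k ∩ D)).toReal - (μ (ι ⁻¹' Ω k ∩ D)).toReal) -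
      ((μ (Wm ⁻¹' Ω k ∩ Dᶜ)).toReal - (μ (ι ⁻¹' Ω k ∩ Dᶜ)).toReal) +
      (μ (Wm ⁻¹' Ω k ∩ (S ⁻¹' D \ D))).toReal := by
    intro k
    have a1 := hadd hSD (hfW k)
    have a2 := hadd hD (hfι k)
    have a3 : (μ (Wm ⁻¹' Ω k ∩ S ⁻¹' D)).toReal = (μ (Wp ⁻¹' Ω k ∩ D)).toReal := by
      rw [← hS.measure_preimage ((hWp (hΩm k)).inter hD).nullMeasurableSet, preimage_inter,
        ← preimage_comp, show Wp ∘ S = Wm from funext hWS]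
    have a4 := hadd hD ((measure_mono sdiff_subset).trans_lt (hfW k) : μ (Wm ⁻¹' Ω k \ S ⁻¹' D) < ⊤)
    have a5 := hadd hSD ((measure_mono sdiff_subset).trans_lt (hfW k) : μ (Wm ⁻¹' Ω k \ D) < ⊤)
    rw [hs1, hs2] at a4
    rw [hs1] at a5
    rw [Set.sdiff_eq] at a2
    have a6 : Wm ⁻¹' Ω k \ D = Wm ⁻¹' Ω k ∩ Dᶜ := Set.sdiff_eq _ _
    rw [a6] at a5 a4
    linarith
  have hlim2 : Tendsto (fun k ↦ (μ (Wm ⁻¹' Ω k ∩ (D \ S ⁻¹' D))).toReal) atTop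
      (𝓝 (T - 0 - 0 + (μ (S ⁻¹' D \ D)).toReal)) := by
    simp only [hid]
    exact ((hT.sub hp).sub hm).add (hlimr Wm _ hfin)
  -- Every other term of the identity converges to a finite limit, so this increasing limit is
  -- finite as well.
  have hfin2 : μ (D \ S ⁻¹' D) < ⊤ := by
    have h1 : Tendsto (fun k ↦ μ (Wm ⁻¹' Ω k ∩ (D \ S ⁻¹' D))) atTop
        (𝓝 (ENNReal.ofReal (T - 0 - 0 + (μ (S ⁻¹' D \ D)).toReal))) := by
      refine (ENNReal.tendsto_ofReal hlim2).congr fun k ↦ ?_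
      exact ENNReal.ofReal_toReal ((measure_mono inter_subset_left).trans_lt (hfW k)).ne
    rw [tendsto_nhds_unique (hlim Wm _) h1]
    exact ENNReal.ofReal_lt_top
  refine ⟨hfin2, hfin, ?_⟩
  have h1 := tendsto_nhds_unique (hlimr Wm _ hfin2) hlim2
  rw [h1]
  ring

/-- A second countable locally compact space has an exhaustion by open precompact sets. -/
theorem exists_isExhaustion {M : Type*} [TopologicalSpace M] [T2Space M]
    [SecondCountableTopology M] [LocallyCompactSpace M] : ∃ Ω : ℕ → Set M, IsExhaustion Ω := by
  let K : CompactExhaustion M := default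
  refine ⟨fun k ↦ interior (K k), fun i j hij ↦ interior_mono (K.subset hij),
    fun k ↦ isOpen_interior, fun k ↦ ?_, ?_⟩
  · exact (K.isCompact k).of_isClosed_subset isClosed_closure
      (closure_minimal interior_subset (K.isCompact k).isClosed)
  · refine eq_univ_of_forall fun x ↦ ?_
    obtain ⟨k, hk⟩ := K.exists_mem x
    exact mem_iUnion.2 ⟨k + 1, K.subset_interior_succ k hk⟩

theorem IsExhaustion.eventually_subset {Ω : ℕ → Set M} (hΩ : IsExhaustion Ω) {K : Set M}
    (hK : IsCompact K) : ∀ᶠ k in atTop, K ⊆ Ω k := by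
  obtain ⟨k, hk⟩ := hK.elim_directed_cover Ω hΩ.isOpen (by rw [hΩ.iUnion_eq]; exact subset_univ K)
    hΩ.mono.directed_le
  filter_upwards [eventually_ge_atTop k] with j hj
  exact hk.trans (hΩ.mono hj)

namespace RegularLevel

variable {ϖ : SymplecticForm n M} {H H₀ : M → ℝ} {E : ℝ} (h : RegularLevel ϖ H E)
  (h₀ : RegularLevel ϖ H₀ E) [T2Space M] [SecondCountableTopology M] [MeasurableSpace M]
  [BorelSpace M]

include h h₀

/-- The difference of the Liouville volumes is eventually constant along an exhaustion. -/
theorem eventually_liouville_sub_eq (hn : 1 ≤ n) (hnt : NonTrapping ϖ H E)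
    (hnt₀ : NonTrapping ϖ H₀ E) {U : Set M} (hU : IsOpen U) (hHU : EqOn H H₀ U)
    (hc : IsCompact (energySurface H E ∩ Uᶜ)) (hc₀ : IsCompact (energySurface H₀ E ∩ Uᶜ))
    {Ω : ℕ → Set M} (hΩ : IsExhaustion Ω) :
    ∀ᶠ k in atTop, (h.liouville (Subtype.val ⁻¹' Ω k)).toReal -
      (h₀.liouville (Subtype.val ⁻¹' Ω k)).toReal =
      (h.liouville (Subtype.val ⁻¹' Uᶜ)).toReal - (h₀.liouville (Subtype.val ⁻¹' Uᶜ)).toReal := by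
  filter_upwards [hΩ.eventually_subset hc, hΩ.eventually_subset hc₀] with k hk hk₀
  have key : ∀ {H : M → ℝ} (h : RegularLevel ϖ H E), NonTrapping ϖ H E →
      energySurface H E ∩ Uᶜ ⊆ Ω k → (h.liouville (Subtype.val ⁻¹' Ω k)).toReal =
        (h.liouville (Subtype.val ⁻¹' Uᶜ)).toReal +
          (h.liouville (Subtype.val ⁻¹' (Ω k ∩ U))).toReal := by
    intro H h hnt hk
    have h1 := h.liouville_preimage_lt_top hn hnt (hΩ.isCompact_closure k)
    have e1 : (Subtype.val ⁻¹' Uᶜ : Set (energySurface H E)) =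
        Subtype.val ⁻¹' Ω k \ Subtype.val ⁻¹' U := by
      ext x
      exact ⟨fun hx ↦ ⟨hk ⟨x.2, hx⟩, hx⟩, fun hx ↦ hx.2⟩
    have hUm : MeasurableSet (Subtype.val ⁻¹' U : Set (energySurface H E)) :=
      measurable_subtype_coe hU.measurableSet
    rw [e1, preimage_inter, ← ENNReal.toReal_add ((measure_mono sdiff_subset).trans_lt h1).ne
      ((measure_mono inter_subset_left).trans_lt h1).ne, add_comm, measure_inter_add_sdiff _ hUm]
  rw [key h hnt hk, key h₀ hnt₀ hk₀, h.liouville_eq_of_subset h₀ hn hnt hnt₀ hU hHU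
    ((hΩ.isOpen k).inter hU).measurableSet inter_subset_right]
  ring

end RegularLevel

/-! ### Coordinates given by a global Poincaré section. -/

namespace IsPoincareSection

variable {ϖ : SymplecticForm n M} {H : M → ℝ} {E : ℝ} {Γ : Set M}
  (hΓ : IsPoincareSection ϖ H E Γ)

/-- The inclusion of a Poincaré section into the energy surface. -/
def toSurface (z : Γ) : energySurface H E := ⟨z, hΓ.subset z.2⟩

theorem continuous_toSurface : Continuous hΓ.toSurface :=
  continuous_subtype_val.subtype_mk _

include hΓ

theorem exists_unique_surface (x : energySurface H E) :
    ∃! p : Γ × ℝ, flow ϖ H p.2 p.1.1 = x := by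
  obtain ⟨p, ⟨hp, hpx⟩, hu⟩ := hΓ.existsUnique x x.2
  refine ⟨(⟨p.1, hp⟩, p.2), hpx, fun q hq ↦ ?_⟩
  obtain rfl := hu (q.1.1, q.2) ⟨q.1.2, hq⟩
  rfl

/-- The point of the section on the orbit of `x`. -/
def foot (x : energySurface H E) : Γ := (hΓ.exists_unique_surface x).choose.1

/-- The time from the section to `x`. -/
def time (x : energySurface H E) : ℝ := (hΓ.exists_unique_surface x).choose.2

theorem flow_time_foot (x : energySurface H E) : flow ϖ H (hΓ.time x) (hΓ.foot x).1 = x :=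
  (hΓ.exists_unique_surface x).choose_spec.1

theorem foot_time_unique {x : energySurface H E} {z : Γ} {t : ℝ} (hzt : flow ϖ H t z.1 = x) :
    hΓ.foot x = z ∧ hΓ.time x = t := by
  have h1 := (hΓ.exists_unique_surface x).choose_spec.2 (z, t) hzt
  exact ⟨(congrArg Prod.fst h1).symm, (congrArg Prod.snd h1).symm⟩

end IsPoincareSection

/-- The symplectic volume on a section, with respect to the σ-algebra of `M`. -/
def sectionMeasure [MeasurableSpace M] (ϖ : SymplecticForm n M) (Γ : Set M) : Measure Γ :=
  ⨆ σ : LocalParam n Γ, σ.toPiece.measure ϖ fun u : σ.dom ↦ (⟨σ.map u.1, σ.mem u.1 u.2⟩ : Γ)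

namespace RegularLevel

variable {ϖ : SymplecticForm n M} {H : M → ℝ} {E : ℝ} (h : RegularLevel ϖ H E)
  {Γ : Set M} (hΓ : IsPoincareSection ϖ H E Γ)

include h hΓ

theorem flowS_time_foot (x : energySurface H E) :
    h.flowS (hΓ.time x) (hΓ.toSurface (hΓ.foot x)) = x := Subtype.ext (hΓ.flow_time_foot x)

theorem time_flowS_toSurface (t : ℝ) (z : Γ) : hΓ.time (h.flowS t (hΓ.toSurface z)) = t :=
  (hΓ.foot_time_unique (x := h.flowS t (hΓ.toSurface z)) rfl).2

theorem foot_flowS_toSurface (t : ℝ) (z : Γ) : hΓ.foot (h.flowS t (hΓ.toSurface z)) = z :=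
  (hΓ.foot_time_unique (x := h.flowS t (hΓ.toSurface z)) rfl).1

variable [T2Space M]

theorem time_flowS (t : ℝ) (x : energySurface H E) :
    hΓ.time (h.flowS t x) = t + hΓ.time x := by
  conv_lhs => rw [← h.flowS_time_foot hΓ x, ← h.flowS_add]
  exact h.time_flowS_toSurface hΓ _ _

/-- A local parametrization of a Poincaré section as a local section. -/
def localSectionOfParam (σ : LocalParam n Γ) : LocalSection ϖ H E :=
  h.toLocalSection σ.toPiece (fun u hu ↦ hΓ.subset (σ.mem u hu)) (hΓ.transversal σ) <| by
    intro u hu v hv t ht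
    have h1 := hΓ.foot_time_unique (x := hΓ.toSurface ⟨σ.map v, σ.mem v hv⟩)
      (z := ⟨σ.map u, σ.mem u hu⟩) (t := t) ht
    have h2 := hΓ.foot_time_unique (x := hΓ.toSurface ⟨σ.map v, σ.mem v hv⟩)
      (z := ⟨σ.map v, σ.mem v hv⟩) (t := 0) (h.flow_zero (hΓ.subset (σ.mem v hv)))
    have h3 := σ.isOpenEmbedding.injective (a₁ := ⟨u, hu⟩) (a₂ := ⟨v, hv⟩) (h1.1.symm.trans h2.1)
    exact congrArg Subtype.val h3

theorem bijective_orbitProj_toSurface :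
    Function.Bijective fun z : Γ ↦ orbitProj ϖ H E (hΓ.toSurface z) := by
  constructor
  · intro z w hzw
    obtain ⟨t, ht⟩ := h.orbitProj_eq_iff.1 hzw
    have h1 := h.foot_flowS_toSurface hΓ t z
    have h2 := h.foot_flowS_toSurface hΓ 0 w
    rw [h.flowS_zero] at h2
    rw [← h1, ht, h2]
  · intro y
    refine ⟨hΓ.foot y.rep, ?_⟩
    conv_rhs => rw [← y.orbitProj_rep, ← h.flowS_time_foot hΓ y.rep, h.orbitProj_flowS]

theorem isOpenMap_orbitProj_toSurface (hn : 1 ≤ n) :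
    IsOpenMap fun z : Γ ↦ orbitProj ϖ H E (hΓ.toSurface z) := by
  rw [isOpenMap_iff_nhds_le]
  intro z
  obtain ⟨σ, u, hu, huz⟩ := hΓ.submanifold z z.2
  have e1 := (h.isOpenEmbedding_proj hn (h.localSectionOfParam hΓ σ)).map_nhds_eq ⟨u, hu⟩
  have e2 := σ.isOpenEmbedding.map_nhds_eq ⟨u, hu⟩
  obtain rfl : z = ⟨σ.map u, σ.mem u hu⟩ := Subtype.ext huz.symm
  rw [← e2, map_map]
  exact e1.symm.le

/-- The Poincaré section is homeomorphic to the orbit space. -/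
def sectionHomeo (hn : 1 ≤ n) : Γ ≃ₜ OrbitSpace ϖ H E :=
  (Equiv.ofBijective _ (h.bijective_orbitProj_toSurface hΓ)).toHomeomorphOfContinuousOpen
    (continuous_orbitProj.comp hΓ.continuous_toSurface) (h.isOpenMap_orbitProj_toSurface hΓ hn)

/-- Near the section the time is the function τ of a flow box; elsewhere the flow moves a
neighbourhood to the section and shifts the time by a constant. -/
theorem continuous_time (hn : 1 ≤ n) : Continuous hΓ.time := by
  have key : ∀ z : Γ, ContinuousAt hΓ.time (hΓ.toSurface z) := by
    intro z
    obtain ⟨σ, u, hu, huz⟩ := hΓ.submanifold z z.2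
    obtain ⟨τ, ψ, hτ, -, -, hbox⟩ := h.exists_flowBox hn σ.toPiece
      (fun u hu ↦ hΓ.subset (σ.mem u hu)) hu (hΓ.transversal σ u hu)
    rw [huz, nhdsWithin_eq_map_subtype_coe (hΓ.subset z.2), eventually_map] at hbox
    have h1 : ContinuousAt (fun x : energySurface H E ↦ τ x) (hΓ.toSurface z) := by
      refine ContinuousAt.comp (g := τ) ?_ continuous_subtype_val.continuousAt
      have := hτ.self_of_nhds.continuousAt
      rwa [huz] at this
    refine h1.congr ?_
    filter_upwards [hbox] with x hx
    exact (hΓ.foot_time_unique (x := x) (z := ⟨σ.map (ψ x), σ.mem _ hx.1⟩) hx.2).2.symm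
  refine continuous_iff_continuousAt.2 fun x ↦ ?_
  have h1 : hΓ.time = fun y ↦ hΓ.time x + hΓ.time (h.flowS (-hΓ.time x) y) := by
    funext y
    rw [h.time_flowS hΓ]
    ring
  have h2 : h.flowS (-hΓ.time x) x = hΓ.toSurface (hΓ.foot x) := by
    conv_lhs => rw [← h.flowS_time_foot hΓ x, h.time_flowS_toSurface hΓ, h.flowS_neg_flowS]
  rw [h1]
  refine continuousAt_const.add ?_
  refine ContinuousAt.comp (g := hΓ.time) ?_ (h.continuous_flowS_apply _).continuousAt
  rw [h2]
  exact key _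

variable [SecondCountableTopology M] [MeasurableSpace M] [BorelSpace M]

/-- The volume of a Poincaré section is the volume of the orbit space. -/
theorem map_sectionMeasure (hn : 1 ≤ n) :
    (sectionMeasure ϖ Γ).map (h.sectionHomeo hΓ hn) = reducedVolume ϖ H E := by
  let j := h.sectionHomeo hΓ hn
  let f : ∀ σ : LocalParam n Γ, σ.dom → Γ := fun σ u ↦ ⟨σ.map u.1, σ.mem u.1 u.2⟩
  have hj : Measurable j := j.continuous.measurable
  have hj' : Measurable j.symm := j.symm.continuous.measurable
  have hf : ∀ σ, Measurable (f σ) := fun σ ↦ σ.isOpenEmbedding.continuous.measurable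
  have hjf : ∀ σ, j ∘ f σ = (h.localSectionOfParam hΓ σ).proj := fun σ ↦ rfl
  have hran : ∀ σ : LocalParam n Γ,
      j.symm ⁻¹' range (f σ) = range (h.localSectionOfParam hΓ σ).proj := fun σ ↦
    (j.image_eq_preimage_symm _).symm.trans (range_comp j (f σ)).symm
  have hmap : ∀ σ : LocalParam n Γ, (σ.toPiece.measure ϖ (f σ)).map j =
      (h.localSectionOfParam hΓ σ).toPiece.measure ϖ (h.localSectionOfParam hΓ σ).proj := by
    intro σ
    rw [← hjf]
    exact Measure.map_map hj (hf σ)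
  have hmapB : ∀ (σ : LocalParam n Γ) (B : Set Γ), MeasurableSet B →
      σ.toPiece.measure ϖ (f σ) B = (h.localSectionOfParam hΓ σ).toPiece.measure ϖ
        (h.localSectionOfParam hΓ σ).proj (j.symm ⁻¹' B) := by
    intro σ B hB
    rw [← hmap, Measure.map_apply hj (hj' hB), ← preimage_comp]
    simp
  have hres : ∀ σ : LocalParam n Γ, (sectionMeasure ϖ Γ).restrict (range (f σ)) =
      σ.toPiece.measure ϖ (f σ) := by
    refine iSup_restrict_eq (fun σ : LocalParam n Γ ↦ σ.toPiece.measure ϖ (f σ))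
      (fun σ ↦ range (f σ)) (fun σ ↦ σ.isOpenEmbedding.isOpen_range.measurableSet)
      (fun σ ↦ ?_) (fun σ₁ σ₂ B hB h₁ h₂ ↦ ?_)
    · rw [Piece.measure_apply ϖ _ (hf σ) σ.isOpenEmbedding.isOpen_range.measurableSet.compl,
        preimage_compl, preimage_range, compl_univ, image_empty, Measure.restrict_empty,
        lintegral_zero_measure]
    · rw [hmapB σ₁ B hB, hmapB σ₂ B hB]
      exact h.measure_eq_of_subset_range hn _ _ (hj' hB) (hran σ₁ ▸ preimage_mono h₁)
        (hran σ₂ ▸ preimage_mono h₂)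
  -- On the image of a local parametrization both sides are the measure of that parametrization,
  -- which is at the same time a local section of the flow.
  have hkey : sectionMeasure ϖ Γ = (reducedVolume ϖ H E).map j.symm := by
    refine Measure.ext fun B hB ↦ measure_eq_of_locally_eq (U := univ) (fun z _ ↦ ?_) hB
      (subset_univ B)
    obtain ⟨σ, u, hu, huz⟩ := hΓ.submanifold z z.2
    refine ⟨range (f σ), σ.isOpenEmbedding.isOpen_range, ⟨⟨u, hu⟩, Subtype.ext huz⟩, ?_⟩
    rw [hres, Measure.restrict_map hj' σ.isOpenEmbedding.isOpen_range.measurableSet]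
    rw [hran, h.reducedVolume_restrict_range hn, ← hmap, Measure.map_map hj' hj]
    simp
  rw [hkey, Measure.map_map hj hj']
  simp [j]

/-- The Liouville measure in the coordinates given by a Poincaré section and the time. -/
theorem liouville_apply_section (hn : 1 ≤ n) (hnt : NonTrapping ϖ H E)
    {B : Set (energySurface H E)} (hB : MeasurableSet B) :
    h.liouville B = ∫⁻ z, volume {t : ℝ | h.flowS t (hΓ.toSurface z) ∈ B}
      ∂(sectionMeasure ϖ Γ) := by
  rw [h.liouville_apply hn hnt hB, ← h.map_sectionMeasure hΓ hn,
    lintegral_map (h.measurable_orbitTime hn hnt hB)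
      (h.sectionHomeo hΓ hn).continuous.measurable]
  exact lintegral_congr fun z ↦ h.orbitTime_orbitProj B (hΓ.toSurface z)

end RegularLevel

/-! ### The scattering map and the time delay formula. -/

namespace RegularLevel

variable {ϖ : SymplecticForm n M} {H H₀ : M → ℝ} {E : ℝ} (h : RegularLevel ϖ H E)
  (h₀ : RegularLevel ϖ H₀ E) [T2Space M] {U : Set M} (hU : IsOpen U) (hHU : EqOn H H₀ U)
  {Wp Wm : M → M} (hWp : IsWaveMap ϖ H₀ H E U atTop Wp) (hWm : IsWaveMap ϖ H₀ H E U atBot Wm)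

include h h₀ hU hHU

omit h hHU in
theorem exists_Ioo_flow_mem {x : M} (hx : x ∈ energySurface H₀ E) (hxU : x ∈ U) :
    ∃ ε > 0, ∀ t ∈ Ioo (-ε) ε, flow ϖ H₀ t x ∈ U := by
  have h1 : ContinuousAt (fun t : ℝ ↦ (h₀.flowS t ⟨x, hx⟩ : M)) 0 :=
    (continuous_subtype_val.comp (h₀.continuous_flowS.comp
      (by fun_prop : Continuous fun t : ℝ ↦ (t, (⟨x, hx⟩ : energySurface H₀ E))))).continuousAt
  have h2 : ∀ᶠ t in 𝓝 (0 : ℝ), flow ϖ H₀ t x ∈ U := by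
    refine h1.eventually (hU.mem_nhds ?_)
    change (h₀.flowS 0 ⟨x, hx⟩ : M) ∈ U
    rw [h₀.flowS_zero]
    exact hxU
  obtain ⟨ε, hε, hε'⟩ := Metric.eventually_nhds_iff_ball.1 h2
  rw [Real.ball_eq_Ioo, zero_sub, zero_add] at hε'
  exact ⟨ε, hε, hε'⟩

include hWp in
-- If the forward orbit never leaves U, the comparison Φ_{-t} Φ⁰_t x keeps its value x from time 0
-- on.
theorem waveMap_eq_self_of_forward {x : M} (hx : x ∈ energySurface H₀ E)
    (hxU : ∀ t : ℝ, 0 ≤ t → flow ϖ H₀ t x ∈ U) : Wp x = x := by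
  have hx0 : x ∈ U := by simpa only [h₀.flow_zero hx] using hxU 0 le_rfl
  -- A little room before time 0 is needed, because the comparison of the flows is made on an open
  -- interval of times.
  obtain ⟨ε, hε, hε'⟩ := h₀.exists_Ioo_flow_mem hU hx hx0
  obtain ⟨t, ht, ht0⟩ := ((hWp x hx).and (eventually_ge_atTop 0)).exists
  rw [(ht.self_of_nhdsWithin hx).2, h.flow_neg_flow_congr h₀ hU hHU hx (a := -ε) (b := t + 1)
    (t := 0) (fun s hs ↦ ?_) ⟨by linarith, by linarith⟩ ⟨by linarith, by linarith⟩, neg_zero,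
    h₀.flow_zero hx, h.flow_zero ((hHU hx0).trans hx)]
  rcases le_total 0 s with hs0 | hs0
  · exact hxU s hs0
  · exact hε' s ⟨hs.1, by linarith⟩

include hWm in
theorem waveMap_eq_self_of_backward {x : M} (hx : x ∈ energySurface H₀ E)
    (hxU : ∀ t : ℝ, t ≤ 0 → flow ϖ H₀ t x ∈ U) : Wm x = x := by
  have hx0 : x ∈ U := by simpa only [h₀.flow_zero hx] using hxU 0 le_rfl
  obtain ⟨ε, hε, hε'⟩ := h₀.exists_Ioo_flow_mem hU hx hx0
  obtain ⟨t, ht, ht0⟩ := ((hWm x hx).and (eventually_le_atBot 0)).exists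
  rw [(ht.self_of_nhdsWithin hx).2, h.flow_neg_flow_congr h₀ hU hHU hx (a := t - 1) (b := ε)
    (t := 0) (fun s hs ↦ ?_) ⟨by linarith, by linarith⟩ ⟨by linarith, by linarith⟩, neg_zero,
    h₀.flow_zero hx, h.flow_zero ((hHU hx0).trans hx)]
  rcases le_total s 0 with hs0 | hs0
  · exact hxU s hs0
  · exact hε' s ⟨by linarith, hs.2⟩

variable {Γ : Set M} (hΓ : IsPoincareSection ϖ H₀ E Γ)

include hWp hWm hΓ in
/-- After the section the incoming wave operator differs from the identity only on a compact set,
and likewise before the section for the outgoing one. -/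
theorem exists_isCompact_waveMap_eq (hn : 1 ≤ n) (hc₀ : IsCompact (energySurface H₀ E ∩ Uᶜ)) :
    ∃ C : Set (energySurface H₀ E), IsCompact C ∧
      (∀ x : energySurface H₀ E, Wp x ≠ x → 0 ≤ hΓ.time x → x ∈ C) ∧
      ∀ x : energySurface H₀ E, Wm x ≠ x → hΓ.time x < 0 → x ∈ C := by
  let K : Set (energySurface H₀ E) := Subtype.val ⁻¹' Uᶜ
  have hK : IsCompact K := by
    have := h₀.isClosed.isClosedEmbedding_subtypeVal.isCompact_preimage hc₀
    rwa [preimage_inter, Subtype.coe_preimage_self, univ_inter] at this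
  -- The section time is bounded by q on the interaction region K. A point with nonnegative time
  -- moved by W₊ meets K at some s ≥ 0 with s + time ≤ q, so 0 ≤ s ≤ q and the point lies in the
  -- compact set Φ⁰_{[-q, q]} K. Points before the section are treated symmetrically.
  obtain ⟨q, hq⟩ := hK.exists_bound_of_continuousOn (h₀.continuous_time hΓ hn).continuousOn
  have hmem : ∀ (x : energySurface H₀ E) (s : ℝ), h₀.flowS s x ∈ K → -q ≤ -s → -s ≤ q →
      x ∈ (fun p : ℝ × energySurface H₀ E ↦ h₀.flowS p.1 p.2) '' (Icc (-q) q ×ˢ K) :=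
    fun x s hs h1 h2 ↦ ⟨(-s, h₀.flowS s x), ⟨⟨h1, h2⟩, hs⟩, h₀.flowS_neg_flowS s x⟩
  have hb : ∀ (x : energySurface H₀ E) (s : ℝ), h₀.flowS s x ∈ K →
      -q ≤ s + hΓ.time x ∧ s + hΓ.time x ≤ q := by
    intro x s hs
    have := hq _ hs
    rw [h₀.time_flowS hΓ, Real.norm_eq_abs] at this
    exact abs_le.1 this
  refine ⟨_, ((isCompact_Icc (a := -q) (b := q)).prod hK).image h₀.continuous_flowS, fun x hx hxt ↦ ?_,
    fun x hx hxt ↦ ?_⟩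
  · obtain ⟨s, hs, hsU⟩ : ∃ s : ℝ, 0 ≤ s ∧ flow ϖ H₀ s x ∉ U := by
      by_contra! hcon
      exact hx (h.waveMap_eq_self_of_forward h₀ hU hHU hWp x.2 hcon)
    obtain ⟨h1, h2⟩ := hb x s hsU
    exact hmem x s hsU (by linarith) (by linarith)
  · obtain ⟨s, hs, hsU⟩ : ∃ s : ℝ, s ≤ 0 ∧ flow ϖ H₀ s x ∉ U := by
      by_contra! hcon
      exact hx (h.waveMap_eq_self_of_backward h₀ hU hHU hWm x.2 hcon)
    obtain ⟨h1, h2⟩ := hb x s hsU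
    exact hmem x s hsU (by linarith) (by linarith)

variable (hsp : Wp '' energySurface H₀ E = energySurface H E)
  (hsm : Wm '' energySurface H₀ E = energySurface H E)

/-- The scattering map as a homeomorphism of the energy surface. -/
def scatteringHomeo : energySurface H₀ E ≃ₜ energySurface H₀ E :=
  (h.waveHomeo h₀ hU hHU hWm hsm).trans (h.waveHomeo h₀ hU hHU hWp hsp).symm

theorem waveHomeo_scatteringHomeo (x : energySurface H₀ E) :
    h.waveHomeo h₀ hU hHU hWp hsp (h.scatteringHomeo h₀ hU hHU hWp hWm hsp hsm x) =
      h.waveHomeo h₀ hU hHU hWm hsm x := by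
  simp [scatteringHomeo]

theorem scatteringHomeo_flowS (t : ℝ) (x : energySurface H₀ E) :
    h.scatteringHomeo h₀ hU hHU hWp hWm hsp hsm (h₀.flowS t x) =
      h₀.flowS t (h.scatteringHomeo h₀ hU hHU hWp hWm hsp hsm x) := by
  refine (h.waveHomeo h₀ hU hHU hWp hsp).injective ?_
  rw [h.waveHomeo_scatteringHomeo h₀, h.waveHomeo_flowS h₀ hU hHU hWm
    (fun s ↦ tendsto_atBot_add_const_right _ s tendsto_id), h.waveHomeo_flowS h₀ hU hHU hWp
    (fun s ↦ tendsto_atTop_add_const_right _ s tendsto_id), h.waveHomeo_scatteringHomeo h₀]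

theorem coe_scatteringHomeo (hWp : IsWaveMap ϖ H₀ H E U atTop (waveOpPlus ϖ H₀ H))
    (hWm : IsWaveMap ϖ H₀ H E U atBot (waveOpMinus ϖ H₀ H))
    (hsp : waveOpPlus ϖ H₀ H '' energySurface H₀ E = energySurface H E)
    (hsm : waveOpMinus ϖ H₀ H '' energySurface H₀ E = energySurface H E)
    (x : energySurface H₀ E) :
    (h.scatteringHomeo h₀ hU hHU hWp hWm hsp hsm x : M) = scatteringMap ϖ H₀ H E x := by
  have : Nonempty M := ⟨x⟩
  have h1 := congrArg Subtype.val (h.waveHomeo_scatteringHomeo h₀ hU hHU hWp hWm hsp hsm x)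
  rw [h.coe_waveHomeo, h.coe_waveHomeo] at h1
  rw [scatteringMap, ← h1]
  exact ((h.waveMap_injOn h₀ hHU hWp).leftInvOn_invFunOn
    (h.scatteringHomeo h₀ hU hHU hWp hWm hsp hsm x).2).symm

variable [SecondCountableTopology M] [LocallyCompactSpace M] [MeasurableSpace M] [BorelSpace M]

/-- The time delay computes the regularized difference of the volumes. -/
theorem integral_timeDelay (hn : 1 ≤ n) (hnt₀ : NonTrapping ϖ H₀ E) (hnt : NonTrapping ϖ H E)
    (hc : IsCompact (energySurface H E ∩ Uᶜ)) (hc₀ : IsCompact (energySurface H₀ E ∩ Uᶜ))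
    {τ : Γ → ℝ} (hτ : ∀ z, hΓ.time (h.scatteringHomeo h₀ hU hHU hWp hWm hsp hsm
      (hΓ.toSurface z)) = -τ z) :
    Integrable τ (sectionMeasure ϖ Γ) ∧
      (h.liouville (Subtype.val ⁻¹' Uᶜ)).toReal - (h₀.liouville (Subtype.val ⁻¹' Uᶜ)).toReal =
        ∫ z, τ z ∂(sectionMeasure ϖ Γ) := by
  let ep := h.waveHomeo h₀ hU hHU hWp hsp
  let em := h.waveHomeo h₀ hU hHU hWm hsm
  let S := h.scatteringHomeo h₀ hU hHU hWp hWm hsp hsm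
  have hmp : MeasurePreserving ep h₀.liouville h.liouville := ⟨ep.continuous.measurable,
    h.map_waveHomeo_liouville h₀ hU hHU hWp hn hnt₀ hnt hsp⟩
  have hmm : MeasurePreserving em h₀.liouville h.liouville := ⟨em.continuous.measurable,
    h.map_waveHomeo_liouville h₀ hU hHU hWm hn hnt₀ hnt hsm⟩
  have hS : MeasurePreserving S h₀.liouville h₀.liouville :=
    (hmp.symm ep.toMeasurableEquiv).comp hmm
  have htc := h₀.continuous_time hΓ hn
  let D : Set (energySurface H₀ E) := {x | 0 ≤ hΓ.time x}
  have hD : MeasurableSet D := (isClosed_le continuous_const htc).measurableSet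
  obtain ⟨C, hC, hCp, hCm⟩ := h.exists_isCompact_waveMap_eq h₀ hU hHU hWp hWm hΓ hn hc₀
  have := h₀.isLocallyFiniteMeasure_liouville hn hnt₀
  have hCf : h₀.liouville C < ⊤ := hC.measure_lt_top
  have hcp : Continuous fun z : energySurface H₀ E ↦ Wp z :=
    continuous_subtype_val.comp ep.continuous
  have hcm : Continuous fun z : energySurface H₀ E ↦ Wm z :=
    continuous_subtype_val.comp em.continuous
  -- Any exhaustion serves, since the limit does not depend on it.
  obtain ⟨Ω, hΩ⟩ := exists_isExhaustion (M := M)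
  have hWΩ : ∀ k, h₀.liouville ((fun z : energySurface H₀ E ↦ Wm z) ⁻¹' Ω k) =
      h.liouville (Subtype.val ⁻¹' Ω k) := fun k ↦
    hmm.measure_preimage
      (measurable_subtype_coe (hΩ.isOpen k).measurableSet).nullMeasurableSet
  have hlim := tendsto_const_nhds.congr' <| (h.eventually_liouville_sub_eq h₀ hn hnt hnt₀ hU hHU
    hc hc₀ hΩ).mono fun k hk ↦ hk.symm
  obtain ⟨hf1, hf2, hT⟩ := measure_displacement_eq (ι := Subtype.val)
    (Wm := fun z : energySurface H₀ E ↦ Wm z) (Wp := fun z : energySurface H₀ E ↦ Wp z) hcp.measurable hS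
    (fun z ↦ congrArg Subtype.val (h.waveHomeo_scatteringHomeo h₀ hU hHU hWp hWm hsp hsm z))
    Subtype.val_injective hD
    (isClosed_eq hcm continuous_subtype_val).isOpen_compl.measurableSet
    (isClosed_eq hcp continuous_subtype_val).isOpen_compl.measurableSet
    ((measure_mono fun x hx ↦ hCm x hx.1 (not_le.1 hx.2)).trans_lt hCf)
    ((measure_mono fun x hx ↦ hCp x hx.1 hx.2).trans_lt hCf)
    hΩ.mono (fun k ↦ (hΩ.isOpen k).measurableSet) hΩ.iUnion_eq
    (fun k ↦ h₀.liouville_preimage_lt_top hn hnt₀ (hΩ.isCompact_closure k))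
    (fun k ↦ hWΩ k ▸ h.liouville_preimage_lt_top hn hnt (hΩ.isCompact_closure k))
    (hlim.congr fun k ↦ by rw [hWΩ])
  have hSt : ∀ (z : Γ) (t : ℝ), hΓ.time (S (h₀.flowS t (hΓ.toSurface z))) = t - τ z := by
    intro z t
    rw [h.scatteringHomeo_flowS h₀, h₀.time_flowS hΓ, hτ, sub_eq_add_neg]
  have hSD : MeasurableSet (S ⁻¹' D) := S.continuous.measurable hD
  -- On the orbit of z the section time is t before scattering and t - τ z after it, so the orbit
  -- meets this set exactly for 0 ≤ t < τ z, and the opposite difference for τ z ≤ t < 0.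
  have e1 : h₀.liouville (D \ S ⁻¹' D) = ∫⁻ z, ENNReal.ofReal (τ z) ∂(sectionMeasure ϖ Γ) := by
    rw [h₀.liouville_apply_section hΓ hn hnt₀ (hD.diff hSD)]
    refine lintegral_congr fun z ↦ ?_
    rw [← sub_zero (τ z), ← Real.volume_Ico]
    congr 1
    ext t
    change (0 ≤ hΓ.time _ ∧ ¬ 0 ≤ hΓ.time (S _)) ↔ 0 ≤ t ∧ t < τ z
    rw [hSt, h₀.time_flowS_toSurface hΓ, sub_nonneg, not_le]
  have e2 : h₀.liouville (S ⁻¹' D \ D) = ∫⁻ z, ENNReal.ofReal (-τ z) ∂(sectionMeasure ϖ Γ) := by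
    rw [h₀.liouville_apply_section hΓ hn hnt₀ (hSD.diff hD)]
    refine lintegral_congr fun z ↦ ?_
    rw [← zero_sub (τ z), ← Real.volume_Ico]
    congr 1
    ext t
    change (0 ≤ hΓ.time (S _) ∧ ¬ 0 ≤ hΓ.time _) ↔ τ z ≤ t ∧ t < 0
    rw [hSt, h₀.time_flowS_toSurface hΓ, sub_nonneg, not_le]
  have hτm : Measurable τ := by
    have h1 : τ = fun z ↦ -hΓ.time (S (hΓ.toSurface z)) := by
      funext z
      rw [hτ, neg_neg]
    rw [h1]
    exact (htc.comp (S.continuous.comp hΓ.continuous_toSurface)).neg.measurable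
  have hint : Integrable τ (sectionMeasure ϖ Γ) := by
    refine ⟨hτm.aestronglyMeasurable, ?_⟩
    have h1 : ∀ r : ℝ, ‖r‖ₑ = ENNReal.ofReal r + ENNReal.ofReal (-r) := fun r ↦ by
      rcases le_total 0 r with hr | hr
      · rw [Real.enorm_eq_ofReal hr, ENNReal.ofReal_of_nonpos (neg_nonpos.2 hr), add_zero]
      · rw [← enorm_neg, Real.enorm_eq_ofReal (neg_nonneg.2 hr), ENNReal.ofReal_of_nonpos hr,
          zero_add]
    simp only [HasFiniteIntegral, h1]
    rw [lintegral_add_left hτm.ennreal_ofReal, ← e1, ← e2]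
    exact ENNReal.add_lt_top.2 ⟨hf1, hf2⟩
  refine ⟨hint, ?_⟩
  rw [hT, e1, e2, integral_eq_lintegral_pos_part_sub_lintegral_neg_part hint]

end RegularLevel

/-- The σ-algebra induced from M and the Borel σ-algebra of Γ are equal but not definitionally so;
the statement is transported along this equality. -/
theorem sectionVolume_eq_sectionMeasure [MeasurableSpace M] [BorelSpace M]
    (ϖ : SymplecticForm n M) {Γ : Set M} (τ : Γ → ℝ)
    (hint : Integrable τ (sectionMeasure ϖ Γ)) :
    @Integrable _ _ _ _ (borel Γ) τ (sectionVolume ϖ Γ) ∧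
      ∫ z, τ z ∂(sectionMeasure ϖ Γ) = @integral _ _ _ _ (borel Γ) (sectionVolume ϖ Γ) τ := by
  have key : ∀ m : MeasurableSpace Γ, m = borel Γ →
      @Integrable _ _ _ _ m τ (⨆ σ : LocalParam n Γ,
        @Piece.measure n M _ _ _ ϖ σ.toPiece Γ m fun u : σ.dom ↦ ⟨σ.map u.1, σ.mem u.1 u.2⟩) →
      @Integrable _ _ _ _ (borel Γ) τ (sectionVolume ϖ Γ) ∧
        @integral _ _ _ _ m (⨆ σ : LocalParam n Γ,
          @Piece.measure n M _ _ _ ϖ σ.toPiece Γ m fun u : σ.dom ↦ ⟨σ.map u.1, σ.mem u.1 u.2⟩) τ =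
        @integral _ _ _ _ (borel Γ) (sectionVolume ϖ Γ) τ := by
    rintro _ rfl hm
    exact ⟨hm, rfl⟩
  exact key _ BorelSpace.measurable_eq hint

end HamScattering

end

/-! ### The main theorem. -/

theorem mainTheorem3 (n : ℕ) (hn : 1 ≤ n)
    {M : Type*} [TopologicalSpace M] [T2Space M] [SecondCountableTopology M] [NoncompactSpace M]
    [ChartedSpace (Eucl (2 * n)) M] [IsManifold (𝓡 (2 * n)) ∞ M]
    (ϖ : SymplecticForm n M) (H₀ H : M → ℝ)
    (hH₀ : ContMDiff (𝓡 (2 * n)) 𝓘(ℝ, ℝ) ∞ H₀) (hH : ContMDiff (𝓡 (2 * n)) 𝓘(ℝ, ℝ) ∞ H)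
    (E : ℝ) (hass : ScatteringAssumption ϖ H₀ H E) (hcompl : Completeness ϖ H₀ H E) :
    ∃ T : ℝ,
      (∀ Ω : ℕ → Set M, IsExhaustion Ω →
        (∀ k,
          (∀ x ∈ energySurface H₀ E,
            Integrable fun t : ℝ ↦ (Ω k).indicator (fun _ ↦ (1 : ℝ)) (flow ϖ H₀ t x)) ∧
          (∀ x ∈ energySurface H E,
            Integrable fun t : ℝ ↦ (Ω k).indicator (fun _ ↦ (1 : ℝ)) (flow ϖ H t x)) ∧
          Integrable (reducedSojourn ϖ H₀ E (Ω k)) (reducedVolume ϖ H₀ E) ∧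
          Integrable (reducedSojourn ϖ H E (Ω k)) (reducedVolume ϖ H E)) ∧
        Tendsto (fun k ↦
            (∫ y, reducedSojourn ϖ H E (Ω k) y ∂(reducedVolume ϖ H E)) -
              ∫ y, reducedSojourn ϖ H₀ E (Ω k) y ∂(reducedVolume ϖ H₀ E))
          atTop (𝓝 T)) ∧
      (∀ Γ : Set M, IsPoincareSection ϖ H₀ E Γ →
        (∃ (s : Γ → Γ) (τ : Γ → ℝ), IsTimeDelay ϖ H₀ H E Γ s τ) ∧
        ∀ (s : Γ → Γ) (τ : Γ → ℝ), IsTimeDelay ϖ H₀ H E Γ s τ →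
          @Integrable _ _ _ _ (borel Γ) τ (sectionVolume ϖ Γ) ∧
          T = @integral _ _ _ _ (borel Γ) (sectionVolume ϖ Γ) τ) := by
  borelize M
  have : LocallyCompactSpace M := ChartedSpace.locallyCompactSpace (Eucl (2 * n)) M
  have h₀ : RegularLevel ϖ H₀ E := ⟨hH₀, hass.regular₀, hass.complete₀⟩
  have h : RegularLevel ϖ H E := ⟨hH, hass.regular, hass.complete⟩
  let U : Set M := (tsupport fun x ↦ H x - H₀ x)ᶜ
  have hU : IsOpen U := (isClosed_tsupport _).isOpen_compl
  have hHU : EqOn H H₀ U := fun x hx ↦ sub_eq_zero.1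
    (image_eq_zero_of_notMem_tsupport (f := fun x ↦ H x - H₀ x) hx)
  have hnt₀ : NonTrapping ϖ H₀ E := hass.nontrapping
  have hc : IsCompact (energySurface H E ∩ Uᶜ) :=
    hass.compact.of_isClosed_subset (h.isClosed.inter hU.isClosed_compl)
      fun x hx ↦ ⟨le_of_eq hx.1, not_not.1 hx.2⟩
  have hc₀ : IsCompact (energySurface H₀ E ∩ Uᶜ) :=
    hass.compact₀.of_isClosed_subset (h₀.isClosed.inter hU.isClosed_compl)
      fun x hx ↦ ⟨le_of_eq hx.1, not_not.1 hx.2⟩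
  have hWp := h.isWaveMap_waveOpPlus h₀ hnt₀ hU hHU hc₀
  have hWm := h.isWaveMap_waveOpMinus h₀ hnt₀ hU hHU hc₀
  have hnt : NonTrapping ϖ H E := h.nonTrapping_of_waveMap h₀ hU hHU hWp hnt₀
    (fun s ↦ tendsto_atTop_add_const_right _ s tendsto_id) hcompl.1
  -- T_E is the difference of the Liouville volumes of the two compact interaction regions; every
  -- exhaustion eventually produces exactly this value.
  refine ⟨(h.liouville (Subtype.val ⁻¹' Uᶜ)).toReal - (h₀.liouville (Subtype.val ⁻¹' Uᶜ)).toReal,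
    fun Ω hΩ ↦ ⟨fun k ↦ ?_, ?_⟩, fun Γ hΓ ↦ ⟨?_, fun s τ hτ ↦ ?_⟩⟩
  · exact ⟨fun x hx ↦ h₀.integrable_indicator_flow hnt₀ (hΩ.isOpen k) (hΩ.isCompact_closure k) hx,
      fun x hx ↦ h.integrable_indicator_flow hnt (hΩ.isOpen k) (hΩ.isCompact_closure k) hx,
      (h₀.integrable_reducedSojourn hn hnt₀ (hΩ.isOpen k) (hΩ.isCompact_closure k)).1,
      (h.integrable_reducedSojourn hn hnt (hΩ.isOpen k) (hΩ.isCompact_closure k)).1⟩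
  · refine tendsto_const_nhds.congr' ?_
    filter_upwards [h.eventually_liouville_sub_eq h₀ hn hnt hnt₀ hU hHU hc hc₀ hΩ] with k hk
    rw [← hk, (h₀.integrable_reducedSojourn hn hnt₀ (hΩ.isOpen k) (hΩ.isCompact_closure k)).2,
      (h.integrable_reducedSojourn hn hnt (hΩ.isOpen k) (hΩ.isCompact_closure k)).2]
  · let S := h.scatteringHomeo h₀ hU hHU hWp hWm hcompl.1 hcompl.2
    refine ⟨fun z ↦ hΓ.foot (S (hΓ.toSurface z)), fun z ↦ -hΓ.time (S (hΓ.toSurface z)),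
      fun z t ↦ ?_⟩
    refine (h.coe_scatteringHomeo h₀ hU hHU hWp hWm hcompl.1 hcompl.2
      (h₀.flowS t (hΓ.toSurface z))).symm.trans ?_
    rw [h.scatteringHomeo_flowS h₀, ← h₀.flowS_time_foot hΓ (h.scatteringHomeo _ _ _ _ _ _ _ _),
      ← h₀.flowS_add, sub_neg_eq_add]
    rfl
  -- For any admissible pair (s, τ), taking t = 0 gives S z = Φ⁰_{-τ z} (s z), so uniqueness of the
  -- section coordinates forces the time of S z to be -τ z.
  · obtain ⟨hint, hT⟩ := h.integral_timeDelay h₀ hU hHU hWp hWm hΓ hcompl.1 hcompl.2 hn hnt₀ hnt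
      hc hc₀ (τ := τ) (fun z ↦ by
        refine (hΓ.foot_time_unique (z := s z) ?_).2
        rw [h.coe_scatteringHomeo h₀, ← zero_sub, ← hτ z 0, h₀.flow_zero (hΓ.subset z.2)]
        rfl)
    obtain ⟨h1, h2⟩ := sectionVolume_eq_sectionMeasure ϖ τ hint
    exact ⟨h1, hT.trans h2⟩
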